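/- Let $X=(X_t)_{t\in[0,1]}$ be a continuous, centered, $\mathbb R^d$-valued Gaussian process ($d\ge 1$) with $X_0=0$ and i.i.d. components, and let $R(s,t)=\mathbb E[X^j_sX^j_t]$ be its covariance function, with rectangular increments $R^{st}_{uv}=\mathbb E[(X^j_t-X^j_s)(X^j_v-X^j_u)]$. Assume: 1. for some $\rho\in[1,2)$, $R$ has finite mixed $(1,\rho)$-variation on $[0,1]^2$: $$\sup_{(t_i),(t'_j)}\Big(\sum_j\Big(\sum_i\big|R^{t'_jt'_{j+1}}_{t_it_{i+1}}\big|\Big)^{\rho}\Big)^{1/\rho}<\infty ,$$ the supremum being over all dissections $(t_i),(t'_j)$ of $[0,1]$; 2. for all $t_1<t_2<t_3<t_4$ in $[0,1]$, $R^{t_3t_4}_{t_1t_2}\le 0$ and $R^{t_1t_4}_{t_2t_3}\ge 0$; 3. with $\mathcal F_{a,b}=\sigma(X_v-X_u: a\le u\le v\le b)$, there is $\alpha>0$ such that, for each component $j$, $$\inf_{0\le s<t\le 1}(t-s)^{-\alpha}\,\mathrm{Var}\big(X^j_t-X^j_s\,\big|\,\mathcal F_{0,s}\vee\mathcal F_{t,1}\big)>0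 .$$ Let $V_0,V_1,\dots,V_d:\mathbb R^n\to\mathbb R^n$ be $C^\infty$ vector fields, bounded together with all their derivatives, such that $V_1,\dots,V_d$ are uniformly elliptic: for some $\lambda>0$, $\sum_{j=1}^d\langle V_j(x),v\rangle^2\ge\lambda|v|^2$ for all $x,v\in\mathbb R^n$. Let $z\in\mathbb R^n$, and let $\bar{\mathcal H}$ be the Cameron–Martin space of $X$, that is, the Hilbert space of $\mathbb R^d$-valued paths on $[0,1]$ with reproducing kernel $R(s,t)\,\mathrm{Id}_d$. Then, for every $h\in\bar{\mathcal H}$, the Young differential equation $$\Phi_t(h)=z+\int_0^tV_0(\Phi_s(h))\,ds+\sum_{i=1}^d\int_0^tV_i(\Phi_s(h))\,dh^i_s,\qquad t\in[0,1],$$ has a unique solution among the continuous paths that have finite $p$-variation for some $p<2$; the map $\Phi_1:\bar{\mathcal H}\to\mathbb R^n$ is Fréchet differentiable; and for every $h\in\bar{\mathcal H}$ the deterministic Malliavin matrix $$\gamma^{ij}_{\Phi_1(h)}=\langle \mathbf D\Phi^i_1(h),\mathbf D\Phi^j_1(h)\rangle$$ is non-degenerate, $\det\gamma_{\Phi_1(h)}>0$.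 Here $\mathbf D\Phi_1^i(h)$ is the Riesz representative of the derivative of $\Phi_1^i$ at $h$; it may be taken in $\bar{\mathcal H}$ or, through the canonical isometry sending $\mathbf 1_{[0,t]}u$ to $R(t,\cdot)u$ ($u\in\mathbb R^d$), in the completion $\mathcal H$ of the $\mathbb R^d$-valued step functions. Consequently, with $\inf\emptyset=+\infty$, for every $y\in\mathbb R^n$ the two quantities $$d^2(y)=\inf_{h\in\bar{\mathcal H},\ \Phi_1(h)=y}\tfrac12\|h\|^2_{\bar{\mathcal H}},\qquad d_R^2(y)=\inf_{h\in\bar{\mathcal H},\ \Phi_1(h)=y,\ \det\gamma_{\Phi_1(h)}>0}\tfrac12\|h\|^2_{\bar{\mathcal H}}$$ are equal: $d^2(y)=d_R^2(y)$. -/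

import Mathlib

open MeasureTheory ProbabilityTheory Set
open scoped ENNReal InnerProductSpace

noncomputable section

namespace GaussVaradhan

/-! ### The driving Gaussian process and its covariance -/

/-- `X` is a continuous, centered, `ℝ^d`-valued Gaussian process on `[0,1]`, defined on `(Ω, P)`,
whose `d` components are independent and identically distributed (as processes). -/
class IsContinuousCenteredGaussianIID {Ω : Type*} [MeasurableSpace Ω] {d : ℕ}
    (X : unitInterval → Ω → EuclideanSpace ℝ (Fin d)) (P : Measure Ω) : Prop where
  measurable : ∀ t, Measurable (X t)
  continuous : ∀ᵐ ω ∂P, Continuous fun t => X t ω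
  gaussian : IsGaussianProcess X P
  centered : ∀ t j, ∫ ω, X t ω j ∂P = 0
  indep : iIndepFun (fun (j : Fin d) (ω : Ω) (t : unitInterval) => X t ω j) P
  identDistrib : ∀ i j : Fin d,
    IdentDistrib (fun (ω : Ω) (t : unitInterval) => X t ω i)
      (fun (ω : Ω) (t : unitInterval) => X t ω j) P P

/-- The covariance function `R(s,t) = E[X_s^j X_t^j]`. The components being identically
distributed, the choice of `j` is immaterial; we take the first one. -/
def covFun {Ω : Type*} [MeasurableSpace Ω] {d : ℕ} [NeZero d]
    (X : unitInterval → Ω → EuclideanSpace ℝ (Fin d)) (P : Measure Ω)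
    (s t : unitInterval) : ℝ :=
  ∫ ω, X s ω 0 * X t ω 0 ∂P

/-- The rectangular increment of `R` over `[s,t] × [u,v]`; when `R` is the covariance of `X`,
it is `E[(X_t^j - X_s^j) (X_v^j - X_u^j)]`. -/
def rectIncr (R : unitInterval → unitInterval → ℝ) (s t u v : unitInterval) : ℝ :=
  R t v - R t u - R s v + R s u

/-- `t 0 ≤ t 1 ≤ … ≤ t n` is a dissection of `[a,b]`. Repeated points are harmless, since they
only contribute zero increments to the sums below. -/
def IsDissection (a b : unitInterval) (n : ℕ) (t : ℕ → unitInterval) : Prop :=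
  Monotone t ∧ t 0 = a ∧ t n = b

/-- The mixed `(γ,ρ)`-variation `V_{γ,ρ}(R; [s,t] × [u,v])`, for `γ, ρ ≥ 1`. -/
def mixedVariation (γ ρ : ℝ) (R : unitInterval → unitInterval → ℝ)
    (s t u v : unitInterval) : ℝ≥0∞ :=
  ⨆ (n : ℕ) (m : ℕ) (a : ℕ → unitInterval) (b : ℕ → unitInterval)
    (_ : IsDissection s t n a) (_ : IsDissection u v m b),
    ENNReal.ofReal
      ((∑ j ∈ Finset.range m,
        (∑ i ∈ Finset.range n,
          |rectIncr R (a i) (a (i + 1)) (b j) (b (j + 1))| ^ γ) ^ (ρ / γ)) ^ (1 / ρ))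

/-- `X` has non-positively correlated increments. -/
def NonPosCorrelatedIncrements (R : unitInterval → unitInterval → ℝ) : Prop :=
  ∀ t₁ t₂ t₃ t₄ : unitInterval, t₁ < t₂ → t₂ < t₃ → t₃ < t₄ → rectIncr R t₁ t₂ t₃ t₄ ≤ 0

/-- The covariance is diagonally dominant. -/
def DiagonallyDominant (R : unitInterval → unitInterval → ℝ) : Prop :=
  ∀ t₁ t₂ t₃ t₄ : unitInterval, t₁ < t₂ → t₂ < t₃ → t₃ < t₄ → 0 ≤ rectIncr R t₂ t₃ t₁ t₄

/-- The σ-algebra `F_{a,b} = σ(X_v - X_u : a ≤ u ≤ v ≤ b)`. -/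
abbrev incrSigma {Ω : Type*} {d : ℕ} (X : unitInterval → Ω → EuclideanSpace ℝ (Fin d))
    (a b : unitInterval) : MeasurableSpace Ω :=
  ⨆ (u : unitInterval) (v : unitInterval) (_ : a ≤ u ∧ u ≤ v ∧ v ≤ b),
    MeasurableSpace.comap (fun ω => X v ω - X u ω) inferInstance

/-- The non-determinism condition: for some `α > 0`,
`inf_{s < t} (t - s)^{-α} Var(X_t^j - X_s^j | F_{0,s} ∨ F_{t,1}) > 0` for every component `j`. -/
def NonDeterministic {Ω : Type*} [MeasurableSpace Ω] {d : ℕ}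
    (X : unitInterval → Ω → EuclideanSpace ℝ (Fin d)) (P : Measure Ω) : Prop :=
  ∃ α > (0 : ℝ), ∃ c > (0 : ℝ), ∀ s t : unitInterval, s < t → ∀ j : Fin d,
    ∀ᵐ ω ∂P, c * ((t : ℝ) - s) ^ α ≤
      condVar (incrSigma X 0 s ⊔ incrSigma X t 1) (fun ω => X t ω j - X s ω j) P ω

/-! ### The Cameron–Martin space -/

/-- The matrix-valued kernel `R(s,t) Id_d`. -/
def covKernel {Ω : Type*} [MeasurableSpace Ω] {d : ℕ} [NeZero d]
    (X : unitInterval → Ω → EuclideanSpace ℝ (Fin d)) (P : Measure Ω) :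
    Matrix unitInterval unitInterval
      (EuclideanSpace ℝ (Fin d) →L[ℝ] EuclideanSpace ℝ (Fin d)) :=
  Matrix.of fun s t => covFun X P s t • ContinuousLinearMap.id ℝ _

theorem memLp_component {Ω : Type*} [MeasurableSpace Ω] {d : ℕ}
    (X : unitInterval → Ω → EuclideanSpace ℝ (Fin d)) (P : Measure Ω)
    [hX : IsContinuousCenteredGaussianIID X P] (t : unitInterval) (j : Fin d) :
    MemLp (fun ω => X t ω j) 2 P := by
  have h := (hX.gaussian.hasGaussianLaw_eval t).memLp_two
  exact h.continuousLinearMap_comp (EuclideanSpace.proj (𝕜 := ℝ) j)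

instance fact_posSemidef_covKernel {Ω : Type*} [MeasurableSpace Ω] {d : ℕ} [NeZero d]
    (X : unitInterval → Ω → EuclideanSpace ℝ (Fin d)) (P : Measure Ω)
    [hX : IsContinuousCenteredGaussianIID X P] : Fact (covKernel X P).PosSemidef := by
  refine ⟨((RKHS.posSemidef_tfae (K := covKernel X P)).out 0 2 rfl rfl).mpr
    (And.intro ?_ fun vv => ?_)⟩
  · refine Matrix.IsHermitian.ext fun s t => ?_
    have h : covFun X P t s = covFun X P s t := by simp only [covFun, mul_comm]
    refine ContinuousLinearMap.ext fun v => ext_inner_right ℝ fun w => ?_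
    simp [covKernel, h, ContinuousLinearMap.star_eq_adjoint, ContinuousLinearMap.adjoint_inner_left,
      inner_smul_left]
  · have hint : ∀ x y (c : ℝ), Integrable (fun ω => c * (X x ω 0 * X y ω 0)) P := fun x y c =>
      ((memLp_component X P x 0).integrable_mul (memLp_component X P y 0)).const_mul c
    have key : (vv.sum fun x w => vv.sum fun x' w' => ⟪covKernel X P x' x w, w'⟫_ℝ) =
        ∑ j, ∫ ω, (∑ x ∈ vv.support, vv x j * X x ω 0) ^ 2 ∂P := by
      have hsq : ∀ j, ∫ ω, (∑ x ∈ vv.support, vv x j * X x ω 0) ^ 2 ∂P =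
          ∑ x ∈ vv.support, ∑ y ∈ vv.support, (vv x j * vv y j) * covFun X P y x := by
        intro j
        have : ∀ ω, (∑ x ∈ vv.support, vv x j * X x ω 0) ^ 2 =
            ∑ x ∈ vv.support, ∑ y ∈ vv.support,
              (vv x j * vv y j) * (X y ω 0 * X x ω 0) := by
          intro ω
          rw [sq, Finset.sum_mul_sum]
          refine Finset.sum_congr rfl fun x _ => Finset.sum_congr rfl fun y _ => by ring
        simp_rw [this]
        rw [integral_finsetSum _ fun x _ => integrable_finsetSum _ fun y _ => hint y x _]
        refine Finset.sum_congr rfl fun x _ => ?_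
        rw [integral_finsetSum _ fun y _ => hint y x _]
        refine Finset.sum_congr rfl fun y _ => ?_
        rw [integral_const_mul, covFun]
      simp_rw [hsq]
      rw [Finsupp.sum, Finset.sum_comm]
      refine Finset.sum_congr rfl fun x _ => ?_
      rw [Finsupp.sum, Finset.sum_comm]
      refine Finset.sum_congr rfl fun y _ => ?_
      simp only [covKernel, Matrix.of_apply, _root_.smul_apply,
        ContinuousLinearMap.id_apply, inner_smul_left, PiLp.inner_apply, Finset.mul_sum]
      refine Finset.sum_congr rfl fun j _ => ?_
      simp
      ring
    rw [key]
    simp only [RCLike.re_to_real]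
    exact Finset.sum_nonneg fun j _ => integral_nonneg fun ω => sq_nonneg _

/-- The Cameron–Martin space of the `ℝ^d`-valued process `X`: the reproducing kernel Hilbert space
of `R(s,t) Id_d`. Its elements are (through the coercion to functions) `ℝ^d`-valued paths
on `[0,1]`, and it is the completion of the formal combinations `∑ a_i (t_i, u_i)`,
`t_i ∈ [0,1]`, `u_i ∈ ℝ^d`, for the inner product
`⟨∑ a_i (t_i, u_i), ∑ b_j (s_j, v_j)⟩ = ∑ a_i b_j R(t_i, s_j) ⟨u_i, v_j⟩`.
Reading `(t, u)` as the path `R(t, ·) u` this is the Cameron–Martin space; reading it as the step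
function `1_{[0,t]} u` this is the space of integrands of the Wiener integral. The isometry between
the two spaces is the identity on the formal combinations. -/
abbrev CameronMartin {Ω : Type*} [MeasurableSpace Ω] {d : ℕ} [NeZero d]
    (X : unitInterval → Ω → EuclideanSpace ℝ (Fin d)) (P : Measure Ω)
    [IsContinuousCenteredGaussianIID X P] : Type :=
  RKHS.OfKernel (covKernel X P)

/-! ### Vector fields -/

/-- `W` is `C^∞`-bounded: smooth, and bounded together with all its derivatives. -/
def SmoothBounded {n : ℕ} (W : EuclideanSpace ℝ (Fin n) → EuclideanSpace ℝ (Fin n)) : Prop :=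
  ContDiff ℝ ((⊤ : ℕ∞) : WithTop ℕ∞) W ∧ ∀ k : ℕ, ∃ C : ℝ, ∀ x, ‖iteratedFDeriv ℝ k W x‖ ≤ C

/-- Uniform ellipticity: `v* V(x) V(x)* v = ∑_j ⟨V_j(x), v⟩² ≥ lam |v|²` for some `lam > 0`. -/
def UniformlyElliptic {d n : ℕ}
    (V : Fin d → EuclideanSpace ℝ (Fin n) → EuclideanSpace ℝ (Fin n)) : Prop :=
  ∃ lam > (0 : ℝ), ∀ v x : EuclideanSpace ℝ (Fin n),
    lam * ‖v‖ ^ 2 ≤ ∑ j, ⟪V j x, v⟫_ℝ ^ 2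

/-! ### The skeleton equation -/

/-- `J = ∫_a^b F dg` as a limit of Riemann–Stieltjes sums as the mesh tends to zero, uniformly in
the intermediate points; this is the Young integral. -/
def HasYoungIntegral {n : ℕ} (F : unitInterval → EuclideanSpace ℝ (Fin n)) (g : unitInterval → ℝ)
    (a b : unitInterval) (J : EuclideanSpace ℝ (Fin n)) : Prop :=
  ∀ ε > (0 : ℝ), ∃ δ > (0 : ℝ), ∀ (N : ℕ) (t ξ : ℕ → unitInterval), IsDissection a b N t →
    (∀ i < N, (t (i + 1) : ℝ) - t i < δ) → (∀ i < N, ξ i ∈ Icc (t i) (t (i + 1))) →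
    ‖(∑ i ∈ Finset.range N, (g (t (i + 1)) - g (t i)) • F (ξ i)) - J‖ < ε

/-- `φ` has finite `p`-variation on `[0,1]`. -/
def HasFiniteVariation {n : ℕ} (p : ℝ) (φ : unitInterval → EuclideanSpace ℝ (Fin n)) : Prop :=
  ∃ C : ℝ, ∀ (N : ℕ) (t : ℕ → unitInterval), IsDissection 0 1 N t →
    ∑ i ∈ Finset.range N, ‖φ (t (i + 1)) - φ (t i)‖ ^ p ≤ C

/-- `φ` solves `φ_t = z + ∫_0^t V₀(φ_s) ds + ∑_i ∫_0^t V_i(φ_s) dh_s^i`, `t ∈ [0,1]`, in the Young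
sense, that is, among continuous paths of finite `p`-variation for some `p < 2`. -/
structure IsSkeleton {d n : ℕ} (V₀ : EuclideanSpace ℝ (Fin n) → EuclideanSpace ℝ (Fin n))
    (V : Fin d → EuclideanSpace ℝ (Fin n) → EuclideanSpace ℝ (Fin n))
    (z : EuclideanSpace ℝ (Fin n)) (h : unitInterval → EuclideanSpace ℝ (Fin d))
    (φ : unitInterval → EuclideanSpace ℝ (Fin n)) : Prop where
  continuous : Continuous φ
  finiteVariation : ∃ p : ℝ, 1 ≤ p ∧ p < 2 ∧ HasFiniteVariation p φ
  equation : ∀ t : unitInterval, ∃ (J₀ : EuclideanSpace ℝ (Fin n))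
    (J : Fin d → EuclideanSpace ℝ (Fin n)),
    HasYoungIntegral (fun s => V₀ (φ s)) (fun s => (s : ℝ)) 0 t J₀ ∧
    (∀ i, HasYoungIntegral (fun s => V i (φ s)) (fun s => h s i) 0 t (J i)) ∧
    φ t = z + J₀ + ∑ i, J i

open Classical in
/-- The skeleton `Φ(h)`: the solution of the equation above (and `0` if there is none). -/
def skeleton {d n : ℕ} (V₀ : EuclideanSpace ℝ (Fin n) → EuclideanSpace ℝ (Fin n))
    (V : Fin d → EuclideanSpace ℝ (Fin n) → EuclideanSpace ℝ (Fin n))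
    (z : EuclideanSpace ℝ (Fin n)) (h : unitInterval → EuclideanSpace ℝ (Fin d)) :
    unitInterval → EuclideanSpace ℝ (Fin n) :=
  if H : ∃ φ, IsSkeleton V₀ V z h φ then H.choose else 0

section Distances

variable {Ω : Type*} [MeasurableSpace Ω] {d n : ℕ} [NeZero d]
  (X : unitInterval → Ω → EuclideanSpace ℝ (Fin d)) (P : Measure Ω)
  [IsContinuousCenteredGaussianIID X P]
  (V₀ : EuclideanSpace ℝ (Fin n) → EuclideanSpace ℝ (Fin n))
  (V : Fin d → EuclideanSpace ℝ (Fin n) → EuclideanSpace ℝ (Fin n))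
  (z : EuclideanSpace ℝ (Fin n))

/-- The map `h ↦ Φ₁(h)` on the Cameron–Martin space. -/
def skeletonOne (h : CameronMartin X P) : EuclideanSpace ℝ (Fin n) :=
  skeleton V₀ V z (fun t => h t) 1

/-- The deterministic Malliavin matrix `γ^{ij} = ⟨D Φ₁^i(h), D Φ₁^j(h)⟩`, where `D Φ₁^i(h)` is the
gradient at `h` of the map `Φ₁^i` on the Cameron–Martin space, that is, the element representing
its Fréchet derivative. (The isometry with the space of integrands preserves
inner products.) -/
def malliavinMatrix (h : CameronMartin X P) : Matrix (Fin n) (Fin n) ℝ :=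
  Matrix.of fun i j =>
    ⟪gradient (fun k : CameronMartin X P => skeletonOne X P V₀ V z k i) h,
      gradient (fun k : CameronMartin X P => skeletonOne X P V₀ V z k j) h⟫_ℝ

/-- `d²(y) = inf {‖h‖² / 2 : Φ₁(h) = y} ∈ [0,∞]`, with `inf ∅ = ∞`. -/
def distSq (y : EuclideanSpace ℝ (Fin n)) : ℝ≥0∞ :=
  ⨅ (h : CameronMartin X P) (_ : skeletonOne X P V₀ V z h = y),
    ENNReal.ofReal (1 / 2 * ‖h‖ ^ 2)

/-- `d_R²(y) = inf {‖h‖² / 2 : Φ₁(h) = y, det γ_{Φ₁(h)} > 0} ∈ [0,∞]`, with `inf ∅ = ∞`. -/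
def distSqR (y : EuclideanSpace ℝ (Fin n)) : ℝ≥0∞ :=
  ⨅ (h : CameronMartin X P) (_ : skeletonOne X P V₀ V z h = y)
    (_ : 0 < (malliavinMatrix X P V₀ V z h).det),
    ENNReal.ofReal (1 / 2 * ‖h‖ ^ 2)

end Distances

end GaussVaradhan

end

/-!
The skeleton equation is `dy = f(y) dx` for the driver `x_t = (t, h_t)`, and everything about it is
read off its germ: relative to a continuous increasing clock `W`, with `α > 1/2`, a path is a
solution iff `y_t - y_s - f(y_s)(x_t - x_s) = O((W t - W s)^(2α))`. One stability estimate for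
linear-growth equations in this form (`DiscreteGerm.exists_const`, `IsGerm.exists_const`), proved by
Young's argument of splitting a block where the clock has run for half of its time, gives existence
as a limit of Euler schemes (`exists_germ_solution`), uniqueness, and the quadratic bound on the
remainder of the first-order expansion (`exists_expansion`). A path of finite `p`-variation with
`p < 2` has such a clock (`exists_clock`), and its solutions in the sense of germs are those in the
sense of Young integrals (`isSkeleton_of_germ`, `germ_of_isSkeleton`).

The derivative of `Φ₁` at `h` is expressed by the solution `A` of the adjoint linear equation,
solved backwards from `A_1 = Id`: it sends `k` to `∫ A_s V(y_s) dk_s`, a limit of Riemann sums over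
uniform grids (`skeleton_hasFDerivAt`). All this applies to Cameron–Martin paths because finite
mixed `(1,ρ)`-variation of the covariance bounds their `p`-variation, for some `p < 2`, by their norm
(`exists_varEmbedding`).

For non-degeneracy it has to be shown that for `c ≠ 0` the functional `k ↦ ∫ F dk`, with
`F_j = ⟨c, A V_j(y)⟩`, is not zero. By ellipticity some `F_j(1) = ⟨c, V_j(y_1)⟩` is non-zero, say
positive, so that `F_j ≥ b > 0` on some `[s,1]`. Consider the combinations of increments of the
kernel over dyadic refinements of a grid containing `s`, with coefficients whose `j`-th coordinate
is at least `b` on `[s,1]`. They form a convex set. The matrix of covariances of the increments has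
non-positive off-diagonal entries and non-negative row sums, so that its quadratic form is a
Dirichlet form and decreases when the coefficients are clipped to `[0,b]`
(`dirichletForm_contraction`); after clipping it is the mean square of `b (X_1 - X_s)` plus a
variable which is measurable with respect to the past, hence at least `b²` times the conditional
variance of `X_1 - X_s` (`integral_condVar_le`). The convex set thus stays away from zero, and the
element `k` of least norm of its closure has a pairing bounded below with all its elements, among
them the Riemann sums of `F`; in the limit `∫ F dk > 0` (`exists_le_sum_inner`). So the gradients of
the components of `Φ₁` are linearly independent, and their Gram determinant is positive at every
`h` (`det_gradient_pos`); the additional constraint in the definition of `d_R` is void.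
-/

noncomputable section

namespace GaussVaradhan

/-! ### Discrete linear-growth equations -/

/-- Discrete data for a linear-growth equation `dδ = B dX` relative to the clock `w`: `X` is
`α`-Hölder with respect to `w`, the coefficient `B` grows at most linearly in `δ`, and the one-step
defect `δ (i+1) - δ i - B i (X (i+1) - X i)` is of order `θ`. -/
structure DiscreteGerm {E F : Type*} [NormedAddCommGroup E] [NormedSpace ℝ E]
    [NormedAddCommGroup F] [NormedSpace ℝ F] (α θ L G : ℝ) (w : ℕ → ℝ) (X : ℕ → F) (δ : ℕ → E)
    (B : ℕ → F →L[ℝ] E) : Prop where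
  mono : Monotone w
  driver : ∀ i j, i ≤ j → ‖X j - X i‖ ≤ (w j - w i) ^ α
  coeff : ∀ i, ‖B i‖ ≤ L * ‖δ i‖ + G
  coeff_incr : ∀ i j, i ≤ j →
    ‖B j - B i‖ ≤ L * ‖δ j - δ i‖ + (L * ‖δ i‖ + G) * (w j - w i) ^ α
  step : ∀ i, ‖δ (i + 1) - δ i - B i (X (i + 1) - X i)‖ ≤ G * (w (i + 1) - w i) ^ θ

section Discrete

variable {E F : Type*} [NormedAddCommGroup E] [NormedSpace ℝ E]
  [NormedAddCommGroup F] [NormedSpace ℝ F]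

/-- The constant of the discrete sewing estimate. -/
def sewConst (θ L : ℝ) : ℝ := (4 * L + 3) / (1 - 2 ^ (1 - θ))

lemma one_sub_two_rpow_pos {θ : ℝ} (hθ : 1 < θ) : 0 < 1 - (2 : ℝ) ^ (1 - θ) := by
  have : (2 : ℝ) ^ (1 - θ) < 1 := Real.rpow_lt_one_of_one_lt_of_neg (by norm_num) (by linarith)
  linarith

lemma sewConst_pos {θ L : ℝ} (hθ : 1 < θ) (hL : 0 ≤ L) : 0 < sewConst θ L :=
  div_pos (by linarith) (one_sub_two_rpow_pos hθ)

lemma sewConst_eq {θ L : ℝ} (hθ : 1 < θ) :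
    sewConst θ L * 2 ^ (1 - θ) + (4 * L + 3) = sewConst θ L := by
  have h := (one_sub_two_rpow_pos hθ).ne'
  unfold sewConst
  field_simp
  ring

/-- The local estimate: on a window on which the clock advances by at most `η`, the defect is of
order `θ`. Young's argument: a block is split at the index where the clock has advanced by half. -/
lemma DiscreteGerm.local_bound {α θ L G : ℝ} {w : ℕ → ℝ} {X : ℕ → F} {δ : ℕ → E}
    {B : ℕ → F →L[ℝ] E} (H : DiscreteGerm α θ L G w X δ B) (hα : 0 < α) (hαθ : α < θ)
    (hθ : 1 < θ) (hθα : θ ≤ 2 * α) (hL : 0 ≤ L) (hG : 0 ≤ G) {η : ℝ} (hη1 : η ≤ 1)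
    (hη : sewConst θ L * η ^ (θ - α) ≤ 1) {a c : ℕ} (hac : w c - w a ≤ η) {m : ℝ}
    (hm : ∀ l, a ≤ l → l ≤ c → ‖δ l‖ ≤ m) (i j : ℕ) (hai : a ≤ i) (hij : i ≤ j) (hjc : j ≤ c) :
    ‖δ j - δ i - B i (X j - X i)‖ ≤ sewConst θ L * (L * m + G) * (w j - w i) ^ θ ∧
      ‖δ j - δ i‖ ≤ 2 * (L * m + G) * (w j - w i) ^ α := by
  have hK := sewConst_pos hθ hL
  set K := sewConst θ L with hKdef
  have hw : ∀ p q, p ≤ q → 0 ≤ w q - w p := fun p q h => sub_nonneg.2 (H.mono h)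
  -- the second bound follows from the first
  have second : ∀ p q, a ≤ p → p ≤ q → q ≤ c →
      ‖δ q - δ p - B p (X q - X p)‖ ≤ K * (L * m + G) * (w q - w p) ^ θ →
      ‖δ q - δ p‖ ≤ 2 * (L * m + G) * (w q - w p) ^ α := by
    intro p q hap hpq hqc hJ
    have hm0 : 0 ≤ L * m + G := by
      have := (norm_nonneg _).trans (hm p hap (hpq.trans hqc)); positivity
    have h0 := hw p q hpq
    have hle : w q - w p ≤ η := by have := H.mono hap; have := H.mono hqc; linarith
    have hη0 : 0 ≤ η := h0.trans hle
    have h1 : ‖B p (X q - X p)‖ ≤ (L * m + G) * (w q - w p) ^ α := by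
      refine (ContinuousLinearMap.le_opNorm _ _).trans ?_
      gcongr
      · refine (H.coeff p).trans ?_
        gcongr
        exact hm p hap (hpq.trans hqc)
      · exact H.driver p q hpq
    have h2 : K * (L * m + G) * (w q - w p) ^ θ ≤ (L * m + G) * (w q - w p) ^ α := by
      have : (w q - w p) ^ θ = (w q - w p) ^ (θ - α) * (w q - w p) ^ α := by
        rw [← Real.rpow_add_of_nonneg h0 (by linarith) hα.le]; congr 1; ring
      rw [this]
      have h3 : K * (w q - w p) ^ (θ - α) ≤ 1 := by
        refine le_trans ?_ hη
        gcongr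
      calc K * (L * m + G) * ((w q - w p) ^ (θ - α) * (w q - w p) ^ α)
          = (K * (w q - w p) ^ (θ - α)) * ((L * m + G) * (w q - w p) ^ α) := by ring
        _ ≤ 1 * ((L * m + G) * (w q - w p) ^ α) := by
          gcongr
        _ = _ := one_mul _
    calc ‖δ q - δ p‖ = ‖(δ q - δ p - B p (X q - X p)) + B p (X q - X p)‖ := by
          rw [sub_add_cancel]
      _ ≤ _ := norm_add_le _ _
      _ ≤ _ := by linarith
  suffices first : ∀ n p q, a ≤ p → p ≤ q → q ≤ c → q - p ≤ n →
      ‖δ q - δ p - B p (X q - X p)‖ ≤ K * (L * m + G) * (w q - w p) ^ θ by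
    have := first (j - i) i j hai hij hjc le_rfl
    exact ⟨this, second i j hai hij hjc this⟩
  intro n
  induction n with
  | zero =>
    intro p q hap hpq hqc hn
    obtain rfl : p = q := by omega
    simp [Real.zero_rpow (by linarith : θ ≠ 0)]
  | succ n ih =>
    intro p q hap hpq hqc hn
    rcases hpq.eq_or_lt with rfl | hlt
    · simp [Real.zero_rpow (by linarith : θ ≠ 0)]
    have hm0 : 0 ≤ L * m + G := by
      have := (norm_nonneg _).trans (hm p hap (hpq.trans hqc)); positivity
    have hGm : G ≤ L * m + G := by
      have := (norm_nonneg _).trans (hm p hap (hpq.trans hqc))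
      have := mul_nonneg hL this; linarith
    set M := L * m + G with hM
    set D := w q - w p with hD
    have hD0 : 0 ≤ D := hw p q hpq
    have hD1 : D ≤ 1 := by
      have := H.mono hap; have := H.mono hqc; linarith
    -- the splitting index
    obtain ⟨k, hpk, hkq, hk1, hk2⟩ : ∃ k, p ≤ k ∧ k < q ∧ w k - w p ≤ D / 2 ∧
        w q - w (k + 1) ≤ D / 2 := by
      classical
      let S := (Finset.Ico p q).filter fun k => w k - w p ≤ D / 2
      have hS : S.Nonempty := ⟨p, by simp [S, hlt]; positivity⟩
      obtain ⟨k, hk⟩ : ∃ k, k = S.max' hS := ⟨_, rfl⟩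
      have hmem : k ∈ S := hk ▸ S.max'_mem hS
      rw [Finset.mem_filter, Finset.mem_Ico] at hmem
      refine ⟨k, hmem.1.1, hmem.1.2, hmem.2, ?_⟩
      by_contra hcon
      push Not at hcon
      have hne : k + 1 ≠ q := by
        intro h; rw [h] at hcon; simp at hcon; linarith
      have : k + 1 ∈ S := by
        rw [Finset.mem_filter, Finset.mem_Ico]
        refine ⟨⟨by omega, by omega⟩, ?_⟩
        linarith
      have := S.le_max' _ this
      omega
    have hDα : D ^ α * D ^ α ≤ D ^ θ := by
      rcases hD0.eq_or_lt with h | h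
      · rw [← h, Real.zero_rpow hα.ne', Real.zero_rpow (by linarith)]; simp
      · rw [← Real.rpow_add h]
        exact Real.rpow_le_rpow_of_exponent_ge h hD1 (by linarith)
    have hincr : ∀ l r, p ≤ l → l ≤ r → r ≤ q → l - p ≤ n →
        ‖(B l - B p) (X r - X l)‖ ≤ (2 * L + 1) * M * D ^ θ := by
      intro l r hpl hlr hrq hl
      have h1 := second p l hap hpl (by omega) (ih p l hap hpl (by omega) hl)
      have h2 := hm p hap (by omega)
      have hwl : w l - w p ≤ D := by have := H.mono (hlr.trans hrq); linarith
      have hwr : w r - w l ≤ D := by have := H.mono hrq; have := H.mono hpl; linarith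
      have h3 : ‖B l - B p‖ ≤ (2 * L + 1) * M * D ^ α := by
        calc ‖B l - B p‖ ≤ L * ‖δ l - δ p‖ + (L * ‖δ p‖ + G) * (w l - w p) ^ α :=
              H.coeff_incr p l hpl
          _ ≤ L * (2 * M * (w l - w p) ^ α) + (L * m + G) * (w l - w p) ^ α := by
              have := hw p l hpl
              gcongr
          _ = (2 * L + 1) * M * (w l - w p) ^ α := by rw [hM]; ring
          _ ≤ _ := by
              have := hw p l hpl
              gcongr
      have h4 : ‖X r - X l‖ ≤ D ^ α := by
        refine (H.driver l r hlr).trans ?_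
        have := hw l r hlr
        gcongr
      calc ‖(B l - B p) (X r - X l)‖ ≤ ‖B l - B p‖ * ‖X r - X l‖ :=
            ContinuousLinearMap.le_opNorm _ _
        _ ≤ ((2 * L + 1) * M * D ^ α) * D ^ α := by gcongr
        _ = (2 * L + 1) * M * (D ^ α * D ^ α) := by ring
        _ ≤ _ := by gcongr
    have hhalf : ∀ u, 0 ≤ u → u ≤ D / 2 → K * M * u ^ θ ≤ K * M * D ^ θ * (2 ^ (1 - θ) / 2) := by
      intro u hu0 hu
      have : u ^ θ ≤ D ^ θ * (2 ^ (1 - θ) / 2) := by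
        calc u ^ θ ≤ (D / 2) ^ θ := by gcongr
          _ = D ^ θ * (2 ^ (1 - θ) / 2) := by
            rw [Real.div_rpow hD0 (by norm_num), Real.rpow_sub (by norm_num), Real.rpow_one]
            field_simp
      calc K * M * u ^ θ ≤ K * M * (D ^ θ * (2 ^ (1 - θ) / 2)) := by gcongr
        _ = _ := by ring
    have e1 := (ih p k hap hpk (by omega) (by omega)).trans (hhalf _ (hw p k hpk) hk1)
    have e2 := (ih (k + 1) q (by omega) hkq (by omega) (by omega)).trans
      (hhalf _ (hw _ _ hkq) hk2)
    have e3 : ‖δ (k + 1) - δ k - B k (X (k + 1) - X k)‖ ≤ M * D ^ θ := by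
      refine (H.step k).trans ?_
      have h1 := hw k (k + 1) (by omega)
      have h2 := H.mono hpk
      have h3 := H.mono (show k + 1 ≤ q from hkq)
      gcongr
      linarith
    have e4 := hincr k (k + 1) hpk (by omega) hkq (by omega)
    have e5 : ‖(B (k + 1) - B p) (X q - X (k + 1))‖ ≤ (2 * L + 1) * M * D ^ θ := by
      rcases (show k + 1 ≤ q from hkq).eq_or_lt with h | h
      · rw [h]; simp; positivity
      · exact hincr (k + 1) q (by omega) hkq le_rfl (by omega)
    have key : δ q - δ p - B p (X q - X p) =
        (δ k - δ p - B p (X k - X p)) + (δ q - δ (k + 1) - B (k + 1) (X q - X (k + 1))) +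
        (δ (k + 1) - δ k - B k (X (k + 1) - X k)) + (B k - B p) (X (k + 1) - X k) +
        (B (k + 1) - B p) (X q - X (k + 1)) := by
      simp only [map_sub, sub_apply]
      abel
    rw [key]
    refine (norm_add_le _ _).trans ((add_le_add_left (norm_add_le _ _) _).trans
      ((add_le_add_left (add_le_add_left (norm_add_le _ _) _) _).trans
      ((add_le_add_left (add_le_add_left (add_le_add_left (norm_add_le _ _) _) _) _).trans ?_)))
    have hKeq : K * 2 ^ (1 - θ) + (4 * L + 3) = K := sewConst_eq hθ
    calc _ ≤ K * M * D ^ θ * (2 ^ (1 - θ) / 2) + K * M * D ^ θ * (2 ^ (1 - θ) / 2) + M * D ^ θ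
          + (2 * L + 1) * M * D ^ θ + (2 * L + 1) * M * D ^ θ := by linarith
      _ = (K * 2 ^ (1 - θ) + (4 * L + 3)) * M * D ^ θ := by ring
      _ = K * M * D ^ θ := by rw [hKeq]

/-- On a window of clock length `η`, the path at most doubles. -/
lemma DiscreteGerm.window_bound {α θ L G : ℝ} {w : ℕ → ℝ} {X : ℕ → F} {δ : ℕ → E}
    {B : ℕ → F →L[ℝ] E} (H : DiscreteGerm α θ L G w X δ B) (hα : 0 < α) (hαθ : α < θ)
    (hθ : 1 < θ) (hθα : θ ≤ 2 * α) (hL : 0 ≤ L) (hG : 0 ≤ G) {η : ℝ} (hη1 : η ≤ 1)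
    (hη : sewConst θ L * η ^ (θ - α) ≤ 1) (hη' : 4 * (L + 1) * η ^ α ≤ 1)
    {a c : ℕ} (hle : a ≤ c) (hac : w c - w a ≤ η) : ‖δ c‖ + G ≤ 2 * (‖δ a‖ + G) := by
  obtain ⟨l, hl, hmax⟩ := (Finset.Icc a c).exists_max_image (fun l => ‖δ l‖) ⟨a, by simp [hle]⟩
  rw [Finset.mem_Icc] at hl
  have h := (H.local_bound hα hαθ hθ hθα hL hG hη1 hη hac
    (fun i h1 h2 => hmax i (Finset.mem_Icc.2 ⟨h1, h2⟩)) a l le_rfl hl.1 hl.2).2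
  have h0 : 0 ≤ w l - w a := sub_nonneg.2 (H.mono hl.1)
  have h1 : (w l - w a) ^ α ≤ η ^ α := by
    gcongr
    have := H.mono hl.2; linarith
  have h2 : ‖δ l‖ ≤ ‖δ a‖ + ‖δ l - δ a‖ := by
    have := norm_add_le (δ a) (δ l - δ a); simpa using this
  have h3 : 2 * (L * ‖δ l‖ + G) * (w l - w a) ^ α ≤ 2 * (L * ‖δ l‖ + G) * η ^ α := by gcongr
  have h4 : 2 * (L * ‖δ l‖ + G) * η ^ α ≤ (‖δ l‖ + G) / 2 := by
    have : L * ‖δ l‖ + G ≤ (L + 1) * (‖δ l‖ + G) := by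
      have := mul_nonneg hL hG; have := norm_nonneg (δ l); nlinarith
    have h5 : 0 ≤ η ^ α := Real.rpow_nonneg (h0.trans (by have := H.mono hl.2; linarith)) _
    calc 2 * (L * ‖δ l‖ + G) * η ^ α ≤ 2 * ((L + 1) * (‖δ l‖ + G)) * η ^ α := by gcongr
      _ = (4 * (L + 1) * η ^ α) * ((‖δ l‖ + G) / 2) := by ring
      _ ≤ 1 * ((‖δ l‖ + G) / 2) := by gcongr
      _ = _ := one_mul _
  have h6 := hmax c (by simp [hle])
  linarith

/-- Chaining windows: `n` of them cover a clock length `n η / 2`, the steps being at most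
`η / 2`. -/
lemma DiscreteGerm.growth {α θ L G : ℝ} {w : ℕ → ℝ} {X : ℕ → F} {δ : ℕ → E}
    {B : ℕ → F →L[ℝ] E} (H : DiscreteGerm α θ L G w X δ B) (hα : 0 < α) (hαθ : α < θ)
    (hθ : 1 < θ) (hθα : θ ≤ 2 * α) (hL : 0 ≤ L) (hG : 0 ≤ G) {η : ℝ} (hη1 : η ≤ 1)
    (hη0 : 0 < η)
    (hη : sewConst θ L * η ^ (θ - α) ≤ 1) (hη' : 4 * (L + 1) * η ^ α ≤ 1)
    (hstep : ∀ i, w (i + 1) - w i ≤ η / 2) (n j : ℕ) (hj : w j - w 0 ≤ n * (η / 2)) :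
    ‖δ j‖ + G ≤ 2 ^ (n + 1) * (‖δ 0‖ + G) := by
  have hwin := fun a c h1 h2 => H.window_bound hα hαθ hθ hθα hL hG hη1 hη hη' (a := a) (c := c)
    h1 h2
  induction n generalizing j with
  | zero =>
    have := hwin 0 j (Nat.zero_le _) (by simp at hj; linarith)
    simpa using this
  | succ n ih =>
    have hpow : (1 : ℝ) ≤ 2 ^ (n + 1) := one_le_pow₀ (by norm_num)
    by_cases h0 : w j - w 0 ≤ η
    · refine (hwin 0 j (Nat.zero_le _) h0).trans ?_
      rw [pow_succ, mul_comm _ (2 : ℝ), mul_assoc]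
      gcongr
      exact le_mul_of_one_le_left (by positivity) hpow
    · classical
      have hex : ∃ i, i ≤ j ∧ w j - w i ≤ η := ⟨j, le_rfl, by simp [hη0.le]⟩
      obtain ⟨hi1, hi2⟩ := Nat.find_spec hex
      set i := Nat.find hex with hi
      have hipos : 0 < i := by
        rcases Nat.eq_zero_or_pos i with h | h
        · rw [h] at hi2; exact absurd hi2 h0
        · exact h
      have hmin := Nat.find_min hex (m := i - 1) (by omega)
      have hgt : η < w j - w (i - 1) := by
        by_contra hcon
        exact hmin ⟨by omega, not_lt.1 hcon⟩
      have hs := hstep (i - 1)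
      rw [Nat.sub_add_cancel hipos] at hs
      have := ih i (by push_cast at hj; linarith)
      have h3 := hwin i j hi1 hi2
      calc ‖δ j‖ + G ≤ 2 * (‖δ i‖ + G) := h3
        _ ≤ 2 * (2 ^ (n + 1) * (‖δ 0‖ + G)) := by gcongr
        _ = _ := by ring

/-- A window length for which the local estimates close up. -/
lemma exists_window {α θ : ℝ} (hα : 0 < α) (hαθ : α < θ) (K L : ℝ) :
    ∃ η : ℝ, 0 < η ∧ η ≤ 1 ∧ K * η ^ (θ - α) ≤ 1 ∧ 4 * (L + 1) * η ^ α ≤ 1 := by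
  have h : ∀ c β : ℝ, 0 < β → ∀ᶠ η in nhdsWithin (0 : ℝ) (Ioi 0), c * η ^ β ≤ 1 := by
    intro c β hβ
    have : Filter.Tendsto (fun η : ℝ => c * η ^ β) (nhdsWithin 0 (Ioi 0)) (nhds 0) := by
      have := ((Real.continuousAt_rpow_const 0 β (Or.inr hβ.le)).tendsto.const_mul c)
      rw [Real.zero_rpow hβ.ne', mul_zero] at this
      exact this.mono_left nhdsWithin_le_nhds
    exact (this.eventually (gt_mem_nhds one_pos)).mono fun _ h => le_of_lt h
  have h1 : ∀ᶠ η in nhdsWithin (0 : ℝ) (Ioi 0), 0 < η := self_mem_nhdsWithin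
  have h2 : ∀ᶠ η in nhdsWithin (0 : ℝ) (Ioi 0), η ≤ 1 :=
    nhdsWithin_le_nhds (ge_mem_nhds one_pos)
  obtain ⟨η, a, b, c, d⟩ := (h1.and (h2.and ((h K (θ - α) (by linarith)).and
    (h (4 * (L + 1)) α hα)))).exists
  exact ⟨η, a, b, c, d⟩

variable (E F) in
/-- Discrete Gronwall estimate for Young equations: growth, Hölder regularity and defect of the
path are controlled by its starting point and the inhomogeneity `G`, uniformly over all meshes
that are fine enough. -/
theorem DiscreteGerm.exists_const {α θ L T : ℝ} (hα : 0 < α) (hαθ : α < θ)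
    (hθ : 1 < θ) (hθα : θ ≤ 2 * α) (hL : 0 ≤ L) :
    ∃ C η : ℝ, 0 ≤ C ∧ 0 < η ∧ ∀ (G : ℝ) (w : ℕ → ℝ) (X : ℕ → F) (δ : ℕ → E)
      (B : ℕ → F →L[ℝ] E), 0 ≤ G → DiscreteGerm α θ L G w X δ B → (∀ j, w j - w 0 ≤ T) →
      (∀ i, w (i + 1) - w i ≤ η) → ∀ i j, i ≤ j →
        ‖δ j‖ ≤ C * (‖δ 0‖ + G) ∧ ‖δ j - δ i‖ ≤ C * (‖δ 0‖ + G) * (w j - w i) ^ α ∧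
        ‖δ j - δ i - B i (X j - X i)‖ ≤ C * (‖δ 0‖ + G) * (w j - w i) ^ θ := by
  have hK := sewConst_pos hθ hL
  obtain ⟨η, hη0, hη1, hη, hη'⟩ := exists_window hα hαθ (sewConst θ L) L
  set K := sewConst θ L with hKdef
  obtain ⟨n, hn⟩ := exists_nat_ge (T / (η / 2))
  have hn' : T ≤ n * (η / 2) := by rwa [div_le_iff₀ (by positivity)] at hn
  set A : ℝ := 2 ^ (n + 1) with hA
  have hA1 : 0 < A := by positivity
  set C2 := 2 * (L + 1) * A + 2 * A * η ^ (-α) with hC2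
  set C3 := K * (L + 1) * A + (C2 + (L + 1) * A) * η ^ (α - θ) with hC3
  have hp1 : 0 < η ^ (-α) := Real.rpow_pos_of_pos hη0 _
  have hp2 : 0 < η ^ (α - θ) := Real.rpow_pos_of_pos hη0 _
  have hC2p : 0 ≤ C2 := by positivity
  have hC3p : 0 ≤ C3 := by positivity
  refine ⟨A + C2 + C3, η / 2, by positivity, by positivity, ?_⟩
  intro G w X δ B hG H hT hstep i j hij
  set D := ‖δ 0‖ + G with hD
  have hD0 : 0 ≤ D := by positivity
  have hbd : ∀ l, ‖δ l‖ + G ≤ A * D := fun l =>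
    H.growth hα hαθ hθ hθα hL hG hη1 hη0 hη hη' hstep n l ((hT l).trans hn')
  have hbd1 : ∀ l, ‖δ l‖ ≤ A * D := fun l => by have := hbd l; linarith
  have hM : L * (A * D) + G ≤ (L + 1) * A * D := by
    have := hbd 0; have := norm_nonneg (δ 0); nlinarith
  have hM0 : 0 ≤ L * (A * D) + G := by positivity
  have h0 : 0 ≤ w j - w i := sub_nonneg.2 (H.mono hij)
  have hα0 : 0 ≤ (w j - w i) ^ α := Real.rpow_nonneg h0 _
  have hθ0 : 0 ≤ (w j - w i) ^ θ := Real.rpow_nonneg h0 _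
  have hB : ‖B i (X j - X i)‖ ≤ (L + 1) * A * D * (w j - w i) ^ α := by
    refine (ContinuousLinearMap.le_opNorm _ _).trans ?_
    gcongr
    · refine (H.coeff i).trans (le_trans ?_ hM)
      gcongr
      exact hbd1 i
    · exact H.driver i j hij
  have hfirst : ‖δ j‖ ≤ (A + C2 + C3) * D := by
    refine (hbd1 j).trans ?_
    gcongr
    linarith
  have main : ‖δ j - δ i‖ ≤ C2 * D * (w j - w i) ^ α ∧
      ‖δ j - δ i - B i (X j - X i)‖ ≤ C3 * D * (w j - w i) ^ θ := by
    by_cases hsm : w j - w i ≤ η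
    · obtain ⟨l1, l2⟩ := H.local_bound hα hαθ hθ hθα hL hG hη1 hη hsm
        (fun l _ _ => hbd1 l) i j le_rfl hij le_rfl
      constructor
      · refine l2.trans (mul_le_mul_of_nonneg_right ?_ hα0)
        calc 2 * (L * (A * D) + G) ≤ 2 * ((L + 1) * A * D) := by gcongr
          _ = (2 * (L + 1) * A) * D := by ring
          _ ≤ _ := by
            gcongr
            rw [hC2]; linarith [mul_nonneg (mul_nonneg two_pos.le hA1.le) hp1.le]
      · refine l1.trans (mul_le_mul_of_nonneg_right ?_ hθ0)
        calc K * (L * (A * D) + G) ≤ K * ((L + 1) * A * D) := by gcongr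
          _ = (K * (L + 1) * A) * D := by ring
          _ ≤ _ := by
            gcongr
            rw [hC3]; linarith [mul_nonneg (show 0 ≤ C2 + (L + 1) * A by positivity) hp2.le]
    · push Not at hsm
      have g1 : ‖δ j - δ i‖ ≤ C2 * D * (w j - w i) ^ α := by
        have e1 : 1 ≤ η ^ (-α) * (w j - w i) ^ α := by
          rw [Real.rpow_neg hη0.le, inv_mul_eq_div, one_le_div (Real.rpow_pos_of_pos hη0 _)]
          gcongr
        calc ‖δ j - δ i‖ ≤ ‖δ j‖ + ‖δ i‖ := norm_sub_le _ _
          _ ≤ 2 * A * D * 1 := by linarith [hbd1 i, hbd1 j]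
          _ ≤ 2 * A * D * (η ^ (-α) * (w j - w i) ^ α) := by gcongr
          _ = (2 * A * η ^ (-α)) * D * (w j - w i) ^ α := by ring
          _ ≤ _ := by
            gcongr
            rw [hC2]; linarith [show 0 ≤ 2 * (L + 1) * A by positivity]
      refine ⟨g1, ?_⟩
      have e2 : (w j - w i) ^ α ≤ η ^ (α - θ) * (w j - w i) ^ θ := by
        have hpos : 0 < w j - w i := hη0.trans hsm
        have : (w j - w i) ^ α = (w j - w i) ^ (α - θ) * (w j - w i) ^ θ := by
          rw [← Real.rpow_add hpos]; congr 1; ring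
        rw [this]
        gcongr ?_ * _
        exact Real.rpow_le_rpow_of_nonpos hη0 hsm.le (by linarith)
      calc _ ≤ ‖δ j - δ i‖ + ‖B i (X j - X i)‖ := norm_sub_le _ _
        _ ≤ C2 * D * (w j - w i) ^ α + (L + 1) * A * D * (w j - w i) ^ α := by gcongr
        _ = (C2 + (L + 1) * A) * D * (w j - w i) ^ α := by ring
        _ ≤ (C2 + (L + 1) * A) * D * (η ^ (α - θ) * (w j - w i) ^ θ) := by gcongr
        _ = ((C2 + (L + 1) * A) * η ^ (α - θ)) * D * (w j - w i) ^ θ := by ring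
        _ ≤ _ := by
          gcongr
          rw [hC3]; linarith [show 0 ≤ K * (L + 1) * A by positivity]
  refine ⟨hfirst, main.1.trans ?_, main.2.trans ?_⟩
  · gcongr; linarith
  · gcongr; linarith

end Discrete

/-! ### Young equations relative to a clock -/

section Continuous

open Filter Topology

/-- The `i`-th point of the uniform grid of mesh `1/n` on `[0,1]`, frozen at `1` once reached. -/
def gridPt (n i : ℕ) : unitInterval :=
  ⟨min ((i : ℝ) / n) 1, le_min (by positivity) zero_le_one, min_le_right _ _⟩

/-- The point of `[s,t]` at relative position `u`. -/
def segPt (s t u : unitInterval) : unitInterval :=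
  ⟨(1 - u) * s + u * t, by
    have := u.2.1; have := u.2.2; have := s.2.1; have := t.2.1
    have h1 : (0 : ℝ) ≤ 1 - u := by linarith
    positivity, by
    have := u.2.1; have := u.2.2; have := s.2.2; have := t.2.2
    have h1 : (0 : ℝ) ≤ 1 - u := by linarith
    nlinarith⟩

lemma gridPt_mono (n : ℕ) : Monotone (gridPt n) := by
  intro i j hij
  apply Subtype.mk_le_mk.2
  gcongr

@[simp] lemma gridPt_zero (n : ℕ) : gridPt n 0 = 0 := by
  apply Subtype.ext; simp [gridPt]

lemma gridPt_self {n : ℕ} (hn : 0 < n) : gridPt n n = 1 := by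
  apply Subtype.ext
  have : (n : ℝ) ≠ 0 := by positivity
  simp [gridPt, this]

lemma gridPt_dist (n i : ℕ) : |(gridPt n (i + 1) : ℝ) - gridPt n i| ≤ 1 / n := by
  rw [abs_of_nonneg (sub_nonneg.2 (Subtype.coe_le_coe.2 (gridPt_mono n (Nat.le_succ i))))]
  simp only [gridPt]
  have h : ((i + 1 : ℕ) : ℝ) / n = (i : ℝ) / n + 1 / n := by push_cast; ring
  rw [h]
  have h0 : (0 : ℝ) ≤ 1 / n := by positivity
  rcases le_total ((i : ℝ) / n) 1 with h1 | h1
  · rw [min_eq_left h1]; have := min_le_left ((i : ℝ) / n + 1 / n) 1; linarith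
  · rw [min_eq_right h1]; have := min_le_right ((i : ℝ) / n + 1 / n) 1; linarith

lemma segPt_mono {s t : unitInterval} (hst : s ≤ t) : Monotone (segPt s t) := by
  intro u v huv
  apply Subtype.mk_le_mk.2
  have h1 : (u : ℝ) ≤ v := huv
  have h2 : (s : ℝ) ≤ t := hst
  nlinarith

@[simp] lemma segPt_zero (s t : unitInterval) : segPt s t 0 = s := by
  apply Subtype.ext; simp [segPt]

@[simp] lemma segPt_one (s t : unitInterval) : segPt s t 1 = t := by
  apply Subtype.ext; simp [segPt]

lemma segPt_continuous (s t : unitInterval) : Continuous (segPt s t) := by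
  unfold segPt
  fun_prop

/-- A continuous function has small oscillation over the cells of fine uniform grids. -/
lemma eventually_grid_osc {f : unitInterval → ℝ} (hf : Continuous f) {η : ℝ} (hη : 0 < η) :
    ∀ᶠ n : ℕ in atTop, ∀ i, |f (gridPt n (i + 1)) - f (gridPt n i)| < η := by
  have hu := CompactSpace.uniformContinuous_of_continuous hf
  obtain ⟨ε, hε, h⟩ := Metric.uniformContinuous_iff.1 hu η hη
  obtain ⟨N, hN⟩ := exists_nat_gt (1 / ε)
  filter_upwards [eventually_ge_atTop (N + 1)] with n hn i
  have hn0 : (0 : ℝ) < n := by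
    have : 0 < n := by omega
    exact_mod_cast this
  have : dist (gridPt n (i + 1)) (gridPt n i) < ε := by
    rw [Subtype.dist_eq, Real.dist_eq]
    refine (gridPt_dist n i).trans_lt ?_
    rw [div_lt_iff₀ hε] at hN
    rw [div_lt_iff₀ hn0]
    have : (N : ℝ) + 1 ≤ n := by exact_mod_cast hn
    nlinarith
  simpa [Real.dist_eq] using h this

/-- `x` is `α`-Hölder relative to the clock `W`. -/
def HolderWrt {E : Type*} [NormedAddCommGroup E] (α : ℝ) (W : unitInterval → ℝ) (C : ℝ)
    (x : unitInterval → E) : Prop :=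
  ∀ s t, s ≤ t → ‖x t - x s‖ ≤ C * (W t - W s) ^ α

lemma HolderWrt.abs {E : Type*} [NormedAddCommGroup E] {α : ℝ} {W : unitInterval → ℝ} {C : ℝ}
    (hW : Monotone W) {x : unitInterval → E} (h : HolderWrt α W C x) (s t : unitInterval) :
    ‖x t - x s‖ ≤ C * |W t - W s| ^ α := by
  rcases le_total s t with hst | hst
  · rw [abs_of_nonneg (sub_nonneg.2 (hW hst))]; exact h s t hst
  · rw [norm_sub_rev, abs_sub_comm, abs_of_nonneg (sub_nonneg.2 (hW hst))]; exact h t s hst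

lemma HolderWrt.continuous {E : Type*} [NormedAddCommGroup E] {α : ℝ} (hα : 0 < α)
    {W : unitInterval → ℝ} {C : ℝ} (hW : Monotone W) (hWc : Continuous W)
    {x : unitInterval → E} (h : HolderWrt α W C x) : Continuous x := by
  rw [continuous_iff_continuousAt]
  intro s
  rw [ContinuousAt, tendsto_iff_norm_sub_tendsto_zero]
  refine squeeze_zero (fun _ => norm_nonneg _) (fun t => h.abs hW s t) ?_
  have : Continuous fun t => C * |W t - W s| ^ α :=
    continuous_const.mul (((hWc.sub continuous_const).abs).rpow_const fun _ => Or.inr hα.le)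
  have := this.tendsto s
  simpa [Real.zero_rpow hα.ne'] using this

variable {E F : Type*} [NormedAddCommGroup E] [NormedSpace ℝ E]
  [NormedAddCommGroup F] [NormedSpace ℝ F]

/-- The relation `dδ = B dX` in Davie's sense:
`δ_t - δ_s = B_s (X_t - X_s) + O((W_t - W_s)^{2α})`. -/
def IsGerm (α : ℝ) (W : unitInterval → ℝ) (X : unitInterval → F) (δ : unitInterval → E)
    (B : unitInterval → F →L[ℝ] E) : Prop :=
  ∃ K, ∀ s t, s ≤ t → ‖δ t - δ s - B s (X t - X s)‖ ≤ K * (W t - W s) ^ (2 * α)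

lemma IsGerm.exists_nonneg {α : ℝ} {W : unitInterval → ℝ} (hW : Monotone W)
    {X : unitInterval → F} {δ : unitInterval → E}
    {B : unitInterval → F →L[ℝ] E} (h : IsGerm α W X δ B) :
    ∃ K, 0 ≤ K ∧ ∀ s t, s ≤ t → ‖δ t - δ s - B s (X t - X s)‖ ≤ K * (W t - W s) ^ (2 * α) := by
  obtain ⟨K, hK⟩ := h
  refine ⟨max K 0, le_max_right _ _, fun s t hst => (hK s t hst).trans ?_⟩
  have := Real.rpow_nonneg (sub_nonneg.2 (hW hst)) (2 * α)
  gcongr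
  exact le_max_left _ _

variable (E F) in
/-- Gronwall estimate for Young equations: a path with `dδ = B dX`, where the coefficient `B` grows
linearly in `δ` up to an inhomogeneity `G`, is controlled by `‖δ 0‖ + G`, uniformly over clocks of
bounded total length. -/
theorem IsGerm.exists_const {α L T : ℝ} (hα : 1 / 2 < α) (hL : 0 ≤ L) :
    ∃ C : ℝ, 0 ≤ C ∧ ∀ (G : ℝ) (W : unitInterval → ℝ) (X : unitInterval → F)
      (δ : unitInterval → E) (B : unitInterval → F →L[ℝ] E), 0 ≤ G → Monotone W → Continuous W →
      W 1 - W 0 ≤ T → HolderWrt α W 1 X → (∀ s, ‖B s‖ ≤ L * ‖δ s‖ + G) →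
      (∀ s t, s ≤ t → ‖B t - B s‖ ≤ L * ‖δ t - δ s‖ + (L * ‖δ s‖ + G) * (W t - W s) ^ α) →
      IsGerm α W X δ B → (∀ t, ‖δ t‖ ≤ C * (‖δ 0‖ + G)) ∧ HolderWrt α W (C * (‖δ 0‖ + G)) δ := by
  obtain ⟨C, η, hC, hη, hmain⟩ := DiscreteGerm.exists_const E F (α := α) (θ := α + 1 / 2) (L := L)
    (T := T) (by linarith) (by linarith) (by linarith) (by linarith) hL
  refine ⟨C + C * (C + 1), by positivity, ?_⟩
  intro G W X δ B hG hWm hWc hT hX hB hB' hJ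
  obtain ⟨K, hK0, hK⟩ := hJ.exists_nonneg hWm
  have pos : ∀ G', G < G' → ∀ s t, s ≤ t → ‖δ t‖ ≤ C * (‖δ s‖ + G') ∧
      ‖δ t - δ s‖ ≤ C * (‖δ s‖ + G') * (W t - W s) ^ α := by
    intro G' hGG' s t hst
    have hG' : 0 < G' := hG.trans_lt hGG'
    have htend : ∀ᶠ η' in 𝓝[>] (0 : ℝ), K * η' ^ (α - 1 / 2) < G' := by
      have : Tendsto (fun η : ℝ => K * η ^ (α - 1 / 2)) (𝓝[>] 0) (𝓝 0) := by
        have := (Real.continuousAt_rpow_const 0 (α - 1 / 2)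
          (Or.inr (by linarith))).tendsto.const_mul K
        rw [Real.zero_rpow (by linarith), mul_zero] at this
        exact this.mono_left nhdsWithin_le_nhds
      exact this.eventually (gt_mem_nhds hG')
    obtain ⟨η', hη'1, hη'⟩ := (htend.and self_mem_nhdsWithin).exists
    have hη'0 : 0 < η' := hη'
    obtain ⟨n, hn1, hn⟩ := ((eventually_grid_osc (hWc.comp (segPt_continuous s t))
      (lt_min hη hη'0)).and (eventually_gt_atTop 0)).exists
    set τ : ℕ → unitInterval := fun i => segPt s t (gridPt n i) with hτ
    have hτm : Monotone τ := (segPt_mono hst).comp (gridPt_mono n)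
    have hstep : ∀ i, W (τ (i + 1)) - W (τ i) < min η η' := fun i =>
      (le_abs_self _).trans_lt (hn1 i)
    have hτ0 : τ 0 = s := by simp [hτ]
    have hτn : τ n = t := by simp [hτ, gridPt_self hn]
    have hd : DiscreteGerm α (α + 1 / 2) L G' (W ∘ τ) (X ∘ τ) (δ ∘ τ) (B ∘ τ) := by
      refine ⟨hWm.comp hτm, fun i j hij => ?_, fun i => ?_, fun i j hij => ?_, fun i => ?_⟩
      · simpa using hX _ _ (hτm hij)
      · refine (hB _).trans ?_
        simp only [Function.comp]
        linarith
      · refine (hB' _ _ (hτm hij)).trans ?_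
        have := sub_nonneg.2 (hWm (hτm hij))
        simp only [Function.comp]
        gcongr
      · have h0 := sub_nonneg.2 (hWm (hτm (Nat.le_succ i)))
        refine (hK _ _ (hτm (Nat.le_succ i))).trans ?_
        simp only [Function.comp]
        have : (W (τ (i + 1)) - W (τ i)) ^ (2 * α) =
            (W (τ (i + 1)) - W (τ i)) ^ (α - 1 / 2) * (W (τ (i + 1)) - W (τ i)) ^ (α + 1 / 2) := by
          rw [← Real.rpow_add_of_nonneg h0 (by linarith) (by linarith)]; congr 1; ring
        rw [Nat.succ_eq_add_one] at *
        rw [this, ← mul_assoc]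
        gcongr
        refine le_trans ?_ hη'1.le
        gcongr
        exact (hstep i).le.trans (min_le_right _ _)
    have hT' : ∀ j, (W ∘ τ) j - (W ∘ τ) 0 ≤ T := by
      intro j
      have h1 := hWm (show τ j ≤ 1 from unitInterval.le_one')
      have h2 := hWm (show 0 ≤ τ 0 from unitInterval.nonneg')
      simp only [Function.comp]; linarith
    have := hmain G' _ _ _ _ hG'.le hd hT'
      (fun i => (hstep i).le.trans (min_le_left _ _)) 0 n (Nat.zero_le _)
    simp only [Function.comp, hτ0, hτn] at this
    exact ⟨this.1, this.2.1⟩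
  have lim : ∀ s t, s ≤ t → ‖δ t‖ ≤ C * (‖δ s‖ + G) ∧
      ‖δ t - δ s‖ ≤ C * (‖δ s‖ + G) * (W t - W s) ^ α := by
    intro s t hst
    constructor
    · have h : Tendsto (fun G' => C * (‖δ s‖ + G')) (𝓝[>] G) (𝓝 (C * (‖δ s‖ + G))) :=
        (Continuous.tendsto (by fun_prop) G).mono_left nhdsWithin_le_nhds
      exact ge_of_tendsto h (eventually_of_mem self_mem_nhdsWithin fun G' h => (pos G' h s t hst).1)
    · have h : Tendsto (fun G' => C * (‖δ s‖ + G') * (W t - W s) ^ α) (𝓝[>] G)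
          (𝓝 (C * (‖δ s‖ + G) * (W t - W s) ^ α)) :=
        (Continuous.tendsto (by fun_prop) G).mono_left nhdsWithin_le_nhds
      exact ge_of_tendsto h (eventually_of_mem self_mem_nhdsWithin fun G' h => (pos G' h s t hst).2)
  have hD : 0 ≤ ‖δ 0‖ + G := by positivity
  have h1 : ∀ t, ‖δ t‖ ≤ C * (‖δ 0‖ + G) := fun t => (lim 0 t unitInterval.nonneg').1
  refine ⟨fun t => (h1 t).trans ?_, fun s t hst => (lim s t hst).2.trans ?_⟩
  · gcongr
    have : 0 ≤ C * (C + 1) := by positivity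
    linarith
  · refine mul_le_mul_of_nonneg_right ?_ (Real.rpow_nonneg (sub_nonneg.2 (hWm hst)) α)
    calc C * (‖δ s‖ + G) ≤ C * (C * (‖δ 0‖ + G) + (‖δ 0‖ + G)) := by
          gcongr
          · exact h1 s
          · linarith [norm_nonneg (δ 0)]
      _ = C * (C + 1) * (‖δ 0‖ + G) := by ring
      _ ≤ _ := by gcongr; linarith

/-- The Euler scheme for `dy = b(t,y) dX` along the points `τ`. -/
def euler (b : unitInterval → E → F →L[ℝ] E) (X : unitInterval → F) (y₀ : E)
    (τ : ℕ → unitInterval) : ℕ → E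
  | 0 => y₀
  | i + 1 => euler b X y₀ τ i + b (τ i) (euler b X y₀ τ i) (X (τ (i + 1)) - X (τ i))

lemma gridPt_floor_tendsto (t : unitInterval) :
    Tendsto (fun n : ℕ => gridPt n ⌊(t : ℝ) * n⌋₊) atTop (𝓝 t) := by
  rw [tendsto_subtype_rng]
  have h : ∀ n : ℕ, 0 < n → |(gridPt n ⌊(t : ℝ) * n⌋₊ : ℝ) - t| ≤ 1 / n := by
    intro n hn
    have hn0 : (0 : ℝ) < n := by exact_mod_cast hn
    have h1 : (⌊(t : ℝ) * n⌋₊ : ℝ) ≤ t * n := Nat.floor_le (mul_nonneg t.2.1 hn0.le)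
    have h2 := Nat.lt_floor_add_one ((t : ℝ) * n)
    have h3 : (⌊(t : ℝ) * n⌋₊ : ℝ) / n ≤ t := by rwa [div_le_iff₀ hn0]
    simp only [gridPt]
    rw [min_eq_left (h3.trans t.2.2), abs_sub_comm, abs_of_nonneg (by linarith)]
    have : (t : ℝ) = t * n / n := by field_simp
    rw [this, ← sub_div, ← this]
    gcongr
    linarith
  rw [tendsto_iff_norm_sub_tendsto_zero]
  refine squeeze_zero' (Eventually.of_forall fun _ => norm_nonneg _)
    ((eventually_gt_atTop 0).mono fun n hn => h n hn) tendsto_one_div_atTop_nhds_zero_nat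

variable (E F) in
/-- Existence of solutions to `dy = b(t,y) dX` with `b` Lipschitz in `y` and Hölder in `t`, as
ultrafilter limit of Euler schemes; the Gronwall estimate passes to the limit. -/
theorem exists_germ_solution [FiniteDimensional ℝ E] {α L T : ℝ} (hα : 1 / 2 < α) (hL : 0 ≤ L) :
    ∃ C : ℝ, 0 ≤ C ∧ ∀ (G : ℝ) (W : unitInterval → ℝ) (X : unitInterval → F)
      (b : unitInterval → E → F →L[ℝ] E) (y₀ : E), 0 ≤ G → Monotone W → Continuous W →
      W 1 - W 0 ≤ T → HolderWrt α W 1 X → (∀ s y, ‖b s y‖ ≤ L * ‖y‖ + G) →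
      (∀ s t y y', ‖b t y' - b s y‖ ≤ L * ‖y' - y‖ + (L * ‖y‖ + G) * |W t - W s| ^ α) →
      ∃ y : unitInterval → E, y 0 = y₀ ∧ (∀ t, ‖y t‖ ≤ C * (‖y₀‖ + G)) ∧
        HolderWrt α W (C * (‖y₀‖ + G)) y ∧ IsGerm α W X y (fun s => b s (y s)) := by
  obtain ⟨C, η, hC, hη, hmain⟩ := DiscreteGerm.exists_const E F (α := α) (θ := 2 * α) (L := L)
    (T := T) (by linarith) (by linarith) (by linarith) le_rfl hL
  refine ⟨C, hC, ?_⟩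
  intro G W X b y₀ hG hWm hWc hT hX hb hb'
  have hα0 : 0 < α := by linarith
  have hXc : Continuous X := hX.continuous hα0 hWm hWc
  set D := C * (‖y₀‖ + G) with hD
  let z : ℕ → ℕ → E := fun n => euler b X y₀ (gridPt n)
  have hz0 : ∀ n, z n 0 = y₀ := fun n => rfl
  have est : ∀ᶠ n in atTop, ∀ i j, i ≤ j → ‖z n j‖ ≤ D ∧
      ‖z n j - z n i‖ ≤ D * (W (gridPt n j) - W (gridPt n i)) ^ α ∧
      ‖z n j - z n i - b (gridPt n i) (z n i) (X (gridPt n j) - X (gridPt n i))‖ ≤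
        D * (W (gridPt n j) - W (gridPt n i)) ^ (2 * α) := by
    filter_upwards [eventually_grid_osc hWc hη] with n hn
    have hd : DiscreteGerm α (2 * α) L G (W ∘ gridPt n) (X ∘ gridPt n) (z n)
        (fun i => b (gridPt n i) (z n i)) := by
      refine ⟨hWm.comp (gridPt_mono n), fun i j hij => ?_, fun i => hb _ _, fun i j hij => ?_,
        fun i => ?_⟩
      · simpa using hX _ _ (gridPt_mono n hij)
      · have := hb' (gridPt n i) (gridPt n j) (z n i) (z n j)
        rwa [abs_of_nonneg (sub_nonneg.2 (hWm (gridPt_mono n hij)))] at this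
      · have : z n (i + 1) - z n i - b (gridPt n i) (z n i)
            ((X ∘ gridPt n) (i + 1) - (X ∘ gridPt n) i) = 0 := by
          simp only [z, euler, Function.comp]
          abel
        rw [this, norm_zero]
        exact mul_nonneg hG (Real.rpow_nonneg
          (sub_nonneg.2 (hWm (gridPt_mono n (Nat.le_succ i)))) _)
    refine hmain G _ _ _ _ hG hd (fun j => ?_) (fun i => (le_abs_self _).trans (hn i).le)
    have h1 := hWm (show gridPt n j ≤ 1 from unitInterval.le_one')
    have h2 := hWm (show 0 ≤ gridPt n 0 from unitInterval.nonneg')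
    exact (sub_le_sub h1 h2).trans hT
  let 𝒰 : Ultrafilter ℕ := Ultrafilter.of atTop
  have h𝒰 : (𝒰 : Filter ℕ) ≤ atTop := Ultrafilter.of_le _
  let idx : unitInterval → ℕ → ℕ := fun t n => ⌊(t : ℝ) * n⌋₊
  have hlim : ∀ t, ∃ y, Tendsto (fun n => z n (idx t n)) 𝒰 (𝓝 y) := by
    intro t
    have : ProperSpace E := FiniteDimensional.proper ℝ E
    obtain ⟨y, -, hy⟩ := (isCompact_closedBall (0 : E) D).ultrafilter_le_nhds
      (𝒰.map fun n => z n (idx t n)) (by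
        rw [le_principal_iff]
        show ∀ᶠ n in (𝒰 : Filter ℕ), z n (idx t n) ∈ Metric.closedBall 0 D
        filter_upwards [h𝒰 est] with n hn
        simpa using (hn (idx t n) (idx t n) le_rfl).1)
    exact ⟨y, hy⟩
  choose y hy using hlim
  have hg : ∀ t, Tendsto (fun n => gridPt n (idx t n)) 𝒰 (𝓝 t) := fun t =>
    (gridPt_floor_tendsto t).mono_left h𝒰
  have hidx : ∀ s t : unitInterval, s ≤ t → ∀ n, idx s n ≤ idx t n := by
    intro s t hst n
    apply Nat.floor_mono
    gcongr
  have hWlim : ∀ s t, Tendsto (fun n => W (gridPt n (idx t n)) - W (gridPt n (idx s n))) 𝒰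
      (𝓝 (W t - W s)) := fun s t =>
    ((hWc.tendsto t).comp (hg t)).sub ((hWc.tendsto s).comp (hg s))
  refine ⟨y, ?_, fun t => ?_, fun s t hst => ?_, D, fun s t hst => ?_⟩
  · refine tendsto_nhds_unique (hy 0) ?_
    have : (fun n => z n (idx 0 n)) = fun _ => y₀ := by
      funext n; simp [idx, hz0]
    rw [this]
    exact tendsto_const_nhds
  · refine le_of_tendsto (hy t).norm ?_
    filter_upwards [h𝒰 est] with n hn
    exact (hn (idx t n) (idx t n) le_rfl).1
  · refine le_of_tendsto_of_tendsto ((hy t).sub (hy s)).norm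
      (((hWlim s t).rpow_const (Or.inr hα0.le)).const_mul D) ?_
    filter_upwards [h𝒰 est] with n hn
    exact (hn _ _ (hidx s t hst n)).2.1
  · have hblim : Tendsto (fun n => b (gridPt n (idx s n)) (z n (idx s n))) 𝒰 (𝓝 (b s (y s))) := by
      rw [tendsto_iff_norm_sub_tendsto_zero]
      refine squeeze_zero (fun _ => norm_nonneg _) (fun n => hb' s _ (y s) _) ?_
      have h1 := (tendsto_iff_norm_sub_tendsto_zero.1 (hy s)).const_mul L
      have h2 := (((((hWc.tendsto s).comp (hg s)).sub_const (W s)).abs).rpow_const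
        (p := α) (Or.inr hα0.le)).const_mul (L * ‖y s‖ + G)
      simpa [Real.zero_rpow hα0.ne'] using h1.add h2
    have hXlim : Tendsto (fun n => X (gridPt n (idx t n)) - X (gridPt n (idx s n))) 𝒰
        (𝓝 (X t - X s)) := ((hXc.tendsto t).comp (hg t)).sub ((hXc.tendsto s).comp (hg s))
    have happ : Tendsto (fun n => b (gridPt n (idx s n)) (z n (idx s n))
        (X (gridPt n (idx t n)) - X (gridPt n (idx s n)))) 𝒰 (𝓝 (b s (y s) (X t - X s))) :=
      ((isBoundedBilinearMap_apply (𝕜 := ℝ) (E := F) (F := E)).continuous.tendsto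
        (b s (y s), X t - X s)).comp (hblim.prodMk_nhds hXlim)
    refine le_of_tendsto_of_tendsto ((((hy t).sub (hy s)).sub
      happ).norm)
      (((hWlim s t).rpow_const (Or.inr (by linarith : 0 ≤ 2 * α))).const_mul D) ?_
    filter_upwards [h𝒰 est] with n hn
    exact (hn _ _ (hidx s t hst n)).2.2

end Continuous

/-! ### Clocks from finite variation -/

section Variation

open Filter Topology

variable {E : Type*} [NormedAddCommGroup E]

/-- The `p`-variation sum of `f` along `τ 0, …, τ N`. -/
def varSum (f : unitInterval → E) (p : ℝ) (N : ℕ) (τ : ℕ → unitInterval) : ℝ :=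
  ∑ i ∈ Finset.range N, ‖f (τ (i + 1)) - f (τ i)‖ ^ p

lemma varSum_nonneg (f : unitInterval → E) (p : ℝ) (N : ℕ) (τ : ℕ → unitInterval) :
    0 ≤ varSum f p N τ := Finset.sum_nonneg fun _ _ => Real.rpow_nonneg (norm_nonneg _) _

/-- Extending a dissection by one point on the right. -/
lemma IsDissection.snoc {a b c : unitInterval} {N : ℕ} {τ : ℕ → unitInterval}
    (h : IsDissection a b N τ) (hbc : b ≤ c) :
    IsDissection a c (N + 1) (fun i => if i ≤ N then τ i else c) := by
  obtain ⟨hm, h0, hN⟩ := h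
  refine ⟨fun i j hij => ?_, by simp [h0], by simp⟩
  by_cases hj : j ≤ N
  · simp only [hj, hij.trans hj, if_true]; exact hm hij
  · by_cases hi : i ≤ N
    · simp only [hi, hj, if_true, if_false]; exact (hm hi).trans (hN.trans_le hbc)
    · simp [hi, hj]

lemma varSum_snoc (f : unitInterval → E) (p : ℝ) {a b : unitInterval} {N : ℕ}
    {τ : ℕ → unitInterval} (h : IsDissection a b N τ) (c : unitInterval) :
    varSum f p (N + 1) (fun i => if i ≤ N then τ i else c) =
      varSum f p N τ + ‖f c - f b‖ ^ p := by
  unfold varSum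
  rw [Finset.sum_range_succ]
  congr 1
  · refine Finset.sum_congr rfl fun i hi => ?_
    rw [Finset.mem_range] at hi
    simp [show i + 1 ≤ N by omega, hi.le]
  · simp [h.2.2]

/-- Extending a dissection by one point on the left. -/
lemma IsDissection.cons {a b c : unitInterval} {N : ℕ} {τ : ℕ → unitInterval}
    (h : IsDissection a b N τ) (hca : c ≤ a) :
    IsDissection c b (N + 1) (fun i => if i = 0 then c else τ (i - 1)) := by
  obtain ⟨hm, h0, hN⟩ := h
  refine ⟨fun i j hij => ?_, by simp, by simp [hN]⟩
  rcases Nat.eq_zero_or_pos i with hi | hi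
  · rcases Nat.eq_zero_or_pos j with hj | hj
    · simp [hi, hj]
    · simp only [hi, if_true, hj.ne', if_false]
      exact hca.trans (h0 ▸ hm (Nat.zero_le _))
  · simp only [hi.ne', (hi.trans_le hij).ne', if_false]
    exact hm (by omega)

lemma varSum_le_cons (f : unitInterval → E) (p : ℝ) (c : unitInterval) (N : ℕ)
    (τ : ℕ → unitInterval) :
    varSum f p N τ ≤ varSum f p (N + 1) (fun i => if i = 0 then c else τ (i - 1)) := by
  unfold varSum
  rw [Finset.sum_range_succ']
  simp only [Nat.add_eq_zero_iff, one_ne_zero, and_false, if_false, Nat.add_sub_cancel]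
  exact le_add_of_nonneg_right (Real.rpow_nonneg (norm_nonneg _) _)

variable {f : unitInterval → E} {p r C : ℝ}

/-- A bound for the dissections of `[0,1]` holds for those of every subinterval. -/
lemma varSum_sub_le (hC : ∀ N τ, IsDissection 0 1 N τ → varSum f p N τ ≤ C) {a b : unitInterval}
    {N : ℕ} {τ : ℕ → unitInterval} (h : IsDissection a b N τ) : varSum f p N τ ≤ C := by
  have h1 := h.snoc (unitInterval.le_one' : b ≤ 1)
  have h3 := varSum_snoc f p h 1
  generalize (fun i => if i ≤ N then τ i else 1) = σ at h1 h3
  have h2 := h1.cons (unitInterval.nonneg' : 0 ≤ a)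
  have h4 := varSum_le_cons f p 0 (N + 1) σ
  generalize (fun i => if i = 0 then 0 else σ (i - 1)) = σ' at h2 h4
  have h5 := hC _ _ h2
  have h6 := Real.rpow_nonneg (norm_nonneg (f 1 - f b)) p
  linarith

lemma isDissection_pair {a b : unitInterval} (hab : a ≤ b) :
    IsDissection a b 1 (fun i => if i = 0 then a else b) := by
  refine ⟨fun i j hij => ?_, by simp, by simp⟩
  rcases Nat.eq_zero_or_pos i with hi | hi
  · rcases Nat.eq_zero_or_pos j with hj | hj
    · simp [hi, hj]
    · simp [hi, hj.ne', hab]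
  · simp [hi.ne', (hi.trans_le hij).ne']

lemma incr_le_of_varSum_le (hC : ∀ N τ, IsDissection 0 1 N τ → varSum f p N τ ≤ C)
    {a b : unitInterval} (hab : a ≤ b) : ‖f b - f a‖ ^ p ≤ C := by
  simpa [varSum] using varSum_sub_le hC (isDissection_pair hab)

lemma varSum_exponent_le (hp : 0 < p) (hpr : p ≤ r) {A : ℝ}
    {N : ℕ} {τ : ℕ → unitInterval} (hA : ∀ i < N, ‖f (τ (i + 1)) - f (τ i)‖ ≤ A) :
    varSum f r N τ ≤ A ^ (r - p) * varSum f p N τ := by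
  unfold varSum
  rw [Finset.mul_sum]
  refine Finset.sum_le_sum fun i hi => ?_
  have : ‖f (τ (i + 1)) - f (τ i)‖ ^ r =
      ‖f (τ (i + 1)) - f (τ i)‖ ^ (r - p) * ‖f (τ (i + 1)) - f (τ i)‖ ^ p := by
    rw [← Real.rpow_add_of_nonneg (norm_nonneg _) (by linarith) hp.le]; congr 1; ring
  rw [this]
  gcongr
  exact hA i (Finset.mem_range.1 hi)

lemma varSum_le_of_exponent_le (hp : 0 < p) (hpr : p ≤ r)
    (hC : ∀ N τ, IsDissection 0 1 N τ → varSum f p N τ ≤ C)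
    {a b : unitInterval} {N : ℕ} {τ : ℕ → unitInterval} (h : IsDissection a b N τ) :
    varSum f r N τ ≤ C ^ (r / p) := by
  have hC0 : 0 ≤ C := (varSum_nonneg f p _ _).trans (varSum_sub_le hC h)
  have hA : ∀ i < N, ‖f (τ (i + 1)) - f (τ i)‖ ≤ C ^ (1 / p) := by
    intro i _
    have := incr_le_of_varSum_le hC (h.1 (Nat.le_succ i))
    calc ‖f (τ (i + 1)) - f (τ i)‖ = (‖f (τ (i + 1)) - f (τ i)‖ ^ p) ^ (1 / p) := by
          rw [← Real.rpow_mul (norm_nonneg _), mul_one_div_cancel hp.ne', Real.rpow_one]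
      _ ≤ _ := by gcongr
  refine (varSum_exponent_le hp hpr hA).trans ?_
  calc (C ^ (1 / p)) ^ (r - p) * varSum f p N τ ≤ (C ^ (1 / p)) ^ (r - p) * C := by
        gcongr; exact varSum_sub_le hC h
    _ = C ^ ((r - p) / p) * C ^ (1 : ℝ) := by
        rw [← Real.rpow_mul hC0, Real.rpow_one]; congr 2; ring
    _ = C ^ (r / p) := by
        rw [← Real.rpow_add_of_nonneg hC0 (div_nonneg (by linarith) hp.le) zero_le_one]
        congr 1; field_simp; ring

/-- Convexity of `x ↦ x ^ r` for the weights `1 - l` and `l`. As `l → 0` the coefficient of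
`x ^ r` tends to `1`, while the large coefficient only meets `y`. -/
lemma add_rpow_le_weighted {l : ℝ} (hl0 : 0 < l) (hl1 : l < 1) (hr : 1 ≤ r) {x y : ℝ} (hx : 0 ≤ x)
    (hy : 0 ≤ y) : (x + y) ^ r ≤ (1 - l) ^ (1 - r) * x ^ r + l ^ (1 - r) * y ^ r := by
  have h1 : 0 < 1 - l := by linarith
  have h := (convexOn_rpow hr).2 (x := x / (1 - l)) (y := y / l) (div_nonneg hx h1.le)
    (div_nonneg hy hl0.le) h1.le hl0.le (by ring)
  simp only [smul_eq_mul] at h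
  rw [mul_div_cancel₀ _ h1.ne', mul_div_cancel₀ _ hl0.ne', Real.div_rpow hx h1.le,
    Real.div_rpow hy hl0.le] at h
  refine h.trans (le_of_eq ?_)
  rw [Real.rpow_sub h1, Real.rpow_sub hl0, Real.rpow_one, Real.rpow_one]
  ring

/-- The `r`-variation of `f` over `[0,t]`, as a function of `t`. -/
def varClock (f : unitInterval → E) (r : ℝ) (t : unitInterval) : ℝ :=
  sSup {x | ∃ N τ, IsDissection 0 t N τ ∧ x = varSum f r N τ}

/-- A continuous path of finite `p`-variation is `1/r`-Hölder relative to a continuous clock, for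
every `r > p`. The gap between `p` and `r` makes the `r`-variation over short intervals uniformly
small, which gives continuity of the clock. -/
theorem exists_clock (hf : Continuous f) (hp : 1 ≤ p) (hpr : p < r)
    (hC : ∀ N τ, IsDissection 0 1 N τ → varSum f p N τ ≤ C) :
    ∃ W : unitInterval → ℝ, Monotone W ∧ Continuous W ∧ W 1 - W 0 ≤ C ^ (r / p) ∧
      ∀ s t, s ≤ t → ‖f t - f s‖ ^ r ≤ W t - W s := by
  have hp0 : 0 < p := by linarith
  set V := C ^ (r / p) with hV
  have hC0 : 0 ≤ C := (Real.rpow_nonneg (norm_nonneg _) _).trans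
    (incr_le_of_varSum_le hC (le_refl (0 : unitInterval)))
  have hV0 : 0 ≤ V := Real.rpow_nonneg hC0 _
  set S : unitInterval → Set ℝ := fun t => {x | ∃ N τ, IsDissection 0 t N τ ∧ x = varSum f r N τ}
    with hS
  have hbdd : ∀ t, BddAbove (S t) := fun t => ⟨V, by
    rintro x ⟨N, τ, h, rfl⟩; exact varSum_le_of_exponent_le hp0 hpr.le hC h⟩
  have hne : ∀ t, (S t).Nonempty := fun t => ⟨_, _, _, isDissection_pair unitInterval.nonneg', rfl⟩
  have hle : ∀ t N τ, IsDissection 0 t N τ → varSum f r N τ ≤ varClock f r t := fun t N τ h =>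
    le_csSup (hbdd t) ⟨N, τ, h, rfl⟩
  have hW0 : ∀ t, 0 ≤ varClock f r t := fun t =>
    (varSum_nonneg f r _ _).trans (hle t _ _ (isDissection_pair unitInterval.nonneg'))
  have hWV : ∀ t, varClock f r t ≤ V := fun t => csSup_le (hne t) (by
    rintro x ⟨N, τ, h, rfl⟩; exact varSum_le_of_exponent_le hp0 hpr.le hC h)
  have hincr : ∀ s t, s ≤ t → ‖f t - f s‖ ^ r ≤ varClock f r t - varClock f r s := by
    intro s t hst
    rw [le_sub_iff_add_le, add_comm, ← le_sub_iff_add_le]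
    refine csSup_le (hne s) ?_
    rintro x ⟨N, τ, h, rfl⟩
    have := hle t _ _ (h.snoc hst)
    rw [varSum_snoc f r h] at this
    linarith
  have hmono : Monotone (varClock f r) := fun s t hst => by
    have := hincr s t hst
    have := Real.rpow_nonneg (norm_nonneg (f t - f s)) r
    linarith
  -- splitting a dissection of `[0,u]` at `t`
  have hsplit : ∀ l, 0 < l → l < 1 → ∀ A, ∀ t u, t ≤ u →
      (∀ x y, t ≤ x → x ≤ y → y ≤ u → ‖f y - f x‖ ≤ A) →
      varClock f r u ≤ (1 - l) ^ (1 - r) * varClock f r t + l ^ (1 - r) * (A ^ (r - p) * C) := by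
    intro l hl0 hl1 A t u htu hA
    refine csSup_le (hne u) ?_
    rintro x ⟨N, τ, h, rfl⟩
    have hA0 : 0 ≤ A := (norm_nonneg _).trans (hA t t le_rfl le_rfl htu)
    have h1 : IsDissection 0 t N (fun i => min (τ i) t) :=
      ⟨fun i j hij => min_le_min_right _ (h.1 hij), by
        show min (τ 0) t = 0
        rw [h.2.1]; exact min_eq_left unitInterval.nonneg', by
        show min (τ N) t = t
        rw [h.2.2]; exact min_eq_right htu⟩
    have h2 : IsDissection t u N (fun i => max (τ i) t) :=
      ⟨fun i j hij => max_le_max_right _ (h.1 hij), by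
        show max (τ 0) t = t
        rw [h.2.1]; exact max_eq_right unitInterval.nonneg', by
        show max (τ N) t = u
        rw [h.2.2]; exact max_eq_left htu⟩
    have h3 : varSum f r N (fun i => max (τ i) t) ≤ A ^ (r - p) * C := by
      refine (varSum_exponent_le (A := A) hp0 hpr.le fun i hi => ?_).trans ?_
      · refine hA _ _ (le_max_right _ _) (h2.1 (Nat.le_succ i)) ?_
        have := h2.1 (show i + 1 ≤ N from hi)
        simpa [h2.2.2, h.2.2, htu] using this
      · gcongr
        exact varSum_sub_le hC h2
    have h4 := hle t _ _ h1
    have h1l : 0 < 1 - l := by linarith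
    calc varSum f r N τ ≤ (1 - l) ^ (1 - r) * varSum f r N (fun i => min (τ i) t) +
          l ^ (1 - r) * varSum f r N (fun i => max (τ i) t) := by
          unfold varSum
          rw [Finset.mul_sum, Finset.mul_sum, ← Finset.sum_add_distrib]
          refine Finset.sum_le_sum fun i _ => ?_
          refine le_trans ?_ (add_rpow_le_weighted hl0 hl1 (by linarith) (norm_nonneg _)
            (norm_nonneg _))
          refine Real.rpow_le_rpow (norm_nonneg _) ?_ (by linarith)
          have hdec : ∀ v : unitInterval, f v = f (min v t) + f (max v t) - f t := by
            intro v
            rcases le_total v t with hv | hv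
            · rw [min_eq_left hv, max_eq_right hv]; abel
            · rw [min_eq_right hv, max_eq_left hv]; abel
          rw [hdec (τ (i + 1)), hdec (τ i)]
          refine le_trans (le_of_eq ?_) (norm_add_le _ _)
          congr 1; abel
      _ ≤ _ := by gcongr
  have hunif : ∀ ε > 0, ∃ δ > 0, ∀ t u : unitInterval, t ≤ u → (u : ℝ) - t < δ →
      varClock f r u - varClock f r t < ε := by
    intro ε hε
    obtain ⟨l, hl, hl0, hl1⟩ : ∃ l : ℝ, ((1 - l) ^ (1 - r) - 1) * V < ε / 2 ∧ 0 < l ∧ l < 1 := by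
      have hc : Tendsto (fun l : ℝ => ((1 - l) ^ (1 - r) - 1) * V) (𝓝[>] 0) (𝓝 0) := by
        have : ContinuousAt (fun l : ℝ => ((1 - l) ^ (1 - r) - 1) * V) 0 := by
          refine ContinuousAt.mul (ContinuousAt.sub (ContinuousAt.rpow_const ?_ (Or.inl ?_))
            continuousAt_const) continuousAt_const
          · fun_prop
          · norm_num
        have := this.tendsto
        simp only [sub_zero, Real.one_rpow, sub_self, zero_mul] at this
        exact this.mono_left nhdsWithin_le_nhds
      have e1 : ∀ᶠ l : ℝ in 𝓝[>] 0, l < 1 := nhdsWithin_le_nhds (gt_mem_nhds one_pos)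
      exact ((hc.eventually (gt_mem_nhds (half_pos hε))).and
        (Eventually.and (self_mem_nhdsWithin : ∀ᶠ l : ℝ in 𝓝[>] 0, l ∈ Ioi 0) e1)).exists
    obtain ⟨A, hA, hA0⟩ : ∃ A : ℝ, l ^ (1 - r) * (A ^ (r - p) * C) < ε / 2 ∧ 0 < A := by
      have hc : Tendsto (fun A : ℝ => l ^ (1 - r) * (A ^ (r - p) * C)) (𝓝[>] 0) (𝓝 0) := by
        have := (((Real.continuousAt_rpow_const 0 (r - p)
          (Or.inr (by linarith))).tendsto.mul_const C).const_mul (l ^ (1 - r)))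
        rw [Real.zero_rpow (by linarith), zero_mul, mul_zero] at this
        exact this.mono_left nhdsWithin_le_nhds
      exact ((hc.eventually (gt_mem_nhds (half_pos hε))).and self_mem_nhdsWithin).exists
    obtain ⟨δ, hδ, hfδ⟩ := Metric.uniformContinuous_iff.1
      (CompactSpace.uniformContinuous_of_continuous hf) A hA0
    refine ⟨δ, hδ, fun t u htu hd => ?_⟩
    have := hsplit l hl0 hl1 A t u htu (fun x y h1 h2 h3 => by
      rw [← dist_eq_norm]
      refine (hfδ ?_).le
      have h1' : (t : ℝ) ≤ x := h1
      have h2' : (x : ℝ) ≤ y := h2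
      have h3' : (y : ℝ) ≤ u := h3
      rw [Subtype.dist_eq, Real.dist_eq, abs_of_nonneg (by linarith)]
      linarith)
    have h5 : ((1 - l) ^ (1 - r) - 1) * varClock f r t ≤ ((1 - l) ^ (1 - r) - 1) * V := by
      have : (1 : ℝ) ≤ (1 - l) ^ (1 - r) :=
        Real.one_le_rpow_of_pos_of_le_one_of_nonpos (by linarith) (by linarith) (by linarith)
      exact mul_le_mul_of_nonneg_left (hWV t) (by linarith)
    linarith
  refine ⟨varClock f r, hmono, ?_, ?_, hincr⟩
  · rw [Metric.continuous_iff]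
    intro t ε hε
    obtain ⟨δ, hδ, h⟩ := hunif ε hε
    refine ⟨δ, hδ, fun s hs => ?_⟩
    rw [Subtype.dist_eq, Real.dist_eq] at hs
    rw [Real.dist_eq]
    rcases le_total s t with hst | hst
    · rw [abs_sub_comm, abs_of_nonneg (sub_nonneg.2 (hmono hst))]
      rw [abs_sub_comm] at hs
      exact h s t hst ((le_abs_self _).trans_lt hs)
    · rw [abs_of_nonneg (sub_nonneg.2 (hmono hst))]
      exact h t s hst ((le_abs_self _).trans_lt hs)
  · linarith [hWV 1, hW0 0]

lemma holderWrt_of_rpow_le {W : unitInterval → ℝ} (hr : 0 < r)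
    (h : ∀ s t, s ≤ t → ‖f t - f s‖ ^ r ≤ W t - W s) : HolderWrt (1 / r) W 1 f := by
  intro s t hst
  rw [one_mul]
  calc ‖f t - f s‖ = (‖f t - f s‖ ^ r) ^ (1 / r) := by
        rw [← Real.rpow_mul (norm_nonneg _), mul_one_div_cancel hr.ne', Real.rpow_one]
    _ ≤ _ := by
        have := Real.rpow_nonneg (norm_nonneg (f t - f s)) r
        gcongr
        exact h s t hst

lemma HolderWrt.varSum_le {W : unitInterval → ℝ} {A : ℝ} (hW : Monotone W) (hr : 0 < r)
    (hA : 0 ≤ A) (h : HolderWrt (1 / r) W A f) {N : ℕ} {τ : ℕ → unitInterval}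
    (hτ : Monotone τ) : varSum f r N τ ≤ A ^ r * (W (τ N) - W (τ 0)) := by
  unfold varSum
  rw [← Finset.sum_range_sub (fun i => W (τ i)), Finset.mul_sum]
  refine Finset.sum_le_sum fun i _ => ?_
  have h0 := sub_nonneg.2 (hW (hτ (Nat.le_succ i)))
  calc ‖f (τ (i + 1)) - f (τ i)‖ ^ r ≤ (A * (W (τ (i + 1)) - W (τ i)) ^ (1 / r)) ^ r := by
        gcongr; exact h _ _ (hτ (Nat.le_succ i))
    _ = _ := by
        rw [Real.mul_rpow hA (Real.rpow_nonneg h0 _), ← Real.rpow_mul h0,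
          one_div_mul_cancel hr.ne', Real.rpow_one]

lemma HolderWrt.mono_clock {E : Type*} [NormedAddCommGroup E] {f : unitInterval → E} {α A : ℝ}
    {W W' : unitInterval → ℝ} (hα : 0 ≤ α) (hA : 0 ≤ A) (hW : Monotone W)
    (h : HolderWrt α W A f) (hWW' : ∀ s t, s ≤ t → W t - W s ≤ W' t - W' s) :
    HolderWrt α W' A f := by
  intro s t hst
  refine (h s t hst).trans ?_
  have := sub_nonneg.2 (hW hst)
  gcongr ?_ * ?_ ^ _
  exact hWW' s t hst

lemma HolderWrt.mono_const {E : Type*} [NormedAddCommGroup E] {f : unitInterval → E} {α A A' : ℝ}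
    {W : unitInterval → ℝ} (hW : Monotone W)
    (h : HolderWrt α W A f) (hAA' : A ≤ A') : HolderWrt α W A' f := fun s t hst =>
  (h s t hst).trans (mul_le_mul_of_nonneg_right hAA' (Real.rpow_nonneg (sub_nonneg.2 (hW hst)) _))

end Variation

/-! ### Young integrals -/

section Young

open Filter Topology

variable {n : ℕ}

lemma sum_clock_rpow_le {β η : ℝ} (hβ : 1 < β) (hη0 : 0 ≤ η) {W : unitInterval → ℝ}
    (hW : Monotone W) {N : ℕ} {τ : ℕ → unitInterval} (hτ : Monotone τ)
    (hη : ∀ i < N, W (τ (i + 1)) - W (τ i) ≤ η) :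
    ∑ i ∈ Finset.range N, (W (τ (i + 1)) - W (τ i)) ^ β ≤ η ^ (β - 1) * (W 1 - W 0) := by
  calc ∑ i ∈ Finset.range N, (W (τ (i + 1)) - W (τ i)) ^ β
      ≤ ∑ i ∈ Finset.range N, η ^ (β - 1) * (W (τ (i + 1)) - W (τ i)) := by
        refine Finset.sum_le_sum fun i hi => ?_
        have h0 := sub_nonneg.2 (hW (hτ (Nat.le_succ i)))
        have : (W (τ (i + 1)) - W (τ i)) ^ β =
            (W (τ (i + 1)) - W (τ i)) ^ (β - 1) * (W (τ (i + 1)) - W (τ i)) := by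
          rw [← Real.rpow_add_one' h0 (by linarith), sub_add_cancel]
        rw [this]
        have := hη i (Finset.mem_range.1 hi)
        gcongr
    _ = η ^ (β - 1) * (W (τ N) - W (τ 0)) := by
        rw [← Finset.mul_sum, Finset.sum_range_sub (fun i => W (τ i))]
    _ ≤ _ := by
        have h1 := hW (unitInterval.le_one' : τ N ≤ 1)
        have h2 := hW (unitInterval.nonneg' : 0 ≤ τ 0)
        gcongr

/-- Riemann sums with the left endpoint rule approximate a path given by its germ. -/
lemma norm_sub_sum_le {E : Type*} [NormedAddCommGroup E] {α K η : ℝ} (hα : 1 / 2 < α) (hη0 : 0 ≤ η)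
    (hK0 : 0 ≤ K) {W : unitInterval → ℝ} (hW : Monotone W) {δ : unitInterval → E}
    {A : unitInterval → unitInterval → E}
    (hK : ∀ s t, s ≤ t → ‖δ t - δ s - A s t‖ ≤ K * (W t - W s) ^ (2 * α))
    {N : ℕ} {τ : ℕ → unitInterval} (hτ : Monotone τ)
    (hη : ∀ i < N, W (τ (i + 1)) - W (τ i) ≤ η) :
    ‖δ (τ N) - δ (τ 0) - ∑ i ∈ Finset.range N, A (τ i) (τ (i + 1))‖ ≤
      K * (η ^ (2 * α - 1) * (W 1 - W 0)) := by
  rw [← Finset.sum_range_sub (fun i => δ (τ i)), ← Finset.sum_sub_distrib]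
  refine (norm_sum_le _ _).trans ?_
  calc _ ≤ ∑ i ∈ Finset.range N, K * (W (τ (i + 1)) - W (τ i)) ^ (2 * α) :=
        Finset.sum_le_sum fun i _ => hK _ _ (hτ (Nat.le_succ i))
    _ ≤ _ := by
        rw [← Finset.mul_sum]
        gcongr
        exact sum_clock_rpow_le (by linarith) hη0 hW hτ hη

lemma exists_small_rpow {β ε : ℝ} (hβ : 0 < β) (hε : 0 < ε) (M : ℝ) :
    ∃ η : ℝ, 0 < η ∧ M * η ^ β < ε := by
  have hc : Tendsto (fun η : ℝ => M * η ^ β) (𝓝[>] 0) (𝓝 0) := by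
    have := ((Real.continuousAt_rpow_const 0 β (Or.inr hβ.le)).tendsto.const_mul M)
    rw [Real.zero_rpow hβ.ne', mul_zero] at this
    exact this.mono_left nhdsWithin_le_nhds
  obtain ⟨η, h1, h2⟩ := ((hc.eventually (gt_mem_nhds hε)).and self_mem_nhdsWithin).exists
  exact ⟨η, h2, h1⟩

/-- Left endpoint Riemann sums over uniform grids converge to the increment of the path. -/
lemma tendsto_grid_sum {E : Type*} [NormedAddCommGroup E] {α K : ℝ} (hα : 1 / 2 < α)
    (hK0 : 0 ≤ K) {W : unitInterval → ℝ} (hW : Monotone W) (hWc : Continuous W)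
    {δ : unitInterval → E} {A : unitInterval → unitInterval → E}
    (hK : ∀ s t, s ≤ t → ‖δ t - δ s - A s t‖ ≤ K * (W t - W s) ^ (2 * α)) :
    Tendsto (fun n : ℕ => ∑ i ∈ Finset.range n, A (gridPt n i) (gridPt n (i + 1))) atTop
      (𝓝 (δ 1 - δ 0)) := by
  rw [Metric.tendsto_atTop']
  intro ε hε
  obtain ⟨η, hη0, hη⟩ := exists_small_rpow (β := 2 * α - 1) (by linarith) hε (K * (W 1 - W 0))
  obtain ⟨N, hN⟩ := eventually_atTop.1 ((eventually_grid_osc hWc hη0).and (eventually_gt_atTop 0))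
  refine ⟨N, fun n hn => ?_⟩
  have h := norm_sub_sum_le (N := n) hα hη0.le hK0 hW hK (gridPt_mono n)
    (fun i _ => (le_abs_self _).trans ((hN n hn.le).1 i).le)
  rw [gridPt_self (hN n hn.le).2, gridPt_zero, norm_sub_rev] at h
  rw [dist_eq_norm]
  refine h.trans_lt (lt_of_eq_of_lt ?_ hη)
  ring

lemma isDissection_seg {a b : unitInterval} (hab : a ≤ b) {n : ℕ} (hn : 0 < n) :
    IsDissection a b n (fun i => segPt a b (gridPt n i)) :=
  ⟨(segPt_mono hab).comp (gridPt_mono n), by simp, by simp [gridPt_self hn]⟩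

lemma HasYoungIntegral.unique {F : unitInterval → EuclideanSpace ℝ (Fin n)}
    {g : unitInterval → ℝ} {a b : unitInterval} (hab : a ≤ b) {J J' : EuclideanSpace ℝ (Fin n)}
    (h : HasYoungIntegral F g a b J) (h' : HasYoungIntegral F g a b J') : J = J' := by
  refine eq_of_forall_dist_le fun ε hε => ?_
  obtain ⟨δ, hδ, H⟩ := h (ε / 2) (half_pos hε)
  obtain ⟨δ', hδ', H'⟩ := h' (ε / 2) (half_pos hε)
  obtain ⟨N, hN, hN0⟩ := ((eventually_grid_osc
    (f := fun u => ((segPt a b u : unitInterval) : ℝ))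
    (continuous_subtype_val.comp (segPt_continuous a b)) (lt_min hδ hδ')).and
    (eventually_gt_atTop 0)).exists
  have hd := isDissection_seg hab hN0
  have hξ : ∀ i < N, segPt a b (gridPt N i) ∈
      Icc (segPt a b (gridPt N i)) (segPt a b (gridPt N (i + 1))) :=
    fun i _ => ⟨le_rfl, hd.1 (Nat.le_succ i)⟩
  have h1 := H N _ (fun i => segPt a b (gridPt N i)) hd (fun i _ =>
    (le_abs_self _).trans_lt ((hN i).trans_le (min_le_left _ _))) hξ
  have h2 := H' N _ (fun i => segPt a b (gridPt N i)) hd (fun i _ =>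
    (le_abs_self _).trans_lt ((hN i).trans_le (min_le_right _ _))) hξ
  rw [dist_eq_norm]
  generalize (∑ i ∈ Finset.range N, _ : EuclideanSpace ℝ (Fin n)) = S at h1 h2
  rw [← norm_neg] at h1
  calc ‖J - J'‖ = ‖-(S - J) + (S - J')‖ := by congr 1; abel
    _ ≤ _ := norm_add_le _ _
    _ ≤ ε := by linarith

/-- A path with germ `F dg`, for Hölder `F` and `g`, is the indefinite Young integral. -/
lemma hasYoungIntegral_of_germ {α K A B : ℝ} (hα : 1 / 2 < α) (hK0 : 0 ≤ K) (hA : 0 ≤ A)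
    (hB : 0 ≤ B) {W : unitInterval → ℝ} (hW : Monotone W) (hWc : Continuous W)
    {F y : unitInterval → EuclideanSpace ℝ (Fin n)} {g : unitInterval → ℝ}
    (hF : HolderWrt α W A F) (hg : HolderWrt α W B g)
    (hK : ∀ s t, s ≤ t → ‖y t - y s - (g t - g s) • F s‖ ≤ K * (W t - W s) ^ (2 * α))
    (t : unitInterval) : HasYoungIntegral F g 0 t (y t - y 0) := by
  intro ε hε
  obtain ⟨η, hη0, hη⟩ := exists_small_rpow (β := 2 * α - 1) (by linarith) hε
    ((K + A * B) * (W 1 - W 0))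
  obtain ⟨δ, hδ, h⟩ := Metric.uniformContinuous_iff.1
    (CompactSpace.uniformContinuous_of_continuous hWc) η hη0
  refine ⟨δ, hδ, fun N τ ξ hd hmesh hξ => ?_⟩
  have hstep : ∀ i < N, W (τ (i + 1)) - W (τ i) ≤ η := by
    intro i hi
    have h0 : τ i ≤ τ (i + 1) := hd.1 (Nat.le_succ i)
    refine (le_abs_self _).trans (le_of_lt ?_)
    have := h (a := τ (i + 1)) (b := τ i) (by
      rw [Subtype.dist_eq, Real.dist_eq, abs_of_nonneg (sub_nonneg.2 (Subtype.coe_le_coe.2 h0))]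
      exact hmesh i hi)
    rwa [Real.dist_eq] at this
  have h1 := norm_sub_sum_le (N := N) (A := fun s t => (g t - g s) • F s) hα hη0.le hK0 hW hK
    hd.1 hstep
  rw [hd.2.1, hd.2.2] at h1
  have h2 : ‖∑ i ∈ Finset.range N, (g (τ (i + 1)) - g (τ i)) • F (ξ i) -
      ∑ i ∈ Finset.range N, (g (τ (i + 1)) - g (τ i)) • F (τ i)‖ ≤
      A * B * (η ^ (2 * α - 1) * (W 1 - W 0)) := by
    rw [← Finset.sum_sub_distrib]
    refine (norm_sum_le _ _).trans ?_
    calc _ ≤ ∑ i ∈ Finset.range N, A * B * (W (τ (i + 1)) - W (τ i)) ^ (2 * α) := by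
          refine Finset.sum_le_sum fun i hi => ?_
          have hξi := hξ i (Finset.mem_range.1 hi)
          have h0 := sub_nonneg.2 (hW (hd.1 (Nat.le_succ i)))
          rw [← smul_sub, norm_smul]
          have e1 := hg _ _ (hd.1 (Nat.le_succ i))
          have e2 : ‖F (ξ i) - F (τ i)‖ ≤ A * (W (τ (i + 1)) - W (τ i)) ^ α := by
            refine (hF _ _ hξi.1).trans ?_
            have := sub_nonneg.2 (hW hξi.1)
            have := hW hξi.2
            gcongr
          calc _ ≤ (B * (W (τ (i + 1)) - W (τ i)) ^ α) * (A * (W (τ (i + 1)) - W (τ i)) ^ α) := by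
                gcongr
            _ = A * B * ((W (τ (i + 1)) - W (τ i)) ^ α * (W (τ (i + 1)) - W (τ i)) ^ α) := by ring
            _ = _ := by
                rw [← Real.rpow_add_of_nonneg h0 (by linarith) (by linarith), two_mul]
      _ ≤ _ := by
          rw [← Finset.mul_sum]
          gcongr
          exact sum_clock_rpow_le (by linarith) hη0.le hW hd.1 hstep
  rw [norm_sub_rev] at h1
  calc _ = ‖(∑ i ∈ Finset.range N, (g (τ (i + 1)) - g (τ i)) • F (ξ i) -
      ∑ i ∈ Finset.range N, (g (τ (i + 1)) - g (τ i)) • F (τ i)) +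
      (∑ i ∈ Finset.range N, (g (τ (i + 1)) - g (τ i)) • F (τ i) - (y t - y 0))‖ := by
        congr 1; abel
    _ ≤ _ := norm_add_le _ _
    _ ≤ A * B * (η ^ (2 * α - 1) * (W 1 - W 0)) + K * (η ^ (2 * α - 1) * (W 1 - W 0)) :=
        add_le_add h2 h1
    _ = (K + A * B) * (W 1 - W 0) * η ^ (2 * α - 1) := by ring
    _ < ε := hη

lemma HolderWrt.bounded {E : Type*} [NormedAddCommGroup E] {α A : ℝ} (hα : 0 < α)
    {W : unitInterval → ℝ} (hW : Monotone W) (hWc : Continuous W) {f : unitInterval → E}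
    (h : HolderWrt α W A f) : ∃ M, 0 ≤ M ∧ ∀ t, ‖f t‖ ≤ M := by
  obtain ⟨M, hM⟩ := (isCompact_range (h.continuous hα hW hWc)).isBounded.exists_norm_le
  exact ⟨M, (norm_nonneg _).trans (hM (f 0) ⟨0, rfl⟩), fun t => hM _ ⟨t, rfl⟩⟩

lemma HolderWrt.rescale {E : Type*} [NormedAddCommGroup E] {α B : ℝ} (hα : 0 < α) (hB : 0 ≤ B)
    {W : unitInterval → ℝ} (hW : Monotone W) {f : unitInterval → E} (h : HolderWrt α W B f) :
    HolderWrt α (fun t => B ^ (1 / α) * W t) 1 f := by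
  intro s t hst
  refine (h s t hst).trans (le_of_eq ?_)
  rw [← mul_sub, Real.mul_rpow (Real.rpow_nonneg hB _) (sub_nonneg.2 (hW hst)),
    ← Real.rpow_mul hB, one_div_mul_cancel hα.ne', Real.rpow_one, one_mul]

/-- Existence of the indefinite Young integral, with its germ. -/
lemma exists_indefinite_integral {α A B : ℝ} (hα : 1 / 2 < α) (hA : 0 ≤ A) (hB : 0 ≤ B)
    {W : unitInterval → ℝ} (hW : Monotone W) (hWc : Continuous W)
    {F : unitInterval → EuclideanSpace ℝ (Fin n)}
    {g : unitInterval → ℝ} (hF : HolderWrt α W A F) (hg : HolderWrt α W B g) :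
    ∃ y : unitInterval → EuclideanSpace ℝ (Fin n), y 0 = 0 ∧ ∃ K, 0 ≤ K ∧
      ∀ s t, s ≤ t → ‖y t - y s - (g t - g s) • F s‖ ≤ K * (W t - W s) ^ (2 * α) := by
  have hα0 : 0 < α := by linarith
  obtain ⟨M, hM0, hM⟩ := hF.bounded hα0 hW hWc
  obtain ⟨C, -, H⟩ := exists_germ_solution (EuclideanSpace ℝ (Fin n)) ℝ (L := 0)
    (T := (B + 1) ^ (1 / α) * W 1 - (B + 1) ^ (1 / α) * W 0) hα le_rfl
  have hB1 : 1 ≤ (B + 1) ^ (1 / α) := Real.one_le_rpow (by linarith) (by positivity)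
  set c := (B + 1) ^ (1 / α) with hc
  have hWm' : Monotone fun t => c * W t := hW.const_mul (by linarith)
  have hF' : HolderWrt α (fun t => c * W t) A F := hF.mono_clock hα0.le hA hW (fun s t hst => by
    have := sub_nonneg.2 (hW hst); nlinarith)
  obtain ⟨y, hy0, -, -, hy⟩ := H (M + A) (fun t => c * W t) g
    (fun s _ => ContinuousLinearMap.toSpanSingleton ℝ (F s))
    0 (by positivity) hWm' (by fun_prop) le_rfl
    ((hg.mono_const hW (by linarith : B ≤ B + 1)).rescale hα0 (by linarith) hW) (fun s y => by
      simp only [ContinuousLinearMap.norm_toSpanSingleton]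
      have := hM s; linarith) (fun s t y y' => by
      have hsub : ContinuousLinearMap.toSpanSingleton ℝ (F t) -
          ContinuousLinearMap.toSpanSingleton ℝ (F s) =
          ContinuousLinearMap.toSpanSingleton ℝ (F t - F s) := by ext; simp
      rw [hsub, ContinuousLinearMap.norm_toSpanSingleton]
      refine (hF'.abs hWm' s t).trans ?_
      have := Real.rpow_nonneg (abs_nonneg (c * W t - c * W s)) α
      nlinarith)
  obtain ⟨K, hK0, hK⟩ := hy.exists_nonneg hWm'
  refine ⟨y, hy0, K * c ^ (2 * α), by positivity, fun s t hst => ?_⟩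
  have := hK s t hst
  rw [← mul_sub, Real.mul_rpow (by linarith) (sub_nonneg.2 (hW hst)), ← mul_assoc] at this
  simpa using this

end Young

/-! ### Vector fields with bounded derivatives -/

section Fields

variable {E G : Type*} [NormedAddCommGroup E] [NormedSpace ℝ E]
  [NormedAddCommGroup G] [NormedSpace ℝ G]

/-- `f` and its first derivative are bounded by `C`, and its first two derivatives are
`C`-Lipschitz. -/
structure BoundedLipDeriv (f : E → G) (C : ℝ) : Prop where
  nonneg : 0 ≤ C
  diff : Differentiable ℝ f
  diff_fderiv : Differentiable ℝ (fderiv ℝ f)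
  norm_le : ∀ x, ‖f x‖ ≤ C
  fderiv_le : ∀ x, ‖fderiv ℝ f x‖ ≤ C
  fderiv_lip : ∀ x y, ‖fderiv ℝ f y - fderiv ℝ f x‖ ≤ C * ‖y - x‖
  fderiv_fderiv_lip : ∀ x y, ‖fderiv ℝ (fderiv ℝ f) y - fderiv ℝ (fderiv ℝ f) x‖ ≤ C * ‖y - x‖

lemma hasFDerivAt_const_add {f : E → G} (hf : Differentiable ℝ f) (x u : E) :
    HasFDerivAt (fun u => f (x + u)) (fderiv ℝ f (x + u)) u :=
  (hasFDerivAt_comp_add_left x).2 (hf (x + u)).hasFDerivAt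

/-- The second order difference of a function with Lipschitz derivative. -/
lemma norm_cross_diff_le {f : E → G} {C : ℝ} (hf : Differentiable ℝ f)
    (hL : ∀ x y, ‖fderiv ℝ f y - fderiv ℝ f x‖ ≤ C * ‖y - x‖) (x y δ : E) :
    ‖(f (y + δ) - f y) - (f (x + δ) - f x)‖ ≤ C * ‖δ‖ * ‖y - x‖ := by
  have hd : ∀ u, HasFDerivAt (fun u => f (y + u) - f (x + u))
      (fderiv ℝ f (y + u) - fderiv ℝ f (x + u)) u := fun u =>
    (hasFDerivAt_const_add hf y u).sub (hasFDerivAt_const_add hf x u)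
  have := (convex_univ (𝕜 := ℝ) (E := E)).norm_image_sub_le_of_norm_hasFDerivWithin_le
    (f := fun u => f (y + u) - f (x + u)) (C := C * ‖y - x‖)
    (fun u _ => (hd u).hasFDerivWithinAt) (fun u _ => by
      refine (hL _ _).trans (le_of_eq ?_); congr 2; abel) (mem_univ 0) (mem_univ δ)
  simp only [add_zero, sub_zero] at this
  calc _ = ‖f (y + δ) - f (x + δ) - (f y - f x)‖ := by congr 1; abel
    _ ≤ C * ‖y - x‖ * ‖δ‖ := this
    _ = _ := by ring

variable {f : E → G} {C : ℝ}

lemma BoundedLipDeriv.lip (h : BoundedLipDeriv f C) (x y : E) : ‖f y - f x‖ ≤ C * ‖y - x‖ :=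
  (convex_univ (𝕜 := ℝ) (E := E)).norm_image_sub_le_of_norm_fderiv_le
    (fun u _ => h.diff u) (fun u _ => h.fderiv_le u) (mem_univ x) (mem_univ y)

/-- Increments of the difference quotient `f (x + δ) - f x`, in terms of `x` and `δ`. -/
lemma BoundedLipDeriv.diff_incr (h : BoundedLipDeriv f C) (x y δ δ' : E) :
    ‖(f (y + δ') - f y) - (f (x + δ) - f x)‖ ≤ C * ‖δ' - δ‖ + C * ‖δ‖ * ‖y - x‖ := by
  have h1 := norm_cross_diff_le h.diff h.fderiv_lip x y δ
  have h2 := h.lip (y + δ) (y + δ')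
  rw [add_sub_add_left_eq_sub] at h2
  calc _ = ‖(f (y + δ') - f (y + δ)) + ((f (y + δ) - f y) - (f (x + δ) - f x))‖ := by
        congr 1; abel
    _ ≤ _ := (norm_add_le _ _).trans (add_le_add h2 h1)

/-- The second-order Taylor remainder. -/
def taylorRem (f : E → G) (x δ : E) : G := f (x + δ) - f x - fderiv ℝ f x δ

lemma hasFDerivAt_taylorRem (h : BoundedLipDeriv f C) (x δ : E) :
    HasFDerivAt (taylorRem f x) (fderiv ℝ f (x + δ) - fderiv ℝ f x) δ :=
  ((hasFDerivAt_const_add h.diff x δ).sub_const (f x)).sub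
    (fderiv ℝ f x).hasFDerivAt

@[simp] lemma taylorRem_zero (f : E → G) (x : E) : taylorRem f x 0 = 0 := by simp [taylorRem]

lemma BoundedLipDeriv.taylorRem_incr_right (h : BoundedLipDeriv f C) (x δ δ' : E) {m : ℝ}
    (hδ : ‖δ‖ ≤ m) (hδ' : ‖δ'‖ ≤ m) :
    ‖taylorRem f x δ' - taylorRem f x δ‖ ≤ C * m * ‖δ' - δ‖ := by
  refine (convex_closedBall (0 : E) m).norm_image_sub_le_of_norm_hasFDerivWithin_le
    (fun u _ => (hasFDerivAt_taylorRem h x u).hasFDerivWithinAt) (fun u hu => ?_)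
    (by simpa using hδ) (by simpa using hδ')
  have := h.nonneg
  have hu' : ‖u‖ ≤ m := by simpa using hu
  refine (h.fderiv_lip _ _).trans ?_
  rw [add_sub_cancel_left]
  gcongr

lemma BoundedLipDeriv.taylorRem_le (h : BoundedLipDeriv f C) (x δ : E) :
    ‖taylorRem f x δ‖ ≤ C * ‖δ‖ ^ 2 := by
  have := h.taylorRem_incr_right x 0 δ (m := ‖δ‖) (by simp) le_rfl
  rw [taylorRem_zero, sub_zero, sub_zero] at this
  linarith [this, sq ‖δ‖, mul_assoc C ‖δ‖ ‖δ‖, congrArg (C * ·) (sq ‖δ‖)]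

/-- The Taylor remainder is jointly Lipschitz, with constants of first and second order in the
increment. -/
lemma BoundedLipDeriv.taylorRem_incr (h : BoundedLipDeriv f C) (x y δ δ' : E) {m : ℝ}
    (hδ : ‖δ‖ ≤ m) (hδ' : ‖δ'‖ ≤ m) :
    ‖taylorRem f y δ' - taylorRem f x δ‖ ≤ C * m * ‖δ' - δ‖ + C * m ^ 2 * ‖y - x‖ := by
  have hC := h.nonneg
  have h1 := h.taylorRem_incr_right y δ δ' hδ hδ'
  have h2 : ‖taylorRem f y δ - taylorRem f x δ‖ ≤ C * m ^ 2 * ‖y - x‖ := by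
    have := (convex_closedBall (0 : E) m).norm_image_sub_le_of_norm_hasFDerivWithin_le
      (f := fun u => taylorRem f y u - taylorRem f x u) (C := C * m * ‖y - x‖)
      (fun u _ => ((hasFDerivAt_taylorRem h y u).sub
        (hasFDerivAt_taylorRem h x u)).hasFDerivWithinAt) (fun u hu => ?_)
      (x := 0) (y := δ) (by simpa using (norm_nonneg _).trans hδ) (by simpa using hδ)
    · simp only [taylorRem_zero, sub_zero] at this
      refine this.trans ?_
      calc C * m * ‖y - x‖ * ‖δ‖ ≤ C * m * ‖y - x‖ * m := by
            have := (norm_nonneg _).trans hδ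
            gcongr
        _ = _ := by ring
    · have hu' : ‖u‖ ≤ m := by simpa using hu
      refine (norm_cross_diff_le h.diff_fderiv h.fderiv_fderiv_lip x y u).trans ?_
      gcongr
  calc _ = ‖(taylorRem f y δ' - taylorRem f y δ) + (taylorRem f y δ - taylorRem f x δ)‖ := by
        congr 1; abel
    _ ≤ _ := (norm_add_le _ _).trans (add_le_add h1 h2)

/-- `f` is smooth and bounded together with all its derivatives. -/
def SmoothBdd (f : E → G) : Prop :=
  ContDiff ℝ ((⊤ : ℕ∞) : WithTop ℕ∞) f ∧ ∀ k : ℕ, ∃ C : ℝ, ∀ x, ‖iteratedFDeriv ℝ k f x‖ ≤ C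

lemma SmoothBdd.fderiv (h : SmoothBdd f) : SmoothBdd (fderiv ℝ f) := by
  refine ⟨h.1.fderiv_right (by simp), fun k => ?_⟩
  obtain ⟨C, hC⟩ := h.2 (k + 1)
  exact ⟨C, fun x => by rw [norm_iteratedFDeriv_fderiv]; exact hC x⟩

lemma SmoothBdd.bounded (h : SmoothBdd f) : ∃ C, ∀ x, ‖f x‖ ≤ C := by
  obtain ⟨C, hC⟩ := h.2 0
  exact ⟨C, fun x => by simpa using hC x⟩

lemma SmoothBdd.differentiable (h : SmoothBdd f) : Differentiable ℝ f :=
  h.1.differentiable (by simp)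

lemma SmoothBdd.boundedLipDeriv (h : SmoothBdd f) : ∃ C, BoundedLipDeriv f C := by
  obtain ⟨C0, h0⟩ := h.bounded
  obtain ⟨C1, h1⟩ := h.fderiv.bounded
  obtain ⟨C2, h2⟩ := h.fderiv.fderiv.bounded
  obtain ⟨C3, h3⟩ := h.fderiv.fderiv.fderiv.bounded
  have c0 : 0 ≤ C0 := (norm_nonneg _).trans (h0 0)
  have c1 : 0 ≤ C1 := (norm_nonneg _).trans (h1 0)
  have c2 : 0 ≤ C2 := (norm_nonneg _).trans (h2 0)
  have c3 : 0 ≤ C3 := (norm_nonneg _).trans (h3 0)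
  refine ⟨C0 + C1 + C2 + C3, by positivity, h.differentiable, h.fderiv.differentiable,
    fun x => (h0 x).trans (by linarith), fun x => (h1 x).trans (by linarith), fun x y => ?_,
    fun x y => ?_⟩
  · exact (convex_univ (𝕜 := ℝ) (E := E)).norm_image_sub_le_of_norm_fderiv_le
      (fun u _ => h.fderiv.differentiable u) (fun u _ => (h2 u).trans (by linarith)) (mem_univ x)
      (mem_univ y)
  · exact (convex_univ (𝕜 := ℝ) (E := E)).norm_image_sub_le_of_norm_fderiv_le
      (fun u _ => h.fderiv.fderiv.differentiable u) (fun u _ => (h3 u).trans (by linarith))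
      (mem_univ x) (mem_univ y)

lemma SmoothBdd.clm_comp {G' : Type*} [NormedAddCommGroup G'] [NormedSpace ℝ G'] (h : SmoothBdd f)
    (Λ : G →L[ℝ] G') : SmoothBdd fun x => Λ (f x) := by
  refine ⟨Λ.contDiff.comp h.1, fun k => ?_⟩
  obtain ⟨C, hC⟩ := h.2 k
  refine ⟨‖Λ‖ * C, fun x => ?_⟩
  refine (Λ.norm_iteratedFDeriv_comp_left h.1.contDiffAt
    (by exact_mod_cast le_top)).trans ?_
  gcongr
  exact hC x

lemma SmoothBdd.add {g : E → G} (hf : SmoothBdd f) (hg : SmoothBdd g) :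
    SmoothBdd fun x => f x + g x := by
  refine ⟨hf.1.add hg.1, fun k => ?_⟩
  obtain ⟨C, hC⟩ := hf.2 k
  obtain ⟨D, hD⟩ := hg.2 k
  refine ⟨C + D, fun x => ?_⟩
  have e : iteratedFDeriv ℝ k (fun x => f x + g x) x =
      iteratedFDeriv ℝ k f x + iteratedFDeriv ℝ k g x :=
    iteratedFDeriv_add_apply (hf.1.contDiffAt.of_le (by exact_mod_cast le_top))
      (hg.1.contDiffAt.of_le (by exact_mod_cast le_top))
  rw [e]
  exact (norm_add_le _ _).trans (add_le_add (hC x) (hD x))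

lemma SmoothBdd.sum {ι : Type*} (s : Finset ι) {F : ι → E → G} (h : ∀ i, SmoothBdd (F i)) :
    SmoothBdd fun x => ∑ i ∈ s, F i x := by
  classical
  induction s using Finset.induction_on with
  | empty =>
    simp only [Finset.sum_empty]
    refine ⟨contDiff_const, fun k => ⟨0, fun x => ?_⟩⟩
    have : iteratedFDeriv ℝ k (fun _ : E => (0 : G)) = 0 := iteratedFDeriv_fun_zero
    rw [this]; simp
  | insert a s ha ih =>
    simp only [Finset.sum_insert ha]
    exact (h a).add ih

end Fields

/-! ### The skeleton equation: existence and uniqueness -/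

section Skeleton

open Filter Topology

variable {d n : ℕ}

/-- The vector fields `V₀, V₁, …, V_d` gathered into one field with values in the linear maps on
`ℝ × ℝ^d`, the first factor being the direction of time. -/
def driftField (V₀ : EuclideanSpace ℝ (Fin n) → EuclideanSpace ℝ (Fin n))
    (V : Fin d → EuclideanSpace ℝ (Fin n) → EuclideanSpace ℝ (Fin n))
    (x : EuclideanSpace ℝ (Fin n)) :
    (ℝ × EuclideanSpace ℝ (Fin d)) →L[ℝ] EuclideanSpace ℝ (Fin n) :=
  ContinuousLinearMap.smulRightL ℝ (ℝ × EuclideanSpace ℝ (Fin d)) (EuclideanSpace ℝ (Fin n))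
      (ContinuousLinearMap.fst ℝ ℝ _) (V₀ x) +
    ∑ i, ContinuousLinearMap.smulRightL ℝ (ℝ × EuclideanSpace ℝ (Fin d)) (EuclideanSpace ℝ (Fin n))
      ((EuclideanSpace.proj i).comp (ContinuousLinearMap.snd ℝ ℝ _)) (V i x)

variable {V₀ : EuclideanSpace ℝ (Fin n) → EuclideanSpace ℝ (Fin n)}
  {V : Fin d → EuclideanSpace ℝ (Fin n) → EuclideanSpace ℝ (Fin n)}
  {z : EuclideanSpace ℝ (Fin n)}

lemma driftField_apply (x : EuclideanSpace ℝ (Fin n)) (v : ℝ × EuclideanSpace ℝ (Fin d)) :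
    driftField V₀ V x v = v.1 • V₀ x + ∑ i, v.2 i • V i x := by
  simp [driftField]

lemma driftField_smoothBdd (hV₀ : SmoothBounded V₀) (hV : ∀ j, SmoothBounded (V j)) :
    SmoothBdd (driftField V₀ V) :=
  (SmoothBdd.clm_comp (f := V₀) hV₀ _).add
    (SmoothBdd.sum _ fun i => SmoothBdd.clm_comp (f := V i) (hV i) _)

/-- The driver `t ↦ (t, h t)`. -/
def timed (h : unitInterval → EuclideanSpace ℝ (Fin d)) (t : unitInterval) :
    ℝ × EuclideanSpace ℝ (Fin d) := (t, h t)

lemma holderWrt_time {α : ℝ} (hα0 : 0 < α) (hα : α ≤ 1) :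
    HolderWrt α (fun t : unitInterval => (t : ℝ)) 1 (fun t : unitInterval => (t : ℝ)) := by
  intro s t hst
  have h0 : (0 : ℝ) ≤ (t : ℝ) - s := sub_nonneg.2 hst
  have h1 : (t : ℝ) - s ≤ 1 := by have := t.2.2; have := s.2.1; linarith
  rw [Real.norm_of_nonneg h0, one_mul]
  rcases h0.eq_or_lt with h | h
  · rw [← h, Real.zero_rpow hα0.ne']
  · exact Real.self_le_rpow_of_le_one h.le h1 hα

lemma HolderWrt.prodMk {E F : Type*} [NormedAddCommGroup E] [NormedAddCommGroup F] {α A : ℝ}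
    {W : unitInterval → ℝ} {f : unitInterval → E} {g : unitInterval → F} (hf : HolderWrt α W A f)
    (hg : HolderWrt α W A g) : HolderWrt α W A (fun t => (f t, g t)) := fun s t hst => by
  rw [Prod.mk_sub_mk, Prod.norm_mk]
  exact max_le (hf s t hst) (hg s t hst)

lemma HolderWrt.eq_of_zero {E : Type*} [NormedAddCommGroup E] {α : ℝ} {W : unitInterval → ℝ}
    {f : unitInterval → E} (h : HolderWrt α W 0 f) (t : unitInterval) : f t = f 0 := by
  have := h 0 t unitInterval.nonneg'
  rw [zero_mul] at this
  exact sub_eq_zero.1 (norm_le_zero_iff.1 this)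

/-- A path all of whose increments are of order `2α > 1` is constant. -/
lemma eq_of_norm_sub_le {E : Type*} [NormedAddCommGroup E] [NormedSpace ℝ E] {α K : ℝ}
    (hα : 1 / 2 < α) {W : unitInterval → ℝ} (hW : Monotone W) (hWc : Continuous W)
    {δ : unitInterval → E} (h : ∀ s t, s ≤ t → ‖δ t - δ s‖ ≤ K * (W t - W s) ^ (2 * α))
    (t : unitInterval) : δ t = δ 0 := by
  obtain ⟨C, -, H⟩ := IsGerm.exists_const E ℝ (L := 0) (T := W 1 - W 0) hα le_rfl
  have h1 := (H 0 W (fun _ => 0) (fun t => δ t - δ 0) (fun _ => 0) le_rfl hW hWc le_rfl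
    (fun s t hst => by
      have := Real.rpow_nonneg (sub_nonneg.2 (hW hst)) α
      simpa using this) (by simp) (by simp) ⟨K, fun s t hst => by simpa using h s t hst⟩).2
  simp only [sub_self, norm_zero, add_zero, mul_zero] at h1
  simpa [sub_eq_zero] using h1.eq_of_zero t

lemma HolderWrt.comp_lip {E G : Type*} [NormedAddCommGroup E] [NormedAddCommGroup G] {α A C : ℝ}
    (hC : 0 ≤ C) {W : unitInterval → ℝ} {y : unitInterval → E} (hy : HolderWrt α W A y) {f : E → G}
    (hf : ∀ x x', ‖f x' - f x‖ ≤ C * ‖x' - x‖) : HolderWrt α W (C * A) fun t => f (y t) :=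
  fun s t hst => (hf _ _).trans (by
    rw [mul_assoc]; exact mul_le_mul_of_nonneg_left (hy s t hst) hC)

lemma SmoothBounded.lip {V : EuclideanSpace ℝ (Fin n) → EuclideanSpace ℝ (Fin n)}
    (hV : SmoothBounded V) : ∃ C, 0 ≤ C ∧ ∀ x x', ‖V x' - V x‖ ≤ C * ‖x' - x‖ := by
  obtain ⟨C, hC⟩ := SmoothBdd.boundedLipDeriv (f := V) hV
  exact ⟨C, hC.nonneg, hC.lip⟩

lemma HolderWrt.snd_apply {α B : ℝ} {W : unitInterval → ℝ}
    {h : unitInterval → EuclideanSpace ℝ (Fin d)} (hh : HolderWrt α W B (timed h)) (i : Fin d) :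
    HolderWrt α W B fun t => h t i := fun s t hst => by
  refine le_trans ?_ (hh s t hst)
  refine le_trans ?_ (norm_snd_le _)
  exact PiLp.norm_apply_le (h t - h s) i

lemma HolderWrt.time {α B : ℝ} {W : unitInterval → ℝ}
    {h : unitInterval → EuclideanSpace ℝ (Fin d)} (hh : HolderWrt α W B (timed h)) :
    HolderWrt α W B fun t : unitInterval => (t : ℝ) := fun s t hst =>
  le_trans (norm_fst_le (timed h t - timed h s)) (hh s t hst)

/-- The indefinite Young integrals along a Hölder path `y`; their sum has the germ of the skeleton
equation. -/
lemma exists_integrals (hV₀ : SmoothBounded V₀) (hV : ∀ j, SmoothBounded (V j)) {α A B : ℝ}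
    (hα : 1 / 2 < α) (hA : 0 ≤ A) (hB : 0 ≤ B) {W : unitInterval → ℝ} (hW : Monotone W)
    (hWc : Continuous W) {h : unitInterval → EuclideanSpace ℝ (Fin d)}
    (hh : HolderWrt α W B (timed h)) {y : unitInterval → EuclideanSpace ℝ (Fin n)}
    (hy : HolderWrt α W A y) :
    ∃ (y₀ : unitInterval → EuclideanSpace ℝ (Fin n))
      (yi : Fin d → unitInterval → EuclideanSpace ℝ (Fin n)),
      y₀ 0 = 0 ∧ (∀ i, yi i 0 = 0) ∧
      (∀ t, HasYoungIntegral (fun s => V₀ (y s)) (fun s => (s : ℝ)) 0 t (y₀ t)) ∧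
      (∀ i t, HasYoungIntegral (fun s => V i (y s)) (fun s => h s i) 0 t (yi i t)) ∧
      IsGerm α W (timed h) (fun t => y₀ t + ∑ i, yi i t) (fun s => driftField V₀ V (y s)) := by
  obtain ⟨C, hC, hL⟩ := hV₀.lip
  choose D hD hLi using fun i => (hV i).lip
  obtain ⟨y₀, h00, K, hK0, hK⟩ := exists_indefinite_integral hα (mul_nonneg hC hA) hB hW hWc
    (hy.comp_lip hC hL) hh.time
  choose yi hi0 Ki hKi0 hKi using fun i => exists_indefinite_integral hα (mul_nonneg (hD i) hA) hB
    hW hWc (hy.comp_lip (hD i) (hLi i)) (hh.snd_apply i)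
  refine ⟨y₀, yi, h00, hi0, fun t => ?_, fun i t => ?_, K + ∑ i, Ki i, fun s t hst => ?_⟩
  · have := hasYoungIntegral_of_germ hα hK0 (mul_nonneg hC hA) hB hW hWc (hy.comp_lip hC hL)
      hh.time hK t
    rwa [h00, sub_zero] at this
  · have := hasYoungIntegral_of_germ hα (hKi0 i) (mul_nonneg (hD i) hA) hB hW hWc
      (hy.comp_lip (hD i) (hLi i)) (hh.snd_apply i) (hKi i) t
    rwa [hi0, sub_zero] at this
  · have e : y₀ t + ∑ i, yi i t - (y₀ s + ∑ i, yi i s) -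
        driftField V₀ V (y s) (timed h t - timed h s) =
        (y₀ t - y₀ s - ((t : ℝ) - s) • V₀ (y s)) +
          ∑ i, (yi i t - yi i s - (h t i - h s i) • V i (y s)) := by
      rw [driftField_apply, Finset.sum_sub_distrib, Finset.sum_sub_distrib]
      simp only [timed, Prod.mk_sub_mk, PiLp.sub_apply]
      abel
    rw [e, add_mul, Finset.sum_mul]
    exact (norm_add_le _ _).trans (add_le_add (hK s t hst) ((norm_sum_le _ _).trans
      (Finset.sum_le_sum fun i _ => hKi i s t hst)))

/-- A solution in the sense of germs solves the integral equation in Young's sense. -/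
lemma isSkeleton_of_germ (hV₀ : SmoothBounded V₀) (hV : ∀ j, SmoothBounded (V j)) {α A B : ℝ}
    (hα : 1 / 2 < α) (hα1 : α ≤ 1) (hA : 0 ≤ A) (hB : 0 ≤ B) {W : unitInterval → ℝ}
    (hW : Monotone W) (hWc : Continuous W) {h : unitInterval → EuclideanSpace ℝ (Fin d)}
    (hh : HolderWrt α W B (timed h)) {y : unitInterval → EuclideanSpace ℝ (Fin n)}
    (hy : HolderWrt α W A y) (hy0 : y 0 = z)
    (hg : IsGerm α W (timed h) y fun s => driftField V₀ V (y s)) : IsSkeleton V₀ V z h y := by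
  have hα0 : 0 < α := by linarith
  obtain ⟨y₀, yi, h00, hi0, hI0, hIi, hG⟩ := exists_integrals hV₀ hV hα hA hB hW hWc hh hy
  obtain ⟨K, hK⟩ := hg
  obtain ⟨K', hK'⟩ := hG
  have heq := eq_of_norm_sub_le (δ := fun t => y t - (y₀ t + ∑ i, yi i t)) (K := K + K') hα hW hWc
    (fun s t hst => by
      have e : y t - (y₀ t + ∑ i, yi i t) - (y s - (y₀ s + ∑ i, yi i s)) =
          (y t - y s - driftField V₀ V (y s) (timed h t - timed h s)) -
          (y₀ t + ∑ i, yi i t - (y₀ s + ∑ i, yi i s) -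
            driftField V₀ V (y s) (timed h t - timed h s)) := by abel
      rw [e, add_mul]
      exact (norm_sub_le _ _).trans (add_le_add (hK s t hst) (hK' s t hst)))
  refine ⟨hy.continuous hα0 hW hWc, ⟨1 / α, ?_, ?_, A ^ (1 / α) * (W 1 - W 0), fun N τ hτ => ?_⟩,
    fun t => ⟨y₀ t, fun i => yi i t, hI0 t, fun i => hIi i t, ?_⟩⟩
  · rwa [le_div_iff₀ hα0, one_mul]
  · rw [div_lt_iff₀ hα0]; linarith
  · have := HolderWrt.varSum_le (f := y) (r := 1 / α) (N := N) hW (by positivity) hA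
      (by simpa using hy) hτ.1
    rwa [hτ.2.1, hτ.2.2] at this
  · have := heq t
    simp only [h00, hi0, hy0, Finset.sum_const_zero, add_zero, sub_zero] at this
    rw [sub_eq_iff_eq_add] at this
    rw [this, add_assoc]

/-- A solution of the integral equation in Young's sense is one in the sense of germs. -/
lemma germ_of_isSkeleton (hV₀ : SmoothBounded V₀) (hV : ∀ j, SmoothBounded (V j)) {α A B : ℝ}
    (hα : 1 / 2 < α) (hA : 0 ≤ A) (hB : 0 ≤ B) {W : unitInterval → ℝ}
    (hW : Monotone W) (hWc : Continuous W) {h : unitInterval → EuclideanSpace ℝ (Fin d)}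
    (hh : HolderWrt α W B (timed h)) {y : unitInterval → EuclideanSpace ℝ (Fin n)}
    (hy : HolderWrt α W A y) (hs : IsSkeleton V₀ V z h y) :
    y 0 = z ∧ IsGerm α W (timed h) y fun s => driftField V₀ V (y s) := by
  obtain ⟨y₀, yi, h00, hi0, hI0, hIi, K, hK⟩ := exists_integrals hV₀ hV hα hA hB hW hWc hh hy
  have heq : ∀ t, y t = z + (y₀ t + ∑ i, yi i t) := by
    intro t
    obtain ⟨J₀, J, hJ₀, hJ, e⟩ := hs.equation t
    rw [e, hJ₀.unique unitInterval.nonneg' (hI0 t), add_assoc]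
    congr 2
    exact Finset.sum_congr rfl fun i _ => (hJ i).unique unitInterval.nonneg' (hIi i t)
  refine ⟨by rw [heq 0]; simp [h00, hi0], K, fun s t hst => ?_⟩
  have e : y t - y s = y₀ t + ∑ i, yi i t - (y₀ s + ∑ i, yi i s) := by
    rw [heq t, heq s, add_sub_add_left_eq_sub]
  rw [e]
  exact hK s t hst

/-- Two solutions of the germ equation that are Hölder relative to the same clock agree. -/
lemma germ_unique {E F : Type*} [NormedAddCommGroup E] [NormedSpace ℝ E] [NormedAddCommGroup F]
    [NormedSpace ℝ F] {f : E → F →L[ℝ] E} {C : ℝ} (hf : BoundedLipDeriv f C) {α A : ℝ}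
    (hα : 1 / 2 < α) (hA : 0 ≤ A) {W : unitInterval → ℝ} (hW : Monotone W) (hWc : Continuous W)
    {X : unitInterval → F} (hX : HolderWrt α W 1 X) {y y' : unitInterval → E}
    (hy : HolderWrt α W A y) (h0 : y 0 = y' 0)
    (hg : IsGerm α W X y fun s => f (y s)) (hg' : IsGerm α W X y' fun s => f (y' s)) : y = y' := by
  have hC := hf.nonneg
  obtain ⟨D, -, H⟩ := IsGerm.exists_const E F (L := C * (1 + A)) (T := W 1 - W 0) hα (by positivity)
  obtain ⟨K, hK⟩ := hg
  obtain ⟨K', hK'⟩ := hg'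
  have hlip : ∀ a b : E, ‖f b - f a‖ ≤ C * (1 + A) * ‖b - a‖ := fun a b => by
    refine (hf.lip a b).trans ?_
    gcongr
    nlinarith
  have h1 := (H 0 W X (fun t => y' t - y t) (fun s => f (y' s) - f (y s)) le_rfl hW hWc le_rfl hX
    (fun s => by rw [add_zero]; exact hlip _ _) (fun s t hst => by
      have h2 := hf.diff_incr (y s) (y t) (y' s - y s) (y' t - y t)
      rw [add_sub_cancel, add_sub_cancel] at h2
      have h3 := hy s t hst
      have h4 := Real.rpow_nonneg (sub_nonneg.2 (hW hst)) α
      calc _ ≤ C * ‖y' t - y t - (y' s - y s)‖ + C * ‖y' s - y s‖ * ‖y t - y s‖ := h2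
        _ ≤ C * (1 + A) * ‖y' t - y t - (y' s - y s)‖ +
            C * ‖y' s - y s‖ * (A * (W t - W s) ^ α) := by
              gcongr
              nlinarith
        _ ≤ _ := by
          have : 0 ≤ C * ‖y' s - y s‖ * (W t - W s) ^ α := by positivity
          nlinarith)
    ⟨K' + K, fun s t hst => by
      have e : y' t - y t - (y' s - y s) - (f (y' s) - f (y s)) (X t - X s) =
          (y' t - y' s - f (y' s) (X t - X s)) - (y t - y s - f (y s) (X t - X s)) := by
        rw [sub_apply]; abel
      rw [e, add_mul]
      exact (norm_sub_le _ _).trans (add_le_add (hK' s t hst) (hK s t hst))⟩).1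
  funext t
  have := h1 t
  simp only [h0, sub_self, norm_zero, add_zero, mul_zero, norm_le_zero_iff, sub_eq_zero] at this
  exact this.symm

/-- `h` is a continuous path of finite `p`-variation. -/
def FiniteVarPath (p : ℝ) (h : unitInterval → EuclideanSpace ℝ (Fin d)) : Prop :=
  Continuous h ∧ ∃ C, ∀ N τ, IsDissection 0 1 N τ → varSum h p N τ ≤ C

lemma exists_clock_holder {E : Type*} [NormedAddCommGroup E] {f : unitInterval → E} {p r : ℝ}
    (hf : Continuous f) (hp : 1 ≤ p) (hpr : p < r)
    (hC : ∃ C, ∀ N τ, IsDissection 0 1 N τ → varSum f p N τ ≤ C) :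
    ∃ W : unitInterval → ℝ, Monotone W ∧ Continuous W ∧ HolderWrt (1 / r) W 1 f := by
  obtain ⟨C, hC⟩ := hC
  obtain ⟨W, hW, hWc, -, h⟩ := exists_clock hf hp hpr hC
  exact ⟨W, hW, hWc, holderWrt_of_rpow_le (by linarith) h⟩

/-- A clock for the driver of the skeleton equation. -/
lemma exists_clock_timed {p r : ℝ} {h : unitInterval → EuclideanSpace ℝ (Fin d)} (hp : 1 ≤ p)
    (hpr : p < r) (hh : FiniteVarPath p h) :
    ∃ W : unitInterval → ℝ, Monotone W ∧ Continuous W ∧ HolderWrt (1 / r) W 1 (timed h) := by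
  obtain ⟨W, hW, hWc, hH⟩ := exists_clock_holder hh.1 hp hpr hh.2
  have hr : 0 < r := by linarith
  have hid : Monotone fun t : unitInterval => (t : ℝ) := fun s t hst => hst
  refine ⟨fun t => W t + t, hW.add hid, by fun_prop, HolderWrt.prodMk ?_ ?_⟩
  · refine (holderWrt_time (by positivity) ?_).mono_clock (by positivity) zero_le_one hid
      fun s t hst => ?_
    · rw [div_le_one hr]; linarith
    · have := hW hst; linarith
  · refine hH.mono_clock (by positivity) zero_le_one hW fun s t hst => ?_
    have : (s : ℝ) ≤ t := hst
    linarith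

/-- The skeleton equation has a solution along paths of finite `p`-variation, `p < 2`. -/
theorem isSkeleton_exists (hV₀ : SmoothBounded V₀) (hV : ∀ j, SmoothBounded (V j)) {p : ℝ}
    (hp1 : 1 ≤ p) (hp2 : p < 2) {h : unitInterval → EuclideanSpace ℝ (Fin d)}
    (hh : FiniteVarPath p h) : ∃ φ, IsSkeleton V₀ V z h φ := by
  obtain ⟨r, hpr, hr2⟩ := exists_between hp2
  have hr : 0 < r := by linarith
  obtain ⟨W, hW, hWc, hH⟩ := exists_clock_timed hp1 hpr hh
  obtain ⟨C, hf⟩ := (driftField_smoothBdd hV₀ hV).boundedLipDeriv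
  have hα : 1 / 2 < 1 / r := by gcongr
  have hC := hf.nonneg
  obtain ⟨D, hD, H⟩ := exists_germ_solution (EuclideanSpace ℝ (Fin n))
    (ℝ × EuclideanSpace ℝ (Fin d)) (L := C) (T := W 1 - W 0) hα hC
  obtain ⟨y, hy0, -, hy, hg⟩ := H C W (timed h) (fun _ => driftField V₀ V) z hC hW hWc le_rfl hH
    (fun s y => (hf.norm_le y).trans (le_add_of_nonneg_left (by positivity)))
    (fun s t y y' => (hf.lip y y').trans (le_add_of_nonneg_right (by
      have := Real.rpow_nonneg (abs_nonneg (W t - W s)) (1 / r)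
      positivity)))
  exact ⟨y, isSkeleton_of_germ hV₀ hV hα (by rw [div_le_one hr]; linarith) (by positivity)
    zero_le_one hW hWc hH hy hy0 hg⟩

/-- The skeleton equation has at most one solution. The two solutions may have finite variation of
different orders; a common exponent below `2` is taken for them and the driver. -/
theorem IsSkeleton.unique (hV₀ : SmoothBounded V₀) (hV : ∀ j, SmoothBounded (V j)) {p : ℝ}
    (hp1 : 1 ≤ p) (hp2 : p < 2) {h : unitInterval → EuclideanSpace ℝ (Fin d)}
    (hh : FiniteVarPath p h) {φ ψ : unitInterval → EuclideanSpace ℝ (Fin n)}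
    (hφ : IsSkeleton V₀ V z h φ) (hψ : IsSkeleton V₀ V z h ψ) : φ = ψ := by
  obtain ⟨p₁, hp11, hp12, hφv⟩ := hφ.finiteVariation
  obtain ⟨p₂, hp21, hp22, hψv⟩ := hψ.finiteVariation
  obtain ⟨r, hpr, hr2⟩ := exists_between (max_lt hp2 (max_lt hp12 hp22))
  rw [max_lt_iff, max_lt_iff] at hpr
  have hr : 0 < r := by linarith
  have hα : 1 / 2 < 1 / r := by gcongr
  obtain ⟨W₀, hW₀, hWc₀, hH₀⟩ := exists_clock_timed hp1 hpr.1 hh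
  obtain ⟨W₁, hW₁, hWc₁, hH₁⟩ := exists_clock_holder hφ.continuous hp11 hpr.2.1 hφv
  obtain ⟨W₂, hW₂, hWc₂, hH₂⟩ := exists_clock_holder hψ.continuous hp21 hpr.2.2 hψv
  have hW : Monotone fun t => W₀ t + W₁ t + W₂ t := (hW₀.add hW₁).add hW₂
  have hWc : Continuous fun t => W₀ t + W₁ t + W₂ t := by fun_prop
  have hα0 : 0 ≤ 1 / r := by positivity
  have k0 := hH₀.mono_clock (W' := fun t => W₀ t + W₁ t + W₂ t) hα0 zero_le_one hW₀
    fun s t hst => by have := hW₁ hst; have := hW₂ hst; linarith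
  have k1 := hH₁.mono_clock (W' := fun t => W₀ t + W₁ t + W₂ t) hα0 zero_le_one hW₁
    fun s t hst => by have := hW₀ hst; have := hW₂ hst; linarith
  have k2 := hH₂.mono_clock (W' := fun t => W₀ t + W₁ t + W₂ t) hα0 zero_le_one hW₂
    fun s t hst => by have := hW₁ hst; have := hW₀ hst; linarith
  obtain ⟨C, hf⟩ := (driftField_smoothBdd hV₀ hV).boundedLipDeriv
  obtain ⟨a0, ag⟩ := germ_of_isSkeleton hV₀ hV hα zero_le_one zero_le_one hW hWc k0 k1 hφ
  obtain ⟨b0, bg⟩ := germ_of_isSkeleton hV₀ hV hα zero_le_one zero_le_one hW hWc k0 k2 hψ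
  exact germ_unique hf hα zero_le_one hW hWc k0 k1 (a0.trans b0.symm) ag bg

lemma skeleton_eq (hV₀ : SmoothBounded V₀) (hV : ∀ j, SmoothBounded (V j)) {p : ℝ}
    (hp1 : 1 ≤ p) (hp2 : p < 2) {h : unitInterval → EuclideanSpace ℝ (Fin d)}
    (hh : FiniteVarPath p h) {φ : unitInterval → EuclideanSpace ℝ (Fin n)}
    (hφ : IsSkeleton V₀ V z h φ) : skeleton V₀ V z h = φ := by
  have hex : ∃ φ, IsSkeleton V₀ V z h φ := ⟨φ, hφ⟩
  rw [skeleton, dif_pos hex]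
  exact hex.choose_spec.unique hV₀ hV hp1 hp2 hh hφ

end Skeleton

/-! ### Differentiability of the skeleton -/

section Derivative

open Filter Topology

variable {E F F' : Type*} [NormedAddCommGroup E] [NormedSpace ℝ E]
  [NormedAddCommGroup F] [NormedSpace ℝ F] [NormedAddCommGroup F'] [NormedSpace ℝ F']

lemma norm_comp_le_of_norm_le_one (g : F →L[ℝ] E) {π : F' →L[ℝ] F} (hπ : ‖π‖ ≤ 1) :
    ‖g.comp π‖ ≤ ‖g‖ :=
  (g.opNorm_comp_le π).trans (mul_le_of_le_one_right (norm_nonneg _) hπ)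

/-- The coefficient of the linearised equation `dψ = Df(y)ψ π dX + f(y) e dX`. -/
def linCoeff (f : E → F →L[ℝ] E) (π e : F' →L[ℝ] F) (y ψ : E) : F' →L[ℝ] E :=
  (fderiv ℝ f y ψ).comp π + (f y).comp e

variable {f : E → F →L[ℝ] E} {C : ℝ}

lemma BoundedLipDeriv.fderiv_apply_incr (hf : BoundedLipDeriv f C) (y y' v v' : E) :
    ‖fderiv ℝ f y' v' - fderiv ℝ f y v‖ ≤ C * ‖v' - v‖ + C * ‖y' - y‖ * ‖v‖ := by
  have e : fderiv ℝ f y' v' - fderiv ℝ f y v =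
      fderiv ℝ f y' (v' - v) + (fderiv ℝ f y' - fderiv ℝ f y) v := by
    simp only [map_sub, sub_apply]; abel
  rw [e]
  refine (norm_add_le _ _).trans (add_le_add ?_ ?_)
  · exact (ContinuousLinearMap.le_opNorm _ _).trans
      (mul_le_mul_of_nonneg_right (hf.fderiv_le _) (norm_nonneg _))
  · exact (ContinuousLinearMap.le_opNorm _ _).trans
      (mul_le_mul_of_nonneg_right (hf.fderiv_lip _ _) (norm_nonneg _))

/-- The remainder of the first-order expansion satisfies a linear equation driven by second-order
terms: this is the identity of one-step defects behind it. -/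
lemma expansion_defect (f : E → F →L[ℝ] E) (π e : F' →L[ℝ] F) (ε : ℝ) (a b a' b' u v : E)
    (x : F') :
    a' - a - ε • u - (b' - b - ε • v) -
        ((fderiv ℝ f b (b' - b - ε • v) + taylorRem f b (b' - b)).comp π +
          ε • (f b' - f b).comp e) x =
      ((a' - b' - ((f b').comp (π + ε • e)) x) - (a - b - ((f b).comp π) x)) -
        ε • (u - v - linCoeff f π e b v x) := by
  have h1 : taylorRem f b (b' - b) = f b' - f b - fderiv ℝ f b (b' - b) := by
    rw [taylorRem, add_sub_cancel]
  have h2 : fderiv ℝ f b (b' - b - ε • v) = fderiv ℝ f b (b' - b) - ε • fderiv ℝ f b v := by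
    rw [map_sub, map_smul]
  rw [h1, h2, linCoeff]
  generalize fderiv ℝ f b (b' - b) = p
  generalize fderiv ℝ f b v = q
  simp only [ContinuousLinearMap.comp_apply, add_apply, sub_apply, smul_apply, map_add, map_smul,
    smul_sub, smul_add]
  abel

set_option maxHeartbeats 1000000 in
/-- Second order expansion of the solution under a perturbation of the driver of size `ε`, with a
constant that depends only on the total length of the clock. -/
theorem exists_expansion [FiniteDimensional ℝ E] (hf : BoundedLipDeriv f C) {π e : F' →L[ℝ] F}
    (hπ : ‖π‖ ≤ 1) (he : ‖e‖ ≤ 1) {α A T : ℝ} (hα : 1 / 2 < α) (hA : 0 ≤ A) (z : E) :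
    ∃ M : ℝ, 0 ≤ M ∧ ∀ (W : unitInterval → ℝ) (X : unitInterval → F') (y : unitInterval → E)
      (ε : ℝ), Monotone W → Continuous W → W 1 - W 0 ≤ T → HolderWrt α W 1 X → y 0 = z →
      HolderWrt α W A y → IsGerm α W X y (fun s => (f (y s)).comp π) → 0 ≤ ε → ε ≤ 1 →
      ∃ y' ψ : unitInterval → E, y' 0 = z ∧ (∃ A', 0 ≤ A' ∧ HolderWrt α W A' y') ∧
        IsGerm α W X y' (fun s => (f (y' s)).comp (π + ε • e)) ∧ ψ 0 = 0 ∧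
        (∃ A', 0 ≤ A' ∧ HolderWrt α W A' ψ) ∧
        IsGerm α W X ψ (fun s => linCoeff f π e (y s) (ψ s)) ∧
        ‖y' 1 - y 1 - ε • ψ 1‖ ≤ M * ε ^ 2 := by
  have hC := hf.nonneg
  obtain ⟨C₁, hC₁, H₁⟩ := exists_germ_solution E F' (L := 2 * C) (T := T) hα (by positivity)
  obtain ⟨C₂, hC₂, H₂⟩ := exists_germ_solution E F' (L := C * (1 + A)) (T := T) hα (by positivity)
  obtain ⟨D, hD, H₃⟩ := IsGerm.exists_const E F' (L := C * (1 + A)) (T := T) hα (by positivity)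
  set A₁ := C₁ * (‖z‖ + 2 * C) with hA₁
  have hA₁0 : 0 ≤ A₁ := by positivity
  set D₁ := D * (C * (1 + A₁)) with hD₁
  have hD₁0 : 0 ≤ D₁ := by positivity
  refine ⟨D * (C * (D₁ ^ 2 + D₁) * (1 + A)), by positivity, ?_⟩
  intro W X y ε hW hWc hT hX hy0 hy hg hε0 hε1
  have hπe : ‖π + ε • e‖ ≤ 2 := by
    refine (norm_add_le _ _).trans ?_
    rw [norm_smul, Real.norm_of_nonneg hε0]
    nlinarith [norm_nonneg e]
  have hcomp2 : ∀ g : F →L[ℝ] E, ‖g.comp (π + ε • e)‖ ≤ 2 * ‖g‖ := fun g =>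
    (g.opNorm_comp_le _).trans (by rw [mul_comm]; gcongr)
  have hα' : ∀ s t, 0 ≤ |W t - W s| ^ α := fun s t => Real.rpow_nonneg (abs_nonneg _) _
  have hαp : ∀ s t, s ≤ t → 0 ≤ (W t - W s) ^ α := fun s t hst =>
    Real.rpow_nonneg (sub_nonneg.2 (hW hst)) _
  -- the perturbed solution
  obtain ⟨y', hy'0, -, hy', hg'⟩ := H₁ (2 * C) W X (fun _ y => (f y).comp (π + ε • e)) z
    (by positivity) hW hWc hT hX
    (fun s y => (hcomp2 _).trans (by
      have := hf.norm_le y; have := mul_nonneg hC (norm_nonneg y); linarith))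
    (fun s t y y' => by
      rw [← ContinuousLinearMap.sub_comp]
      refine (hcomp2 _).trans ?_
      have h1 := hf.lip y y'
      have h2 : 0 ≤ (2 * C * ‖y‖ + 2 * C) * |W t - W s| ^ α := by
        have := hα' s t; positivity
      linarith)
  -- the linearised solution
  obtain ⟨ψ, hψ0, -, hψ, hgψ⟩ := H₂ (C * (1 + A)) W X (fun s v => linCoeff f π e (y s) v) 0
    (by positivity) hW hWc hT hX
    (fun s v => by
      have h1 : ‖fderiv ℝ f (y s) v‖ ≤ C * ‖v‖ := (ContinuousLinearMap.le_opNorm _ _).trans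
        (mul_le_mul_of_nonneg_right (hf.fderiv_le _) (norm_nonneg _))
      have h2 := hf.norm_le (y s)
      have h3 : 0 ≤ C * A := by positivity
      have h4 : 0 ≤ C * A * ‖v‖ := by positivity
      have := (norm_comp_le_of_norm_le_one (fderiv ℝ f (y s) v) hπ)
      have := (norm_comp_le_of_norm_le_one (f (y s)) he)
      have := norm_add_le ((fderiv ℝ f (y s) v).comp π) ((f (y s)).comp e)
      unfold linCoeff
      linarith)
    (fun s t v v' => by
      have e1 : linCoeff f π e (y t) v' - linCoeff f π e (y s) v =
          (fderiv ℝ f (y t) v' - fderiv ℝ f (y s) v).comp π + (f (y t) - f (y s)).comp e := by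
        simp only [linCoeff, ContinuousLinearMap.sub_comp]; abel
      rw [e1]
      have h1 := hf.fderiv_apply_incr (y s) (y t) v v'
      have h2 := hf.lip (y s) (y t)
      have h3 := hy.abs hW s t
      have h4 := hα' s t
      have h5 := (norm_comp_le_of_norm_le_one (fderiv ℝ f (y t) v' - fderiv ℝ f (y s) v) hπ)
      have h6 := (norm_comp_le_of_norm_le_one (f (y t) - f (y s)) he)
      refine (norm_add_le _ _).trans ?_
      calc _ ≤ (C * ‖v' - v‖ + C * ‖y t - y s‖ * ‖v‖) + C * ‖y t - y s‖ := by linarith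
        _ ≤ (C * ‖v' - v‖ + C * (A * |W t - W s| ^ α) * ‖v‖) + C * (A * |W t - W s| ^ α) := by
          gcongr
        _ ≤ _ := by
          have h7 : 0 ≤ C * A * ‖v' - v‖ := by positivity
          have h8 : 0 ≤ C * (‖v‖ + 1) * |W t - W s| ^ α := by positivity
          linarith)
  obtain ⟨K, hK⟩ := hg
  obtain ⟨K', hK'⟩ := hg'
  obtain ⟨Kψ, hKψ⟩ := id hgψ
  have hdiff : ∀ s t, s ≤ t → ‖f (y' t) - f (y t) - (f (y' s) - f (y s))‖ ≤
      C * ‖y' t - y t - (y' s - y s)‖ + C * ‖y' s - y s‖ * (A * (W t - W s) ^ α) := by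
    intro s t hst
    have h2 := hf.diff_incr (y s) (y t) (y' s - y s) (y' t - y t)
    rw [add_sub_cancel, add_sub_cancel] at h2
    refine h2.trans ?_
    gcongr
    exact hy s t hst
  -- the first order bound
  obtain ⟨hδ, hδH⟩ := H₃ (C * (1 + A₁) * ε) W X (fun t => y' t - y t)
    (fun s => (f (y' s) - f (y s)).comp π + ε • (f (y' s)).comp e) (by positivity) hW hWc hT hX
    (fun s => by
      have h1 := norm_comp_le_of_norm_le_one (f (y' s) - f (y s)) hπ
      have h2 := norm_comp_le_of_norm_le_one (f (y' s)) he
      have h3 := hf.lip (y s) (y' s)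
      have h4 := hf.norm_le (y' s)
      refine (norm_add_le _ _).trans ?_
      rw [norm_smul, Real.norm_of_nonneg hε0]
      have h5 : ε * ‖(f (y' s)).comp e‖ ≤ ε * C := by gcongr; exact h2.trans h4
      have h6 : 0 ≤ C * A * ‖y' s - y s‖ := by positivity
      have h7 : 0 ≤ C * A₁ * ε := by positivity
      linarith)
    (fun s t hst => by
      have e1 : (f (y' t) - f (y t)).comp π + ε • (f (y' t)).comp e -
          ((f (y' s) - f (y s)).comp π + ε • (f (y' s)).comp e) =
          (f (y' t) - f (y t) - (f (y' s) - f (y s))).comp π +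
            ε • (f (y' t) - f (y' s)).comp e := by
        simp only [ContinuousLinearMap.sub_comp, smul_sub]; abel
      rw [e1]
      refine (norm_add_le _ _).trans ?_
      rw [norm_smul, Real.norm_of_nonneg hε0]
      have h1 := norm_comp_le_of_norm_le_one (f (y' t) - f (y t) - (f (y' s) - f (y s))) hπ
      have h2 := norm_comp_le_of_norm_le_one (f (y' t) - f (y' s)) he
      have h3 := hdiff s t hst
      have h4 := hαp s t hst
      have h5 : ε * ‖(f (y' t) - f (y' s)).comp e‖ ≤ ε * (C * (A₁ * (W t - W s) ^ α)) := by
        gcongr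
        exact h2.trans ((hf.lip _ _).trans (by gcongr; exact hy' s t hst))
      have h6 : 0 ≤ C * A * ‖y' t - y t - (y' s - y s)‖ := by positivity
      have h7 : 0 ≤ C * ‖y' s - y s‖ * (W t - W s) ^ α := by positivity
      have h8 : 0 ≤ C * ε * (W t - W s) ^ α := by positivity
      linarith)
    ⟨K' + K, fun s t hst => by
      have e1 : y' t - y t - (y' s - y s) -
          ((f (y' s) - f (y s)).comp π + ε • (f (y' s)).comp e) (X t - X s) =
          (y' t - y' s - ((f (y' s)).comp (π + ε • e)) (X t - X s)) -
          (y t - y s - ((f (y s)).comp π) (X t - X s)) := by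
        simp only [ContinuousLinearMap.comp_apply, add_apply, sub_apply, smul_apply, map_add,
          map_smul]
        abel
      rw [e1, add_mul]
      exact (norm_sub_le _ _).trans (add_le_add (hK' s t hst) (hK s t hst))⟩
  simp only [hy'0, hy0, sub_self, norm_zero, zero_add] at hδ hδH
  have hδ' : ∀ t, ‖y' t - y t‖ ≤ D₁ * ε := fun t => (hδ t).trans (by rw [hD₁]; linarith)
  have hδH' : ∀ s t, s ≤ t → ‖y' t - y t - (y' s - y s)‖ ≤ D₁ * ε * (W t - W s) ^ α :=
    fun s t hst => (hδH s t hst).trans (le_of_eq (by rw [hD₁]; ring))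
  -- the second order bound
  obtain ⟨hρ, -⟩ := H₃ (C * (D₁ ^ 2 + D₁) * (1 + A) * ε ^ 2) W X
    (fun t => y' t - y t - ε • ψ t)
    (fun s => (fderiv ℝ f (y s) (y' s - y s - ε • ψ s) + taylorRem f (y s) (y' s - y s)).comp π +
      ε • (f (y' s) - f (y s)).comp e) (by positivity) hW hWc hT hX
    (fun s => by
      have h1 := norm_comp_le_of_norm_le_one
        (fderiv ℝ f (y s) (y' s - y s - ε • ψ s) + taylorRem f (y s) (y' s - y s)) hπ
      have h2 := norm_comp_le_of_norm_le_one (f (y' s) - f (y s)) he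
      have h3 : ‖fderiv ℝ f (y s) (y' s - y s - ε • ψ s)‖ ≤ C * ‖y' s - y s - ε • ψ s‖ :=
        (ContinuousLinearMap.le_opNorm _ _).trans
          (mul_le_mul_of_nonneg_right (hf.fderiv_le _) (norm_nonneg _))
      have h4 : ‖taylorRem f (y s) (y' s - y s)‖ ≤ C * (D₁ * ε) ^ 2 :=
        (hf.taylorRem_le _ _).trans (by gcongr; exact hδ' s)
      have h5 : ε * ‖(f (y' s) - f (y s)).comp e‖ ≤ ε * (C * (D₁ * ε)) := by
        gcongr
        exact h2.trans ((hf.lip _ _).trans (by gcongr; exact hδ' s))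
      refine (norm_add_le _ _).trans ?_
      rw [norm_smul, Real.norm_of_nonneg hε0]
      have h6 := norm_add_le (fderiv ℝ f (y s) (y' s - y s - ε • ψ s))
        (taylorRem f (y s) (y' s - y s))
      have h7 : 0 ≤ C * A * ‖y' s - y s - ε • ψ s‖ := by positivity
      have h8 : 0 ≤ C * (D₁ ^ 2 + D₁) * A * ε ^ 2 := by positivity
      calc _ ≤ (C * ‖y' s - y s - ε • ψ s‖ + C * (D₁ * ε) ^ 2) + ε * (C * (D₁ * ε)) := by linarith
        _ ≤ _ := by nlinarith)
    (fun s t hst => by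
      have e1 : (fderiv ℝ f (y t) (y' t - y t - ε • ψ t) +
            taylorRem f (y t) (y' t - y t)).comp π + ε • (f (y' t) - f (y t)).comp e -
          ((fderiv ℝ f (y s) (y' s - y s - ε • ψ s) +
            taylorRem f (y s) (y' s - y s)).comp π + ε • (f (y' s) - f (y s)).comp e) =
          ((fderiv ℝ f (y t) (y' t - y t - ε • ψ t) - fderiv ℝ f (y s) (y' s - y s - ε • ψ s)) +
            (taylorRem f (y t) (y' t - y t) - taylorRem f (y s) (y' s - y s))).comp π +
            ε • (f (y' t) - f (y t) - (f (y' s) - f (y s))).comp e := by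
        simp only [ContinuousLinearMap.sub_comp, ContinuousLinearMap.add_comp, smul_sub]; abel
      rw [e1]
      have h4 := hαp s t hst
      have h3 := hy s t hst
      refine (norm_add_le _ _).trans ?_
      rw [norm_smul, Real.norm_of_nonneg hε0]
      have h1 := norm_comp_le_of_norm_le_one
        ((fderiv ℝ f (y t) (y' t - y t - ε • ψ t) - fderiv ℝ f (y s) (y' s - y s - ε • ψ s)) +
            (taylorRem f (y t) (y' t - y t) - taylorRem f (y s) (y' s - y s))) hπ
      have h2 := norm_add_le (fderiv ℝ f (y t) (y' t - y t - ε • ψ t) -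
        fderiv ℝ f (y s) (y' s - y s - ε • ψ s))
        (taylorRem f (y t) (y' t - y t) - taylorRem f (y s) (y' s - y s))
      have a1 : ‖fderiv ℝ f (y t) (y' t - y t - ε • ψ t) -
          fderiv ℝ f (y s) (y' s - y s - ε • ψ s)‖ ≤
          C * ‖y' t - y t - ε • ψ t - (y' s - y s - ε • ψ s)‖ +
          C * (A * (W t - W s) ^ α) * ‖y' s - y s - ε • ψ s‖ := by
        refine (hf.fderiv_apply_incr _ _ _ _).trans ?_
        gcongr
      have a2 : ‖taylorRem f (y t) (y' t - y t) - taylorRem f (y s) (y' s - y s)‖ ≤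
          C * (D₁ * ε) * (D₁ * ε * (W t - W s) ^ α) +
          C * (D₁ * ε) ^ 2 * (A * (W t - W s) ^ α) := by
        refine (hf.taylorRem_incr _ _ _ _ (hδ' s) (hδ' t)).trans ?_
        gcongr
        exact hδH' s t hst
      have a3 : ‖(f (y' t) - f (y t) - (f (y' s) - f (y s))).comp e‖ ≤
          C * (D₁ * ε * (W t - W s) ^ α) + C * (D₁ * ε) * (A * (W t - W s) ^ α) := by
        refine (norm_comp_le_of_norm_le_one _ he).trans ((hdiff s t hst).trans ?_)
        gcongr
        · exact hδH' s t hst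
        · exact hδ' s
      have a4 := mul_le_mul_of_nonneg_left a3 hε0
      have a5 : 0 ≤ C * A * ‖y' t - y t - ε • ψ t - (y' s - y s - ε • ψ s)‖ := by positivity
      have a6 : 0 ≤ C * (W t - W s) ^ α * ‖y' s - y s - ε • ψ s‖ := by positivity
      have a7 : (C * (D₁ * ε) * (D₁ * ε * (W t - W s) ^ α) +
          C * (D₁ * ε) ^ 2 * (A * (W t - W s) ^ α)) + ε * (C * (D₁ * ε * (W t - W s) ^ α) +
          C * (D₁ * ε) * (A * (W t - W s) ^ α)) =
          C * (D₁ ^ 2 + D₁) * (1 + A) * ε ^ 2 * (W t - W s) ^ α := by ring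
      linarith)
    ⟨K' + K + ε * Kψ, fun s t hst => by
      have e1 := expansion_defect f π e ε (y t) (y s) (y' t) (y' s) (ψ t) (ψ s) (X t - X s)
      rw [e1, add_mul, add_mul]
      refine (norm_sub_le _ _).trans (add_le_add ((norm_sub_le _ _).trans
        (add_le_add (hK' s t hst) (hK s t hst))) ?_)
      rw [norm_smul, Real.norm_of_nonneg hε0, mul_assoc]
      exact mul_le_mul_of_nonneg_left (hKψ s t hst) hε0⟩
  simp only [hy'0, hy0, hψ0, smul_zero, sub_self, norm_zero, zero_add] at hρ
  exact ⟨y', ψ, hy'0, ⟨A₁, hA₁0, hy'⟩, ⟨K', hK'⟩, hψ0, ⟨_, by positivity, hψ⟩, hgψ,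
    (hρ 1).trans (le_of_eq (by ring))⟩

end Derivative

/-! ### The derivative of the skeleton -/

section Adjoint

open Filter Topology

variable {E F F' : Type*} [NormedAddCommGroup E] [NormedSpace ℝ E]
  [NormedAddCommGroup F] [NormedSpace ℝ F] [NormedAddCommGroup F'] [NormedSpace ℝ F']

lemma IsGerm.mono_clock {α : ℝ} (hα : 0 ≤ α) {W W' : unitInterval → ℝ} (hW : Monotone W)
    {X : unitInterval → F} {δ : unitInterval → E} {B : unitInterval → F →L[ℝ] E}
    (h : IsGerm α W X δ B) (hWW' : ∀ s t, s ≤ t → W t - W s ≤ W' t - W' s) :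
    IsGerm α W' X δ B := by
  obtain ⟨K, hK0, hK⟩ := h.exists_nonneg hW
  refine ⟨K, fun s t hst => (hK s t hst).trans ?_⟩
  have := sub_nonneg.2 (hW hst)
  gcongr ?_ * ?_ ^ _
  exact hWW' s t hst

/-- Solving `dy = b(t,y) dX` backwards from time `1`. -/
theorem exists_germ_solution_backward [FiniteDimensional ℝ E] {α L G : ℝ} (hα : 1 / 2 < α)
    (hL : 0 ≤ L) (hG : 0 ≤ G) {W : unitInterval → ℝ} (hW : Monotone W) (hWc : Continuous W)
    {X : unitInterval → F} (hX : HolderWrt α W 1 X) {b : unitInterval → E → F →L[ℝ] E} (y₁ : E)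
    (hb : ∀ s y, ‖b s y‖ ≤ L * ‖y‖ + G)
    (hb' : ∀ s t y y', ‖b t y' - b s y‖ ≤ L * ‖y' - y‖ + (L * ‖y‖ + G) * |W t - W s| ^ α) :
    ∃ y : unitInterval → E, y 1 = y₁ ∧ (∃ A, 0 ≤ A ∧ HolderWrt α W A y) ∧
      IsGerm α W X y (fun s => b s (y s)) := by
  obtain ⟨C, hC, H⟩ := exists_germ_solution E F (L := L) (T := W 1 - W 0) hα hL
  have hanti : ∀ s t : unitInterval, s ≤ t → unitInterval.symm t ≤ unitInterval.symm s :=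
    fun s t h => unitInterval.strictAnti_symm.antitone h
  obtain ⟨y, hy0, hyb, hy, hyg⟩ := H G (fun s => -W (unitInterval.symm s))
    (fun s => X (unitInterval.symm s)) (fun s => b (unitInterval.symm s)) y₁ hG
    (fun s t hst => neg_le_neg (hW (hanti s t hst)))
    (hWc.comp unitInterval.continuous_symm).neg (by simp)
    (fun s t hst => by
      have := hX _ _ (hanti s t hst)
      rwa [norm_sub_rev, neg_sub_neg]) (fun s y => hb _ y)
    (fun s t y y' => by
      have := hb' (unitInterval.symm s) (unitInterval.symm t) y y'
      rwa [neg_sub_neg, abs_sub_comm])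
  set A := C * (‖y₁‖ + G) with hA
  have hA0 : 0 ≤ A := by positivity
  obtain ⟨K, hK⟩ := hyg
  have hyH : HolderWrt α W A (fun t => y (unitInterval.symm t)) := by
    intro s t hst
    have := hy _ _ (hanti s t hst)
    simp only [unitInterval.symm_symm] at this
    rwa [norm_sub_rev, neg_sub_neg] at this
  refine ⟨fun t => y (unitInterval.symm t), by simp [hy0], ⟨A, hA0, hyH⟩,
    K + (L * A + (L * A + G)), fun s t hst => ?_⟩
  have h1 := hK _ _ (hanti s t hst)
  simp only [unitInterval.symm_symm] at h1
  rw [neg_sub_neg] at h1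
  have h0 := sub_nonneg.2 (hW hst)
  have h2 := hb' s t (y (unitInterval.symm s)) (y (unitInterval.symm t))
  rw [abs_of_nonneg h0] at h2
  have h3 := hyH s t hst
  have h4 := hX s t hst
  have h5 : ‖y (unitInterval.symm s)‖ ≤ A := hyb _
  have h6 := Real.rpow_nonneg h0 α
  have e : y (unitInterval.symm t) - y (unitInterval.symm s) -
      b s (y (unitInterval.symm s)) (X t - X s) =
      -(y (unitInterval.symm s) - y (unitInterval.symm t) -
        b t (y (unitInterval.symm t)) (X s - X t)) +
      (b t (y (unitInterval.symm t)) - b s (y (unitInterval.symm s))) (X t - X s) := by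
    simp only [sub_apply, map_sub]; abel
  rw [e, add_mul]
  refine (norm_add_le _ _).trans (add_le_add (by rw [norm_neg]; exact h1) ?_)
  refine (ContinuousLinearMap.le_opNorm _ _).trans ?_
  calc _ ≤ (L * (A * (W t - W s) ^ α) + (L * A + G) * (W t - W s) ^ α) *
        (1 * (W t - W s) ^ α) := by
        gcongr
        refine h2.trans ?_
        gcongr
    _ = (L * A + (L * A + G)) * ((W t - W s) ^ α * (W t - W s) ^ α) := by ring
    _ = _ := by rw [← Real.rpow_add_of_nonneg h0 (by linarith) (by linarith), two_mul]

/-- The coefficient of the adjoint equation `dP = - P Df(y) dX`. -/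
def adjCoeff (f : E → F →L[ℝ] E) (y : E) (P : E →L[ℝ] E) : F →L[ℝ] E →L[ℝ] E :=
  -((ContinuousLinearMap.compL ℝ E E E P).comp (fderiv ℝ f y).flip)

lemma adjCoeff_apply (f : E → F →L[ℝ] E) (y : E) (P : E →L[ℝ] E) (x : F) (v : E) :
    adjCoeff f y P x v = -P (fderiv ℝ f y v x) := by
  simp [adjCoeff]

lemma norm_compL_comp_flip_le (P : E →L[ℝ] E) (D : E →L[ℝ] F →L[ℝ] E) :
    ‖(ContinuousLinearMap.compL ℝ E E E P).comp D.flip‖ ≤ ‖D‖ * ‖P‖ := by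
  refine (ContinuousLinearMap.opNorm_comp_le _ _).trans ?_
  rw [ContinuousLinearMap.opNorm_flip, mul_comm]
  gcongr
  refine (ContinuousLinearMap.le_opNorm _ _).trans ?_
  exact mul_le_of_le_one_left (norm_nonneg _) (ContinuousLinearMap.norm_compL_le ℝ E E E)

variable {f : E → F →L[ℝ] E} {C : ℝ}

/-- The adjoint flow, normalised to be the identity at time `1`. -/
theorem exists_adjoint [FiniteDimensional ℝ E] (hf : BoundedLipDeriv f C) {α A : ℝ}
    (hα : 1 / 2 < α) (hA : 0 ≤ A) {W : unitInterval → ℝ} (hW : Monotone W) (hWc : Continuous W)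
    {X : unitInterval → F} (hX : HolderWrt α W 1 X) {y : unitInterval → E}
    (hy : HolderWrt α W A y) :
    ∃ P : unitInterval → E →L[ℝ] E, P 1 = ContinuousLinearMap.id ℝ E ∧
      (∃ A', 0 ≤ A' ∧ HolderWrt α W A' P) ∧ IsGerm α W X P (fun s => adjCoeff f (y s) (P s)) := by
  have hC := hf.nonneg
  refine exists_germ_solution_backward (L := C * (1 + A)) (G := 0) hα (by positivity) le_rfl hW hWc
    hX (b := fun s P => adjCoeff f (y s) P) _ (fun s P => ?_) (fun s t P P' => ?_)
  · rw [adjCoeff, norm_neg, add_zero]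
    refine (norm_compL_comp_flip_le _ _).trans ?_
    gcongr
    have := hf.fderiv_le (y s)
    nlinarith
  · have e : adjCoeff f (y t) P' - adjCoeff f (y s) P =
        -((ContinuousLinearMap.compL ℝ E E E (P' - P)).comp (fderiv ℝ f (y t)).flip +
          (ContinuousLinearMap.compL ℝ E E E P).comp
            (fderiv ℝ f (y t) - fderiv ℝ f (y s)).flip) := by
      ext x v
      simp [adjCoeff]
      abel
    rw [e, norm_neg, add_zero]
    refine (norm_add_le _ _).trans ?_
    have h1 := norm_compL_comp_flip_le (P' - P) (fderiv ℝ f (y t))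
    have h2 := norm_compL_comp_flip_le P (fderiv ℝ f (y t) - fderiv ℝ f (y s))
    have h3 := hf.fderiv_le (y t)
    have h4 := hf.fderiv_lip (y s) (y t)
    have h5 := hy.abs hW s t
    have h6 := Real.rpow_nonneg (abs_nonneg (W t - W s)) α
    calc _ ≤ C * ‖P' - P‖ + C * (A * |W t - W s| ^ α) * ‖P‖ := by
          refine add_le_add (h1.trans (by gcongr)) (h2.trans ?_)
          gcongr
          exact h4.trans (by gcongr)
      _ ≤ _ := by
          have : 0 ≤ C * A * ‖P' - P‖ := by positivity
          have : 0 ≤ C * ‖P‖ * |W t - W s| ^ α := by positivity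
          nlinarith

/-- Variation of constants: along the linearised solution `ψ`, the germ of `P ψ` is
`P f(y) e dX`. -/
lemma adjoint_product {π e : F' →L[ℝ] F} {α A₁ A₂ : ℝ} (hα : 1 / 2 < α)
    (hA₁ : 0 ≤ A₁) (hA₂ : 0 ≤ A₂)
    {W : unitInterval → ℝ} (hW : Monotone W) (hWc : Continuous W) {X : unitInterval → F'}
    {y ψ : unitInterval → E} {P : unitInterval → E →L[ℝ] E}
    (hP : HolderWrt α W A₁ P) (hψ : HolderWrt α W A₂ ψ)
    (hPg : IsGerm α W (fun t => π (X t)) P (fun s => adjCoeff f (y s) (P s)))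
    (hψg : IsGerm α W X ψ (fun s => linCoeff f π e (y s) (ψ s))) :
    ∃ K, 0 ≤ K ∧ ∀ s t, s ≤ t →
      ‖P t (ψ t) - P s (ψ s) - P s (f (y s) (e (X t - X s)))‖ ≤ K * (W t - W s) ^ (2 * α) := by
  have hα0 : 0 < α := by linarith
  obtain ⟨M₁, hM₁, h1⟩ := hP.bounded hα0 hW hWc
  obtain ⟨M₂, hM₂, h2⟩ := hψ.bounded hα0 hW hWc
  obtain ⟨K₁, hK₁, k1⟩ := hPg.exists_nonneg hW
  obtain ⟨K₂, hK₂, k2⟩ := hψg.exists_nonneg hW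
  refine ⟨M₁ * K₂ + K₁ * M₂ + A₁ * A₂, by positivity, fun s t hst => ?_⟩
  have h0 := sub_nonneg.2 (hW hst)
  have e1 : P t (ψ t) - P s (ψ s) - P s (f (y s) (e (X t - X s))) =
      P s (ψ t - ψ s - linCoeff f π e (y s) (ψ s) (X t - X s)) +
      (P t - P s - adjCoeff f (y s) (P s) (π (X t) - π (X s))) (ψ s) +
      (P t - P s) (ψ t - ψ s) := by
    have h3 : (P t - P s - adjCoeff f (y s) (P s) (π (X t) - π (X s))) (ψ s) =
        P t (ψ s) - P s (ψ s) + P s (fderiv ℝ f (y s) (ψ s) (π (X t - X s))) := by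
      rw [sub_apply, sub_apply, adjCoeff_apply, sub_neg_eq_add, map_sub π]
    rw [h3, linCoeff]
    simp only [map_sub, map_add, sub_apply, add_apply, ContinuousLinearMap.comp_apply]
    abel
  have r0 := Real.rpow_nonneg h0 (2 * α)
  have r1 := Real.rpow_nonneg h0 α
  have n1 : ‖P s (ψ t - ψ s - linCoeff f π e (y s) (ψ s) (X t - X s))‖ ≤
      M₁ * (K₂ * (W t - W s) ^ (2 * α)) := by
    refine (ContinuousLinearMap.le_opNorm _ _).trans ?_
    gcongr
    · exact h1 s
    · exact k2 s t hst
  have n2 : ‖(P t - P s - adjCoeff f (y s) (P s) (π (X t) - π (X s))) (ψ s)‖ ≤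
      (K₁ * (W t - W s) ^ (2 * α)) * M₂ := by
    refine (ContinuousLinearMap.le_opNorm _ _).trans ?_
    gcongr
    · exact k1 s t hst
    · exact h2 s
  have n3 : ‖(P t - P s) (ψ t - ψ s)‖ ≤ A₁ * A₂ * (W t - W s) ^ (2 * α) := by
    refine (ContinuousLinearMap.le_opNorm _ _).trans ?_
    calc _ ≤ (A₁ * (W t - W s) ^ α) * (A₂ * (W t - W s) ^ α) := by
          gcongr
          · exact hP s t hst
          · exact hψ s t hst
      _ = A₁ * A₂ * ((W t - W s) ^ α * (W t - W s) ^ α) := by ring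
      _ = _ := by rw [← Real.rpow_add_of_nonneg h0 hα0.le hα0.le, two_mul]
  rw [e1]
  refine (norm_add_le _ _).trans ((add_le_add (norm_add_le _ _) le_rfl).trans ?_)
  linarith

end Adjoint

section SkeletonDerivative

open Filter Topology

variable {d n : ℕ} {V₀ : EuclideanSpace ℝ (Fin n) → EuclideanSpace ℝ (Fin n)}
  {V : Fin d → EuclideanSpace ℝ (Fin n) → EuclideanSpace ℝ (Fin n)}
  {z : EuclideanSpace ℝ (Fin n)}
  {H : Type*} [NormedAddCommGroup H] [InnerProductSpace ℝ H]
  [RKHS ℝ H unitInterval (EuclideanSpace ℝ (Fin d))]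

variable (H) in
/-- The elements of `H` are continuous paths whose `p`-variation is controlled by their norm. -/
def VarEmbedding (p C : ℝ) : Prop :=
  ∀ h : H, Continuous h ∧ ∀ N τ, IsDissection 0 1 N τ → varSum h p N τ ≤ C * ‖h‖ ^ p

lemma VarEmbedding.finiteVarPath {p C : ℝ} (hH : VarEmbedding H p C) (h : H) :
    FiniteVarPath p (h : unitInterval → EuclideanSpace ℝ (Fin d)) :=
  ⟨(hH h).1, _, (hH h).2⟩

/-- Riemann sums over uniform grids for `∫ P_s V(y_s) dk_s`. -/
def riemannSum (V : Fin d → EuclideanSpace ℝ (Fin n) → EuclideanSpace ℝ (Fin n))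
    (y : unitInterval → EuclideanSpace ℝ (Fin n))
    (P : unitInterval → EuclideanSpace ℝ (Fin n) →L[ℝ] EuclideanSpace ℝ (Fin n)) (N : ℕ)
    (k : unitInterval → EuclideanSpace ℝ (Fin d)) : EuclideanSpace ℝ (Fin n) :=
  ∑ i ∈ Finset.range N, P (gridPt N i)
    (∑ j, (k (gridPt N (i + 1)) j - k (gridPt N i) j) • V j (y (gridPt N i)))

variable (H) in
/-- The Riemann sums as continuous linear maps on `H`. -/
def riemannCLM (V : Fin d → EuclideanSpace ℝ (Fin n) → EuclideanSpace ℝ (Fin n))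
    (y : unitInterval → EuclideanSpace ℝ (Fin n))
    (P : unitInterval → EuclideanSpace ℝ (Fin n) →L[ℝ] EuclideanSpace ℝ (Fin n)) (N : ℕ) :
    H →L[ℝ] EuclideanSpace ℝ (Fin n) where
  toFun k := riemannSum V y P N k
  map_add' k l := by
    simp only [riemannSum, RKHS.coe_add, Pi.add_apply, PiLp.add_apply, ← Finset.sum_add_distrib,
      ← map_add, ← add_smul]
    refine Finset.sum_congr rfl fun i _ => ?_
    congr 1
    refine Finset.sum_congr rfl fun j _ => ?_
    congr 1; ring
  map_smul' c k := by
    simp only [riemannSum, RKHS.coe_smul, Pi.smul_apply, PiLp.smul_apply, Finset.smul_sum,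
      ← map_smul, smul_eq_mul, smul_smul, mul_sub, RingHom.id_apply]
  cont := by
    have hc : ∀ (t : unitInterval) (j : Fin d), Continuous fun k : H => (k t) j := fun t j =>
      (EuclideanSpace.proj (𝕜 := ℝ) j).continuous.comp (RKHS.continuous_eval (𝕜 := ℝ) t)
    refine continuous_finsetSum _ fun i _ => (P _).continuous.comp
      (continuous_finsetSum _ fun j _ => ?_)
    exact ((hc _ j).sub (hc _ j)).smul continuous_const

/-- Fréchet differentiability of the skeleton, with the derivative given by variation of constants:
`DΦ₁(h)k = ∫ P_s V(Φ_s(h)) dk_s`, where `P` is the adjoint flow. -/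
theorem skeleton_hasFDerivAt [CompleteSpace H] (hV₀ : SmoothBounded V₀)
    (hV : ∀ j, SmoothBounded (V j)) {p Cv : ℝ} (hp1 : 1 ≤ p) (hp2 : p < 2)
    (hH : VarEmbedding H p Cv) (h : H) :
    ∃ (D : H →L[ℝ] EuclideanSpace ℝ (Fin n)) (y : unitInterval → EuclideanSpace ℝ (Fin n))
      (P : unitInterval → EuclideanSpace ℝ (Fin n) →L[ℝ] EuclideanSpace ℝ (Fin n)),
      Continuous y ∧ Continuous P ∧ P 1 = ContinuousLinearMap.id ℝ _ ∧
      HasFDerivAt (fun k : H => skeleton V₀ V z k 1) D h ∧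
      ∀ k : H, Tendsto (fun N => riemannSum V y P N k) atTop (𝓝 (D k)) := by
  obtain ⟨r, hpr, hr2⟩ := exists_between hp2
  have hr : 0 < r := by linarith
  have hα : 1 / 2 < 1 / r := by gcongr
  have hα1 : 1 / r ≤ 1 := by rw [div_le_one hr]; linarith
  have hα0 : 0 < 1 / r := by positivity
  obtain ⟨C, hf⟩ := (driftField_smoothBdd hV₀ hV).boundedLipDeriv
  have hC := hf.nonneg
  obtain ⟨W₀, hW₀, hWc₀, hX₀⟩ := exists_clock_timed hp1 hpr (hH.finiteVarPath h)
  -- the unperturbed solution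
  obtain ⟨C₁, hC₁, H₁⟩ := exists_germ_solution (EuclideanSpace ℝ (Fin n))
    (ℝ × EuclideanSpace ℝ (Fin d)) (L := C) (T := W₀ 1 - W₀ 0) hα hC
  obtain ⟨y, hy0, -, hy, hyg⟩ := H₁ C W₀ (timed h) (fun _ => driftField V₀ V) z hC hW₀ hWc₀ le_rfl
    hX₀ (fun s y => (hf.norm_le y).trans (le_add_of_nonneg_left (by positivity)))
    (fun s t y y' => (hf.lip y y').trans (le_add_of_nonneg_right (by
      have := Real.rpow_nonneg (abs_nonneg (W₀ t - W₀ s)) (1 / r)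
      positivity)))
  set A := C₁ * (‖z‖ + C) with hAdef
  have hA : 0 ≤ A := by positivity
  have hys : skeleton V₀ V z h = y := skeleton_eq hV₀ hV hp1 hp2 (hH.finiteVarPath h)
    (isSkeleton_of_germ hV₀ hV hα hα1 hA zero_le_one hW₀ hWc₀ hX₀ hy hy0 hyg)
  obtain ⟨P, hP1, ⟨A₁, hA₁, hP⟩, hPg⟩ := exists_adjoint hf hα hA hW₀ hWc₀ hX₀ hy
  -- the perturbation result
  let π : (ℝ × EuclideanSpace ℝ (Fin d)) × EuclideanSpace ℝ (Fin d) →L[ℝ]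
    ℝ × EuclideanSpace ℝ (Fin d) := ContinuousLinearMap.fst ℝ _ _
  let e : (ℝ × EuclideanSpace ℝ (Fin d)) × EuclideanSpace ℝ (Fin d) →L[ℝ]
    ℝ × EuclideanSpace ℝ (Fin d) := (ContinuousLinearMap.inr ℝ ℝ _).comp
      (ContinuousLinearMap.snd ℝ _ _)
  have hπ : ‖π‖ ≤ 1 := ContinuousLinearMap.norm_fst_le ..
  have he : ‖e‖ ≤ 1 := by
    refine ContinuousLinearMap.opNorm_le_bound _ zero_le_one fun x => ?_
    simp only [e, ContinuousLinearMap.comp_apply, ContinuousLinearMap.inr_apply,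
      ContinuousLinearMap.coe_snd', one_mul, Prod.norm_mk, norm_zero]
    exact max_le (norm_nonneg _) (norm_snd_le x)
  have hCv : 0 ≤ |Cv| ^ (r / p) := by positivity
  obtain ⟨M, hM, H₂⟩ := exists_expansion hf hπ he (T := W₀ 1 - W₀ 0 + |Cv| ^ (r / p)) hα hA z
  have expand : ∀ (κ : H) (ε : ℝ), ‖κ‖ ≤ 1 → 0 ≤ ε → ε ≤ 1 →
      ∃ v : EuclideanSpace ℝ (Fin n), Tendsto (fun N => riemannSum V y P N κ) atTop (𝓝 v) ∧
        ‖skeleton V₀ V z ((h + ε • κ : H) : unitInterval → _) 1 - skeleton V₀ V z h 1 - ε • v‖ ≤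
          M * ε ^ 2 := by
    intro κ ε hκ hε0 hε1
    obtain ⟨Wk, hWk, hWck, hTk, hk⟩ := exists_clock (C := |Cv|) (hH κ).1 hp1 hpr
      (fun N τ hτ => ((hH κ).2 N τ hτ).trans (by
        calc Cv * ‖κ‖ ^ p ≤ |Cv| * 1 := by
              gcongr
              · exact le_abs_self _
              · exact Real.rpow_le_one (norm_nonneg _) hκ (by linarith)
          _ = |Cv| := mul_one _))
    have hkH := holderWrt_of_rpow_le hr hk
    have hW : Monotone fun t => W₀ t + Wk t := hW₀.add hWk
    have hWc : Continuous fun t => W₀ t + Wk t := by fun_prop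
    have hWW : ∀ s t, s ≤ t → W₀ t - W₀ s ≤ (W₀ t + Wk t) - (W₀ s + Wk s) := fun s t hst => by
      have := hWk hst; linarith
    have hX : HolderWrt (1 / r) (fun t => W₀ t + Wk t) 1 (fun t => (timed h t, κ t)) := by
      refine HolderWrt.prodMk (hX₀.mono_clock hα0.le zero_le_one hW₀ hWW)
        (hkH.mono_clock hα0.le zero_le_one hWk fun s t hst => ?_)
      have := hW₀ hst; linarith
    have hy' := hy.mono_clock hα0.le hA hW₀ hWW
    obtain ⟨y', ψ, hy'0, ⟨A', hA', hy'H⟩, hy'g, hψ0, ⟨A₂, hA₂, hψ⟩, hψg, hest⟩ :=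
      H₂ (fun t => W₀ t + Wk t) (fun t => (timed h t, κ t)) y ε hW hWc (by linarith) hX hy0 hy'
        (hyg.mono_clock hα0.le hW₀ hWW) hε0 hε1
    have hdrv : ∀ t, (π + ε • e) (timed h t, κ t) =
        timed ((h + ε • κ : H) : unitInterval → _) t := by
      intro t
      simp [π, e, timed, RKHS.coe_add, RKHS.coe_smul]
    have hX' : HolderWrt (1 / r) (fun t => W₀ t + Wk t) 2
        (timed ((h + ε • κ : H) : unitInterval → EuclideanSpace ℝ (Fin d))) := by
      intro s t hst
      rw [← hdrv, ← hdrv, ← map_sub]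
      refine (ContinuousLinearMap.le_opNorm _ _).trans ?_
      have h1 : ‖π + ε • e‖ ≤ 2 := by
        refine (norm_add_le _ _).trans ?_
        rw [norm_smul, Real.norm_of_nonneg hε0]
        nlinarith [norm_nonneg e]
      have h2 := hX s t hst
      rw [one_mul] at h2
      gcongr
    have hsk : skeleton V₀ V z ((h + ε • κ : H) : unitInterval → _) = y' := by
      refine skeleton_eq hV₀ hV hp1 hp2 (hH.finiteVarPath _)
        (isSkeleton_of_germ hV₀ hV hα hα1 hA' zero_le_two hW hWc hX' hy'H hy'0 ?_)
      obtain ⟨K, hK⟩ := hy'g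
      refine ⟨K, fun s t hst => ?_⟩
      have := hK s t hst
      rwa [ContinuousLinearMap.comp_apply, map_sub, hdrv, hdrv] at this
    obtain ⟨K, hK0, hK⟩ := adjoint_product (π := π) (e := e) hα hA₁ hA₂ hW hWc
      (X := fun t => (timed h t, κ t)) (hP.mono_clock hα0.le hA₁ hW₀ hWW) hψ
      (hPg.mono_clock hα0.le hW₀ hWW) hψg
    refine ⟨ψ 1, ?_, by rw [hsk, hys]; exact hest⟩
    have := tendsto_grid_sum hα hK0 hW hWc hK
    rw [hψ0, hP1, map_zero, sub_zero, ContinuousLinearMap.id_apply] at this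
    refine this.congr fun N => Finset.sum_congr rfl fun i _ => ?_
    congr 1
    rw [driftField_apply]
    simp [e]
  have hlim : ∀ k : H, ∃ v, Tendsto (fun N => riemannCLM H V y P N k) atTop (𝓝 v) := by
    intro k
    obtain ⟨v, hv, -⟩ := expand (‖k‖⁻¹ • k) 0 (by
      rw [norm_smul, norm_inv, norm_norm]; exact inv_mul_le_one) le_rfl zero_le_one
    refine ⟨‖k‖ • v, ?_⟩
    have h1 : Tendsto (fun N => riemannCLM H V y P N (‖k‖⁻¹ • k)) atTop (𝓝 v) := hv
    have h2 := h1.const_smul ‖k‖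
    refine h2.congr fun N => ?_
    rw [← map_smul, smul_smul]
    rcases eq_or_ne k 0 with rfl | hk
    · simp
    · rw [mul_inv_cancel₀ (norm_ne_zero_iff.2 hk), one_smul]
  choose v hv using hlim
  let D : H →L[ℝ] EuclideanSpace ℝ (Fin n) := continuousLinearMapOfTendsto
    (fun N => riemannCLM H V y P N) (f := v) (l := atTop) (tendsto_pi_nhds.2 hv)
  have hDv : ∀ k, D k = v k := fun k => rfl
  refine ⟨D, y, P, hy.continuous hα0 hW₀ hWc₀, hP.continuous hα0 hW₀ hWc₀, hP1, ?_, fun k => hv k⟩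
  have hbound : ∀ k : H, ‖k‖ ≤ 1 →
      ‖skeleton V₀ V z ((h + k : H) : unitInterval → _) 1 - skeleton V₀ V z h 1 - D k‖ ≤
        M * ‖k‖ ^ 2 := by
    intro k hk
    obtain ⟨v', hv', hest⟩ := expand (‖k‖⁻¹ • k) ‖k‖ (by
      rw [norm_smul, norm_inv, norm_norm]; exact inv_mul_le_one) (norm_nonneg _) hk
    have hkk : ‖k‖ • (‖k‖⁻¹ • k) = k := by
      rcases eq_or_ne k 0 with rfl | hk0
      · simp
      · rw [smul_smul, mul_inv_cancel₀ (norm_ne_zero_iff.2 hk0), one_smul]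
    have hvD : v' = D (‖k‖⁻¹ • k) := tendsto_nhds_unique hv' (hv _)
    rwa [hvD, ← map_smul, hkk] at hest
  rw [hasFDerivAt_iff_isLittleO_nhds_zero]
  refine Asymptotics.IsBigO.trans_isLittleO (g := fun k : H => ‖k‖ ^ 2) ?_ ?_
  · refine Asymptotics.IsBigO.of_bound M ?_
    filter_upwards [Metric.closedBall_mem_nhds (0 : H) one_pos] with k hk
    rw [norm_pow, norm_norm]
    exact hbound k (by simpa using hk)
  · simpa using (Asymptotics.isLittleO_norm_pow_id (E' := H) one_lt_two)

end SkeletonDerivative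

/-! ### Increments of the kernel -/

section Kernel

open Filter Topology

variable {Ω : Type*} [MeasurableSpace Ω]

lemma measurable_component {d : ℕ}
    {X : unitInterval → Ω → EuclideanSpace ℝ (Fin d)} (P : Measure Ω)
    [hX : IsContinuousCenteredGaussianIID X P] (t : unitInterval) (j : Fin d) :
    Measurable fun ω => X t ω j :=
  (EuclideanSpace.proj (𝕜 := ℝ) j).continuous.measurable.comp (hX.measurable t)

lemma measurable_component_sub {d : ℕ}
    {X : unitInterval → Ω → EuclideanSpace ℝ (Fin d)} (P : Measure Ω)
    [hX : IsContinuousCenteredGaussianIID X P] (s t : unitInterval) (j : Fin d) :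
    Measurable fun ω => X t ω j - X s ω j :=
  (measurable_component P t j).sub (measurable_component P s j)

variable {d : ℕ} [NeZero d] (X : unitInterval → Ω → EuclideanSpace ℝ (Fin d)) (P : Measure Ω)

lemma covFun_comm (s t : unitInterval) : covFun X P s t = covFun X P t s := by
  simp only [covFun, mul_comm]

lemma rectIncr_comm (a b c e : unitInterval) :
    rectIncr (covFun X P) a b c e = rectIncr (covFun X P) c e a b := by
  simp only [rectIncr, covFun_comm X P b, covFun_comm X P a]
  ring

variable [hX : IsContinuousCenteredGaussianIID X P]

/-- The increment `(R(b, ·) - R(a, ·)) u` of the reproducing kernel; it corresponds to the step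
function `1_{(a,b]} u`. -/
def kerIncr (a b : unitInterval) (u : EuclideanSpace ℝ (Fin d)) : CameronMartin X P :=
  RKHS.kerFun (CameronMartin X P) b u - RKHS.kerFun (CameronMartin X P) a u

variable {X P}

lemma inner_kerFun_kerFun (s t : unitInterval) (u v : EuclideanSpace ℝ (Fin d)) :
    ⟪RKHS.kerFun (CameronMartin X P) s u, RKHS.kerFun (CameronMartin X P) t v⟫_ℝ =
      covFun X P s t * ⟪u, v⟫_ℝ := by
  rw [← RKHS.kernel_inner, RKHS.OfKernel.kernel_ofKernel, covFun_comm X P]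
  simp [covKernel, inner_smul_left]

lemma inner_kerIncr_kerIncr (a b c e : unitInterval) (u v : EuclideanSpace ℝ (Fin d)) :
    ⟪kerIncr X P a b u, kerIncr X P c e v⟫_ℝ =
      rectIncr (covFun X P) a b c e * ⟪u, v⟫_ℝ := by
  simp only [kerIncr, inner_sub_left, inner_sub_right, inner_kerFun_kerFun, rectIncr]
  ring

lemma inner_kerIncr (a b : unitInterval) (u : EuclideanSpace ℝ (Fin d)) (h : CameronMartin X P) :
    ⟪kerIncr X P a b u, h⟫_ℝ = ⟪u, h b - h a⟫_ℝ := by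
  simp only [kerIncr, inner_sub_left, RKHS.kerFun_inner, inner_sub_right]

lemma norm_sq_sum_kerIncr (N : ℕ) (τ : ℕ → unitInterval) (g : ℕ → EuclideanSpace ℝ (Fin d)) :
    ‖∑ i ∈ Finset.range N, kerIncr X P (τ i) (τ (i + 1)) (g i)‖ ^ 2 =
      ∑ i ∈ Finset.range N, ∑ l ∈ Finset.range N,
        rectIncr (covFun X P) (τ i) (τ (i + 1)) (τ l) (τ (l + 1)) * ⟪g i, g l⟫_ℝ := by
  rw [← real_inner_self_eq_norm_sq, sum_inner]
  simp only [inner_sum, inner_kerIncr_kerIncr]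

lemma rectIncr_eq_integral (a b c e : unitInterval) :
    rectIncr (covFun X P) a b c e =
      ∫ ω, (X b ω 0 - X a ω 0) * (X e ω 0 - X c ω 0) ∂P := by
  have hint : ∀ x y, Integrable (fun ω => X x ω 0 * X y ω 0) P := fun x y =>
    (memLp_component X P x 0).integrable_mul (memLp_component X P y 0)
  have : ∀ ω, (X b ω 0 - X a ω 0) * (X e ω 0 - X c ω 0) =
      X b ω 0 * X e ω 0 - X b ω 0 * X c ω 0 - X a ω 0 * X e ω 0 + X a ω 0 * X c ω 0 := by
    intro ω; ring
  simp_rw [this]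
  rw [integral_add, integral_sub, integral_sub]
  · rfl
  all_goals first
    | exact hint _ _
    | exact (hint _ _).sub (hint _ _)
    | exact ((hint _ _).sub (hint _ _)).sub (hint _ _)

variable [IsProbabilityMeasure P]

/-- The characteristic function of an increment. -/
lemma integral_cexp_increment (s t : unitInterval) :
    ∫ ω, Complex.exp ((X t ω 0 - X s ω 0 : ℝ) * Complex.I) ∂P =
      Complex.exp ((-(rectIncr (covFun X P) s t s t) / 2 : ℝ)) := by
  have h1 := (hX.gaussian.hasGaussianLaw_fun_sub (s := t) (t := s)).map_fun
    (EuclideanSpace.proj (𝕜 := ℝ) (0 : Fin d))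
  have hm : ∀ t, Integrable (fun ω => X t ω 0) P := fun t =>
    (memLp_component X P t 0).integrable one_le_two
  have h1' : HasGaussianLaw (fun ω => X t ω 0 - X s ω 0) P := by simpa using h1
  have h2 := h1'.charFun_map_eq (1 : ℝ)
  have hmean : ∫ ω, (X t ω 0 - X s ω 0) ∂P = 0 := by
    rw [integral_sub (hm t) (hm s), hX.centered, hX.centered, sub_zero]
  have hvar : Var[fun ω => X t ω 0 - X s ω 0; P] = rectIncr (covFun X P) s t s t := by
    rw [variance_eq_integral (measurable_component_sub P s t 0).aemeasurable, hmean,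
      rectIncr_eq_integral]
    simp [sq]
  rw [charFun_apply_real, integral_map (measurable_component_sub P s t 0).aemeasurable
    (by fun_prop)] at h2
  simp only [Complex.ofReal_one, one_mul] at h2
  rw [h2]
  simp only [RCLike.inner_apply, conj_trivial, mul_one, hmean, hvar]
  congr 1
  push_cast
  ring

/-- A continuous Gaussian process is continuous in mean square. -/
lemma tendsto_rectIncr_self (s : unitInterval) :
    Tendsto (fun t => rectIncr (covFun X P) s t s t) (𝓝 s) (𝓝 0) := by
  have h1 : Tendsto (fun t => ∫ ω, Complex.exp ((X t ω 0 - X s ω 0 : ℝ) * Complex.I) ∂P) (𝓝 s)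
      (𝓝 (∫ ω, (1 : ℂ) ∂P)) := by
    refine tendsto_integral_filter_of_dominated_convergence (fun _ => 1)
      (Eventually.of_forall fun t => ?_) (Eventually.of_forall fun t => ae_of_all _ fun ω => ?_)
      (integrable_const _) ?_
    · exact (Complex.measurable_exp.comp ((Complex.measurable_ofReal.comp
        (measurable_component_sub P s t 0)).mul_const _)).aestronglyMeasurable
    · rw [Complex.norm_exp_ofReal_mul_I]
    · filter_upwards [hX.continuous] with ω hω
      have hc : Continuous fun t => X t ω 0 :=
        (EuclideanSpace.proj (𝕜 := ℝ) (0 : Fin d)).continuous.comp hω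
      have : Continuous fun t => Complex.exp ((X t ω 0 - X s ω 0 : ℝ) * Complex.I) := by
        fun_prop
      simpa using this.tendsto s
  simp_rw [integral_cexp_increment] at h1
  have h2 := (Complex.continuous_re.tendsto _).comp h1
  simp only [Function.comp_def, Complex.exp_ofReal_re, integral_const, probReal_univ,
    one_smul, Complex.one_re] at h2
  have h3 := (Real.continuousAt_log one_ne_zero).tendsto.comp h2
  simp only [Function.comp_def, Real.log_exp, Real.log_one] at h3
  have h4 := h3.const_mul (-2)
  simp only [mul_zero] at h4
  exact h4.congr fun t => by ring

lemma continuous_kerFun (u : EuclideanSpace ℝ (Fin d)) :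
    Continuous fun t => RKHS.kerFun (CameronMartin X P) t u := by
  refine continuous_iff_continuousAt.2 fun s => tendsto_iff_norm_sub_tendsto_zero.2 ?_
  have h1 : ∀ t, ‖RKHS.kerFun (CameronMartin X P) t u - RKHS.kerFun (CameronMartin X P) s u‖ =
      √(rectIncr (covFun X P) s t s t * ‖u‖ ^ 2) := by
    intro t
    rw [← real_inner_self_eq_norm_sq, ← inner_kerIncr_kerIncr, real_inner_self_eq_norm_sq,
      Real.sqrt_sq (norm_nonneg _), kerIncr]
  simp_rw [h1]
  have := ((tendsto_rectIncr_self (X := X) (P := P) s).mul_const (‖u‖ ^ 2)).sqrt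
  simpa using this

lemma CameronMartin.continuous (h : CameronMartin X P) : Continuous fun t => h t := by
  have hj : ∀ j, Continuous fun t => h t j := by
    intro j
    have : ∀ t, h t j = ⟪RKHS.kerFun (CameronMartin X P) t (EuclideanSpace.single j 1), h⟫_ℝ := by
      intro t
      rw [RKHS.kerFun_inner, EuclideanSpace.inner_single_left]; simp
    simp_rw [this]
    exact (continuous_kerFun _).inner continuous_const
  exact (PiLp.continuous_toLp 2 _).comp (continuous_pi hj)

lemma continuous_covFun : Continuous fun p : unitInterval × unitInterval =>
    covFun X P p.1 p.2 := by
  have : ∀ p : unitInterval × unitInterval, covFun X P p.1 p.2 =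
      ⟪RKHS.kerFun (CameronMartin X P) p.1 (EuclideanSpace.single 0 1),
        RKHS.kerFun (CameronMartin X P) p.2 (EuclideanSpace.single 0 1)⟫_ℝ := by
    intro p
    rw [inner_kerFun_kerFun]; simp
  simp_rw [this]
  exact ((continuous_kerFun _).comp continuous_fst).inner
    ((continuous_kerFun _).comp continuous_snd)

end Kernel

/-! ### Cameron–Martin paths have finite variation -/

section Embedding

open Filter Topology

variable {Ω : Type*} [MeasurableSpace Ω] {d : ℕ} [NeZero d]
  {X : unitInterval → Ω → EuclideanSpace ℝ (Fin d)} {P : Measure Ω}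

/-- Finite mixed `(1,ρ)`-variation, with an exponent larger than `1` so as to have a finite
conjugate exponent. -/
lemma exists_sum_rpow_rectIncr_le
    (hmix : ∃ ρ : ℝ, 1 ≤ ρ ∧ ρ < 2 ∧ mixedVariation 1 ρ (covFun X P) 0 1 0 1 < ⊤) :
    ∃ r > (1 : ℝ), ∃ B, 0 ≤ B ∧ ∀ (N : ℕ) (τ : ℕ → unitInterval), IsDissection 0 1 N τ →
      ∑ j ∈ Finset.range N, (∑ i ∈ Finset.range N,
        |rectIncr (covFun X P) (τ i) (τ (i + 1)) (τ j) (τ (j + 1))|) ^ r ≤ B := by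
  obtain ⟨ρ, hρ1, hρ2, hfin⟩ := hmix
  set M := mixedVariation 1 ρ (covFun X P) 0 1 0 1 with hM
  have hρ0 : 0 < ρ := by linarith
  set B := M.toReal ^ ρ with hB
  have hB0 : 0 ≤ B := Real.rpow_nonneg ENNReal.toReal_nonneg _
  refine ⟨ρ + 1, by linarith, B * (1 + B), by positivity, fun N τ hτ => ?_⟩
  set x : ℕ → ℝ := fun j => ∑ i ∈ Finset.range N,
        |rectIncr (covFun X P) (τ i) (τ (i + 1)) (τ j) (τ (j + 1))| with hx
  have hx0 : ∀ j, 0 ≤ x j := fun j => Finset.sum_nonneg fun i _ => abs_nonneg _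
  have hs0 : 0 ≤ ∑ j ∈ Finset.range N, x j ^ ρ :=
    Finset.sum_nonneg fun j _ => Real.rpow_nonneg (hx0 j) _
  have h1 : ∑ j ∈ Finset.range N, x j ^ ρ ≤ B := by
    have h2 : ENNReal.ofReal ((∑ j ∈ Finset.range N, x j ^ ρ) ^ (1 / ρ)) ≤ M := by
      rw [hM, mixedVariation]
      refine le_trans (le_of_eq ?_) (le_iSup_of_le N <| le_iSup_of_le N <| le_iSup_of_le τ <|
        le_iSup_of_le τ <| le_iSup_of_le hτ <| le_iSup_of_le hτ le_rfl)
      simp [hx]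
    have h3 := (ENNReal.ofReal_le_iff_le_toReal hfin.ne).1 h2
    have h4 := Real.rpow_le_rpow (Real.rpow_nonneg hs0 _) h3 hρ0.le
    rwa [← Real.rpow_mul hs0, one_div_mul_cancel hρ0.ne', Real.rpow_one] at h4
  have h5 : ∀ j ∈ Finset.range N, x j ≤ 1 + B := by
    intro j hj
    have h6 := (Finset.single_le_sum (f := fun j => x j ^ ρ)
      (fun j _ => Real.rpow_nonneg (hx0 j) _) hj).trans h1
    rcases le_total (x j) 1 with h | h
    · linarith
    · have := Real.rpow_le_rpow_of_exponent_le h hρ1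
      rw [Real.rpow_one] at this
      linarith
  calc ∑ j ∈ Finset.range N, x j ^ (ρ + 1) ≤ ∑ j ∈ Finset.range N, x j ^ ρ * (1 + B) := by
        refine Finset.sum_le_sum fun j hj => ?_
        rw [Real.rpow_add_one' (hx0 j) (by linarith)]
        exact mul_le_mul_of_nonneg_left (h5 j hj) (Real.rpow_nonneg (hx0 j) _)
    _ = (∑ j ∈ Finset.range N, x j ^ ρ) * (1 + B) := by rw [Finset.sum_mul]
    _ ≤ B * (1 + B) := by gcongr

variable [hX : IsContinuousCenteredGaussianIID X P]

/-- If the sums `x_j = ∑_i |R_ij|` are bounded in `ℓ^r`, then by Schur's test and Hölder's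
inequality `(R_ij)` is bounded from `ℓ^{p/(p-1)}` to its dual, where `p = 2r/(1+r)`; testing a path
against its own increments, weighted so that the pairing is the `p`-variation sum, then bounds
that sum by the norm of the path. -/
lemma varSum_le_norm_rpow {r B : ℝ} (hr : 1 < r) (hB : 0 ≤ B) {N : ℕ} {τ : ℕ → unitInterval}
    (hR : ∑ j ∈ Finset.range N, (∑ i ∈ Finset.range N,
        |rectIncr (covFun X P) (τ i) (τ (i + 1)) (τ j) (τ (j + 1))|) ^ r ≤ B)
    (h : CameronMartin X P) :
    varSum (fun t => h t) (2 * r / (1 + r)) N τ ≤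
      (B ^ (1 / (2 * r))) ^ (2 * r / (1 + r)) * ‖h‖ ^ (2 * r / (1 + r)) := by
  set p := 2 * r / (1 + r) with hp
  have hr0 : 0 < r := by linarith
  have hr1 : 0 < 1 + r := by linarith
  have hp0 : 0 < p := by positivity
  have hp1 : p - 1 = (r - 1) / (1 + r) := by rw [hp]; field_simp; ring
  have hp1' : 0 < p - 1 := by rw [hp1]; exact div_pos (by linarith) hr1
  set R : ℕ → ℕ → ℝ := fun i j =>
    rectIncr (covFun X P) (τ i) (τ (i + 1)) (τ j) (τ (j + 1)) with hRdef
  have hsym : ∀ i j, R i j = R j i := fun i j => rectIncr_comm X P _ _ _ _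
  set Δ : ℕ → EuclideanSpace ℝ (Fin d) := fun i => h (τ (i + 1)) - h (τ i) with hΔ
  set a : ℕ → ℝ := fun i => ‖Δ i‖ ^ (p - 1) with ha
  have ha0 : ∀ i, 0 ≤ a i := fun i => Real.rpow_nonneg (norm_nonneg _) _
  set u : ℕ → EuclideanSpace ℝ (Fin d) := fun i => (‖Δ i‖ ^ (p - 2)) • Δ i with hu
  have hun : ∀ i, ‖u i‖ ≤ a i := by
    intro i
    rcases eq_or_ne (Δ i) 0 with h0 | h0
    · simp only [hu, h0, smul_zero, norm_zero]; exact ha0 i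
    · have h1 : 0 < ‖Δ i‖ := norm_pos_iff.2 h0
      simp only [hu, ha, norm_smul, Real.norm_eq_abs, abs_of_nonneg (Real.rpow_nonneg h1.le _)]
      rw [← Real.rpow_add_one h1.ne']
      exact le_of_eq (by ring_nf)
  have hui : ∀ i, ⟪u i, Δ i⟫_ℝ = ‖Δ i‖ ^ p := by
    intro i
    rcases eq_or_ne (Δ i) 0 with h0 | h0
    · simp [h0, Real.zero_rpow hp0.ne']
    · have h1 : 0 < ‖Δ i‖ := norm_pos_iff.2 h0
      simp only [hu, real_inner_smul_left, real_inner_self_eq_norm_sq]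
      rw [← Real.rpow_natCast, ← Real.rpow_add h1]
      norm_num
  set S := varSum (fun t => h t) p N τ with hS
  have hSe : S = ∑ i ∈ Finset.range N, ‖Δ i‖ ^ p := rfl
  have hS0 : 0 ≤ S := varSum_nonneg _ _ _ _
  set w := ∑ i ∈ Finset.range N, kerIncr X P (τ i) (τ (i + 1)) (u i) with hw
  have hSw : S = ⟪w, h⟫_ℝ := by
    rw [hw, sum_inner, hSe]
    exact Finset.sum_congr rfl fun i _ => by rw [inner_kerIncr, hui]
  have hw2 : ‖w‖ ^ 2 ≤ S ^ (2 * (p - 1) / p) * B ^ (1 / r) := by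
    rw [hw, norm_sq_sum_kerIncr]
    calc _ ≤ ∑ i ∈ Finset.range N, ∑ j ∈ Finset.range N,
          (|R i j| * (a i ^ 2 / 2) + |R i j| * (a j ^ 2 / 2)) := by
          refine Finset.sum_le_sum fun i _ => Finset.sum_le_sum fun j _ => ?_
          calc _ ≤ |R i j| * (a i * a j) := by
                refine (le_abs_self _).trans ?_
                rw [abs_mul]
                gcongr
                exact (abs_real_inner_le_norm _ _).trans
                  (mul_le_mul (hun i) (hun j) (norm_nonneg _) (ha0 i))
            _ ≤ |R i j| * (a i ^ 2 / 2 + a j ^ 2 / 2) := by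
                gcongr
                nlinarith [sq_nonneg (a i - a j)]
            _ = _ := by ring
      _ = ∑ j ∈ Finset.range N, a j ^ 2 * ∑ i ∈ Finset.range N, |R i j| := by
          simp only [Finset.sum_add_distrib]
          rw [Finset.sum_comm (f := fun i j => |R i j| * (a j ^ 2 / 2)), ← Finset.sum_add_distrib]
          refine Finset.sum_congr rfl fun j _ => ?_
          simp only [hsym j]
          rw [← Finset.sum_mul]
          ring
      _ ≤ (∑ j ∈ Finset.range N, |a j ^ 2| ^ (r / (r - 1))) ^ (1 / (r / (r - 1))) *
          (∑ j ∈ Finset.range N, |(∑ i ∈ Finset.range N, |R i j|)| ^ r) ^ (1 / r) :=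
          Real.inner_le_Lp_mul_Lq _ _ _ (Real.HolderConjugate.conjExponent hr).symm
      _ ≤ _ := by
          have e1 : ∀ j, |a j ^ 2| ^ (r / (r - 1)) = ‖Δ j‖ ^ p := by
            intro j
            rw [abs_of_nonneg (sq_nonneg _), ha]
            simp only
            rw [← Real.rpow_natCast, ← Real.rpow_mul (norm_nonneg _),
              ← Real.rpow_mul (norm_nonneg _)]
            congr 1
            have : r - 1 ≠ 0 := by linarith
            rw [hp1, hp]; push_cast; field_simp
          have e2 : 1 / (r / (r - 1)) = 2 * (p - 1) / p := by
            rw [hp1, hp]; field_simp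
          simp only [e1, e2, abs_of_nonneg (Finset.sum_nonneg fun i _ => abs_nonneg (R i _))]
          rw [← hSe]
          gcongr
  rcases hS0.eq_or_lt with h0 | h0
  · rw [← h0]; positivity
  have h1 : S ≤ ‖w‖ * ‖h‖ := hSw ▸ real_inner_le_norm _ _
  have h2 : ‖w‖ ≤ S ^ ((p - 1) / p) * B ^ (1 / (2 * r)) := by
    refine (pow_le_pow_iff_left₀ (norm_nonneg _) (by positivity) two_ne_zero).1 ?_
    refine hw2.trans (le_of_eq ?_)
    rw [mul_pow, ← Real.rpow_natCast (S ^ _), ← Real.rpow_natCast (B ^ _), ← Real.rpow_mul hS0,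
      ← Real.rpow_mul hB]
    congr 2 <;> push_cast <;> field_simp
  have h3 : S ^ (1 / p) ≤ B ^ (1 / (2 * r)) * ‖h‖ := by
    have h4 : S ^ (1 / p) * S ^ ((p - 1) / p) = S := by
      rw [← Real.rpow_add h0, ← add_div, add_sub_cancel, div_self hp0.ne', Real.rpow_one]
    have h5 : 0 < S ^ ((p - 1) / p) := Real.rpow_pos_of_pos h0 _
    refine le_of_mul_le_mul_right ?_ h5
    rw [h4]
    refine h1.trans ((mul_le_mul_of_nonneg_right h2 (norm_nonneg _)).trans (le_of_eq (by ring)))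
  have h6 := Real.rpow_le_rpow (Real.rpow_nonneg hS0 _) h3 hp0.le
  rwa [← Real.rpow_mul hS0, one_div_mul_cancel hp0.ne', Real.rpow_one,
    Real.mul_rpow (by positivity) (norm_nonneg _)] at h6

/-- Cameron–Martin paths have finite `p`-variation for some `p < 2`, with a bound in terms of
their norm. -/
theorem exists_varEmbedding [IsProbabilityMeasure P]
    (hmix : ∃ ρ : ℝ, 1 ≤ ρ ∧ ρ < 2 ∧ mixedVariation 1 ρ (covFun X P) 0 1 0 1 < ⊤) :
    ∃ p C : ℝ, 1 ≤ p ∧ p < 2 ∧ VarEmbedding (CameronMartin X P) p C := by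
  obtain ⟨r, hr, B, hB, hR⟩ := exists_sum_rpow_rectIncr_le hmix
  refine ⟨2 * r / (1 + r), _, ?_, ?_, fun h => ⟨CameronMartin.continuous h, fun N τ hτ =>
    varSum_le_norm_rpow hr hB (hR N τ hτ) h⟩⟩
  · rw [le_div_iff₀ (by linarith)]; linarith
  · rw [div_lt_iff₀ (by linarith)]; linarith

end Embedding

/-! ### Lower bounds for the norm of combinations of increments -/

section LowerBound

open Filter Topology

/-- By continuity, an inequality for strict chains holds for weak ones. -/
lemma nonneg_of_strict_chain {f : unitInterval → unitInterval → unitInterval → unitInterval → ℝ}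
    (hf : Continuous fun p : unitInterval × unitInterval × unitInterval × unitInterval =>
      f p.1 p.2.1 p.2.2.1 p.2.2.2)
    (h : ∀ a b c e, a < b → b < c → c < e → 0 ≤ f a b c e) {a b c e : unitInterval}
    (hab : a ≤ b) (hbc : b ≤ c) (hce : c ≤ e) : 0 ≤ f a b c e := by
  -- perturb the four points towards four distinct ones
  let u : ℕ → unitInterval := fun k => ⟨1 / (k + 1 : ℝ), by positivity, by
    rw [div_le_one (by positivity)]; linarith [(Nat.cast_nonneg k : (0 : ℝ) ≤ k)]⟩
  have hu : Tendsto u atTop (𝓝 0) :=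
    tendsto_subtype_rng.2 (tendsto_one_div_add_atTop_nhds_zero_nat (𝕜 := ℝ))
  have hseg : ∀ s t, Tendsto (fun k => segPt s t (u k)) atTop (𝓝 s) := fun s t => by
    have := ((segPt_continuous s t).tendsto 0).comp hu
    rwa [segPt_zero] at this
  have hlt : ∀ {s s' t t' : unitInterval}, s ≤ s' → t < t' → ∀ k,
      segPt s t (u k) < segPt s' t' (u k) := by
    intro s s' t t' hs ht k
    apply Subtype.mk_lt_mk.2
    have h1 : (s : ℝ) ≤ s' := hs
    have h2 : (t : ℝ) < t' := ht
    have h3 : (0 : ℝ) < u k := by simp only [u]; positivity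
    have h4 : ((u k : unitInterval) : ℝ) ≤ 1 := (u k).2.2
    nlinarith
  let q : ℕ → unitInterval := fun i => gridPt 4 i
  have hq : ∀ i < 4, q i < q (i + 1) := by
    intro i hi
    apply Subtype.mk_lt_mk.2
    interval_cases i <;> norm_num
  have hlim := (hf.tendsto (a, b, c, e)).comp ((hseg a (q 0)).prodMk_nhds
    ((hseg b (q 1)).prodMk_nhds ((hseg c (q 2)).prodMk_nhds (hseg e (q 3)))))
  exact ge_of_tendsto hlim (Eventually.of_forall fun k => h _ _ _ _ (hlt hab (hq 0 (by norm_num)) k)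
    (hlt hbc (hq 1 (by norm_num)) k) (hlt hce (hq 2 (by norm_num)) k))

/-- Contractions decrease the quadratic form of a symmetric matrix with non-positive off-diagonal
entries and non-negative row sums. -/
lemma dirichletForm_contraction {N : ℕ} {Q : ℕ → ℕ → ℝ} (hsym : ∀ i l, Q i l = Q l i)
    (hoff : ∀ i < N, ∀ l < N, i ≠ l → Q i l ≤ 0)
    (hrow : ∀ i < N, 0 ≤ ∑ l ∈ Finset.range N, Q i l) {f g : ℕ → ℝ}
    (hfg : ∀ i l, |f i - f l| ≤ |g i - g l|) (hfg' : ∀ i, |f i| ≤ |g i|) :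
    ∑ i ∈ Finset.range N, ∑ l ∈ Finset.range N, Q i l * (f i * f l) ≤
      ∑ i ∈ Finset.range N, ∑ l ∈ Finset.range N, Q i l * (g i * g l) := by
  have key : ∀ g : ℕ → ℝ, ∑ i ∈ Finset.range N, ∑ l ∈ Finset.range N, Q i l * (g i * g l) =
      ∑ i ∈ Finset.range N, ((∑ l ∈ Finset.range N, Q i l) * g i ^ 2 +
        ∑ l ∈ Finset.range N, -Q i l / 2 * (g i - g l) ^ 2) := by
    intro g
    have h1 : ∑ i ∈ Finset.range N, ∑ l ∈ Finset.range N, Q i l * g l ^ 2 =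
        ∑ i ∈ Finset.range N, ∑ l ∈ Finset.range N, Q i l * g i ^ 2 := by
      rw [Finset.sum_comm]
      exact Finset.sum_congr rfl fun i _ => Finset.sum_congr rfl fun l _ => by rw [hsym]
    have h2 : ∀ i l, Q i l * (g i * g l) =
        Q i l * g i ^ 2 + -Q i l / 2 * (g i - g l) ^ 2 +
          1 / 2 * (Q i l * g l ^ 2) - 1 / 2 * (Q i l * g i ^ 2) := by
      intro i l; ring
    simp_rw [h2, Finset.sum_sub_distrib, Finset.sum_add_distrib, ← Finset.mul_sum, h1,
      Finset.sum_mul]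
    ring
  rw [key f, key g]
  refine Finset.sum_le_sum fun i hi => add_le_add ?_ (Finset.sum_le_sum fun l hl => ?_)
  · exact mul_le_mul_of_nonneg_left (sq_le_sq.2 (hfg' i)) (hrow i (Finset.mem_range.1 hi))
  · rcases eq_or_ne i l with rfl | hil
    · simp
    · exact mul_le_mul_of_nonneg_left (sq_le_sq.2 (hfg i l))
        (by linarith [hoff i (Finset.mem_range.1 hi) l (Finset.mem_range.1 hl) hil])

variable {Ω : Type*} [mΩ : MeasurableSpace Ω]

/-- Adding an `m`-measurable variable to `U` cannot make it smaller, in mean square, than the part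
of `U` that `m` leaves undetermined. -/
lemma integral_condVar_le {P : Measure Ω} [IsProbabilityMeasure P] {m : MeasurableSpace Ω}
    (hm : m ≤ mΩ) {U Z : Ω → ℝ} (hU : MemLp U 2 P) (hZ : MemLp Z 2 P)
    (hZm : Measurable[m] Z) :
    ∫ ω, condVar m U P ω ∂P ≤ ∫ ω, (U ω + Z ω) ^ 2 ∂P := by
  have hUi := hU.integrable one_le_two
  have hZi := hZ.integrable one_le_two
  have h1 : P[U + Z | m] =ᵐ[P] P[U | m] + Z := by
    have := condExp_add (m := m) hUi hZi
    rwa [condExp_of_stronglyMeasurable hm hZm.stronglyMeasurable hZi] at this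
  have h2 : condVar m U P =ᵐ[P] condVar m (U + Z) P := by
    refine condExp_congr_ae ?_
    filter_upwards [h1] with ω hω
    simp only [Pi.pow_apply, Pi.sub_apply, Pi.add_apply, hω]
    ring
  have h3 := condVar_ae_le_condExp_sq (m := m) hm (hU.add hZ)
  rw [integral_congr_ae h2]
  refine (integral_mono_ae integrable_condVar integrable_condExp h3).trans ?_
  rw [integral_condExp hm]
  exact le_of_eq rfl

lemma incrSigma_le {d : ℕ} {X : unitInterval → Ω → EuclideanSpace ℝ (Fin d)}
    (hmeas : ∀ t, Measurable (X t)) (a b : unitInterval) : incrSigma X a b ≤ mΩ :=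
  iSup_le fun u => iSup_le fun v => iSup_le fun _ =>
    ((hmeas v).sub (hmeas u)).comap_le

variable {d : ℕ} [NeZero d] {X : unitInterval → Ω → EuclideanSpace ℝ (Fin d)} {P : Measure Ω}

lemma sum_rectIncr (a b : unitInterval) (τ : ℕ → unitInterval) (N : ℕ) :
    ∑ l ∈ Finset.range N, rectIncr (covFun X P) a b (τ l) (τ (l + 1)) =
      rectIncr (covFun X P) a b (τ 0) (τ N) := by
  induction N with
  | zero => simp [rectIncr]
  | succ N ih => rw [Finset.sum_range_succ, ih]; simp only [rectIncr]; ring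

variable [hX : IsContinuousCenteredGaussianIID X P]

lemma sum_rectIncr_mul_eq_integral (τ : ℕ → unitInterval) (N : ℕ) (f : ℕ → ℝ) :
    ∑ i ∈ Finset.range N, ∑ l ∈ Finset.range N,
      rectIncr (covFun X P) (τ i) (τ (i + 1)) (τ l) (τ (l + 1)) * (f i * f l) =
    ∫ ω, (∑ i ∈ Finset.range N, f i * (X (τ (i + 1)) ω 0 - X (τ i) ω 0)) ^ 2 ∂P := by
  have hint : ∀ i l, Integrable (fun ω => f i * f l *
      ((X (τ (i + 1)) ω 0 - X (τ i) ω 0) * (X (τ (l + 1)) ω 0 - X (τ l) ω 0))) P := fun i l =>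
    (((memLp_component X P _ 0).sub (memLp_component X P _ 0)).integrable_mul
      ((memLp_component X P _ 0).sub (memLp_component X P _ 0))).const_mul _
  have : ∀ ω, (∑ i ∈ Finset.range N, f i * (X (τ (i + 1)) ω 0 - X (τ i) ω 0)) ^ 2 =
      ∑ i ∈ Finset.range N, ∑ l ∈ Finset.range N, f i * f l *
        ((X (τ (i + 1)) ω 0 - X (τ i) ω 0) * (X (τ (l + 1)) ω 0 - X (τ l) ω 0)) := by
    intro ω
    rw [sq, Finset.sum_mul_sum]
    exact Finset.sum_congr rfl fun i _ => Finset.sum_congr rfl fun l _ => by ring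
  simp_rw [this]
  rw [integral_finsetSum _ fun i _ => integrable_finsetSum _ fun l _ => hint i l]
  refine Finset.sum_congr rfl fun i _ => ?_
  rw [integral_finsetSum _ fun l _ => hint i l]
  refine Finset.sum_congr rfl fun l _ => ?_
  rw [integral_const_mul, ← rectIncr_eq_integral, mul_comm]

variable [IsProbabilityMeasure P]

lemma continuous_rectIncr : Continuous
    fun p : unitInterval × unitInterval × unitInterval × unitInterval =>
      rectIncr (covFun X P) p.1 p.2.1 p.2.2.1 p.2.2.2 := by
  have h := continuous_covFun (X := X) (P := P)
  have h' : ∀ f g : unitInterval × unitInterval × unitInterval × unitInterval → unitInterval,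
      Continuous f → Continuous g → Continuous fun p => covFun X P (f p) (g p) :=
    fun f g hf hg => h.comp (hf.prodMk hg)
  have h1 := continuous_fst (X := unitInterval) (Y := unitInterval × unitInterval × unitInterval)
  have h2 : Continuous fun p : unitInterval × unitInterval × unitInterval × unitInterval =>
    p.2.1 := by fun_prop
  have h3 : Continuous fun p : unitInterval × unitInterval × unitInterval × unitInterval =>
    p.2.2.1 := by fun_prop
  have h4 : Continuous fun p : unitInterval × unitInterval × unitInterval × unitInterval =>
    p.2.2.2 := by fun_prop
  exact (((h' _ _ h2 h4).sub (h' _ _ h2 h3)).sub (h' _ _ h1 h4)).add (h' _ _ h1 h3)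

lemma rectIncr_nonpos (hneg : NonPosCorrelatedIncrements (covFun X P)) {a b c e : unitInterval}
    (hab : a ≤ b) (hbc : b ≤ c) (hce : c ≤ e) : rectIncr (covFun X P) a b c e ≤ 0 :=
  neg_nonneg.1 (nonneg_of_strict_chain (f := fun a b c e => -rectIncr (covFun X P) a b c e)
    continuous_rectIncr.neg (fun _ _ _ _ h1 h2 h3 => neg_nonneg.2 (hneg _ _ _ _ h1 h2 h3))
    hab hbc hce)

lemma rectIncr_zero_one_nonneg (hdiag : DiagonallyDominant (covFun X P)) {b c : unitInterval}
    (hbc : b ≤ c) : 0 ≤ rectIncr (covFun X P) b c 0 1 :=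
  nonneg_of_strict_chain (f := fun a b c e => rectIncr (covFun X P) b c a e)
    (continuous_rectIncr.comp (f := fun p : unitInterval × unitInterval × unitInterval ×
      unitInterval => (p.2.1, p.2.2.1, p.1, p.2.2.2)) (by fun_prop))
    (fun _ _ _ _ h1 h2 h3 => hdiag _ _ _ _ h1 h2 h3) unitInterval.nonneg' hbc
    unitInterval.le_one'

/-- A combination of increments which equals the plain increment over `[s,1]` there is at least as
large as the part of that increment which is not determined by the past. -/
lemma condVar_le_sum_rectIncr {κ : ℝ} {s : unitInterval}
    (hκ : ∀ᵐ ω ∂P, κ ≤ condVar (incrSigma X 0 s ⊔ incrSigma X 1 1)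
      (fun ω => X 1 ω 0 - X s ω 0) P ω) {N : ℕ} {τ : ℕ → unitInterval}
    (hτ : IsDissection 0 1 N τ) {q : ℕ} (hq : q ≤ N) (hqs : τ q = s) {f : ℕ → ℝ}
    (hf : ∀ i, q ≤ i → i < N → f i = 1) :
    κ ≤ ∑ i ∈ Finset.range N, ∑ l ∈ Finset.range N,
      rectIncr (covFun X P) (τ i) (τ (i + 1)) (τ l) (τ (l + 1)) * (f i * f l) := by
  have hm : incrSigma X 0 s ⊔ incrSigma X 1 1 ≤ mΩ :=
    sup_le (incrSigma_le hX.measurable _ _) (incrSigma_le hX.measurable _ _)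
  set Z : Ω → ℝ := fun ω => ∑ i ∈ Finset.range q, f i * (X (τ (i + 1)) ω 0 - X (τ i) ω 0) with hZ
  have hsub : ∀ i, MemLp (fun ω => X (τ (i + 1)) ω 0 - X (τ i) ω 0) 2 P := fun i =>
    (memLp_component X P _ 0).sub (memLp_component X P _ 0)
  have hZL : MemLp Z 2 P := memLp_finsetSum _ fun i _ => (hsub i).const_mul (f i)
  have hZm : Measurable[incrSigma X 0 s ⊔ incrSigma X 1 1] Z := by
    refine Finset.measurable_sum _ fun i hi => ?_
    refine Measurable.const_mul ?_ _
    have h1 : MeasurableSpace.comap (fun ω => X (τ (i + 1)) ω - X (τ i) ω) inferInstance ≤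
        incrSigma X 0 s ⊔ incrSigma X 1 1 := by
      refine le_trans ?_ le_sup_left
      refine le_iSup_of_le (τ i) <| le_iSup_of_le (τ (i + 1)) <| le_iSup_of_le
        ⟨unitInterval.nonneg', hτ.1 (Nat.le_succ i), ?_⟩ le_rfl
      rw [← hqs]
      exact hτ.1 (Finset.mem_range.1 hi)
    have h2 : Measurable[incrSigma X 0 s ⊔ incrSigma X 1 1]
        (fun ω => X (τ (i + 1)) ω - X (τ i) ω) := fun A hA => h1 _ ⟨A, hA, rfl⟩
    exact (EuclideanSpace.proj (𝕜 := ℝ) (0 : Fin d)).continuous.measurable.comp h2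
  have hU : MemLp (fun ω => X 1 ω 0 - X s ω 0) 2 P :=
    (memLp_component X P _ 0).sub (memLp_component X P _ 0)
  rw [sum_rectIncr_mul_eq_integral]
  have hsum : ∀ ω, ∑ i ∈ Finset.range N, f i * (X (τ (i + 1)) ω 0 - X (τ i) ω 0) =
      (X 1 ω 0 - X s ω 0) + Z ω := by
    intro ω
    rw [← Finset.sum_range_add_sum_Ico _ hq, add_comm, hZ]
    congr 1
    rw [← hτ.2.2, ← hqs, ← Finset.sum_Ico_sub (fun i => X (τ i) ω 0) hq]
    refine Finset.sum_congr rfl fun i hi => ?_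
    rw [hf i (Finset.mem_Ico.1 hi).1 (Finset.mem_Ico.1 hi).2, one_mul]
  simp_rw [hsum]
  refine le_trans ?_ (integral_condVar_le hm hU hZL hZm)
  have := integral_mono_ae (integrable_const κ) integrable_condVar hκ
  simpa using this

/-- A combination of increments, one coordinate of which is at least `b` on `[s,1]`, has norm
bounded below: clipping that coordinate to `[0,b]` decreases the norm. -/
lemma le_norm_sq_sum_kerIncr (hneg : NonPosCorrelatedIncrements (covFun X P))
    (hdiag : DiagonallyDominant (covFun X P)) {κ : ℝ} {s : unitInterval}
    (hκ : ∀ᵐ ω ∂P, κ ≤ condVar (incrSigma X 0 s ⊔ incrSigma X 1 1)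
      (fun ω => X 1 ω 0 - X s ω 0) P ω) {N : ℕ} {τ : ℕ → unitInterval}
    (hτ : IsDissection 0 1 N τ) {q : ℕ} (hq : q ≤ N) (hqs : τ q = s) {b : ℝ} (hb : 0 < b)
    {j : Fin d} {g : ℕ → EuclideanSpace ℝ (Fin d)} (hg : ∀ i, q ≤ i → i < N → b ≤ g i j) :
    b ^ 2 * κ ≤ ‖∑ i ∈ Finset.range N, kerIncr X P (τ i) (τ (i + 1)) (g i)‖ ^ 2 := by
  set Q : ℕ → ℕ → ℝ := fun i l =>
    rectIncr (covFun X P) (τ i) (τ (i + 1)) (τ l) (τ (l + 1)) with hQ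
  have hsym : ∀ i l, Q i l = Q l i := fun i l => rectIncr_comm X P _ _ _ _
  have hmono : ∀ i, τ i ≤ τ (i + 1) := fun i => hτ.1 (Nat.le_succ i)
  have hoff : ∀ i < N, ∀ l < N, i ≠ l → Q i l ≤ 0 := by
    have : ∀ i l, i < l → Q i l ≤ 0 := fun i l hil =>
      rectIncr_nonpos hneg (hmono i) (hτ.1 hil) (hmono l)
    intro i _ l _ hil
    rcases lt_or_gt_of_ne hil with h | h
    · exact this i l h
    · rw [hsym]; exact this l i h
  have hrow : ∀ i < N, 0 ≤ ∑ l ∈ Finset.range N, Q i l := by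
    intro i _
    simp only [hQ]
    rw [sum_rectIncr, hτ.2.1, hτ.2.2]
    exact rectIncr_zero_one_nonneg hdiag (hmono i)
  have hD := fun {f g : ℕ → ℝ} => dirichletForm_contraction (f := f) (g := g) hsym hoff hrow
  have hnn : ∀ g : ℕ → ℝ, 0 ≤ ∑ i ∈ Finset.range N, ∑ l ∈ Finset.range N, Q i l * (g i * g l) := by
    intro g
    simpa using hD (f := fun _ => 0) (g := g) (by simp) (by simp)
  set f : ℕ → ℝ := fun i => max 0 (min (g i j) b) with hf
  have h1 : κ ≤ ∑ i ∈ Finset.range N, ∑ l ∈ Finset.range N, Q i l * (f i / b * (f l / b)) :=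
    condVar_le_sum_rectIncr (X := X) (P := P) hκ hτ hq hqs (f := fun i => f i / b)
      (fun i hi hi' => by
      simp only [hf]
      rw [min_eq_right (hg i hi hi'), max_eq_right hb.le, div_self hb.ne'])
  have h2 : ∑ i ∈ Finset.range N, ∑ l ∈ Finset.range N, Q i l * (f i * f l) ≤
      ∑ i ∈ Finset.range N, ∑ l ∈ Finset.range N, Q i l * (g i j * g l j) := by
    refine hD (f := f) (g := fun i => g i j) (fun i l => ?_) fun i => ?_
    · simp only [hf]
      refine (abs_max_sub_max_le_max 0 _ 0 _).trans ?_
      have := abs_min_sub_min_le_max (g i j) b (g l j) b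
      simpa using this
    · simp only [hf]
      rw [abs_of_nonneg (le_max_left _ _)]
      exact max_le (abs_nonneg _) ((min_le_left _ _).trans (le_abs_self _))
  have h3 : b ^ 2 * ∑ i ∈ Finset.range N, ∑ l ∈ Finset.range N, Q i l * (f i / b * (f l / b)) =
      ∑ i ∈ Finset.range N, ∑ l ∈ Finset.range N, Q i l * (f i * f l) := by
    simp only [Finset.mul_sum]
    refine Finset.sum_congr rfl fun i _ => Finset.sum_congr rfl fun l _ => ?_
    field_simp
  have h4 : ‖∑ i ∈ Finset.range N, kerIncr X P (τ i) (τ (i + 1)) (g i)‖ ^ 2 =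
      ∑ j, ∑ i ∈ Finset.range N, ∑ l ∈ Finset.range N, Q i l * (g i j * g l j) := by
    rw [norm_sq_sum_kerIncr, Finset.sum_comm]
    conv_rhs => rw [Finset.sum_comm]
    rw [Finset.sum_comm]
    refine Finset.sum_congr rfl fun i _ => ?_
    conv_rhs => rw [Finset.sum_comm]
    refine Finset.sum_congr rfl fun l _ => ?_
    rw [← Finset.mul_sum, PiLp.inner_apply]
    refine congrArg _ (Finset.sum_congr rfl fun j _ => ?_)
    simp [mul_comm]
  calc b ^ 2 * κ ≤ _ := mul_le_mul_of_nonneg_left h1 (sq_nonneg b)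
    _ = _ := h3
    _ ≤ _ := h2
    _ ≤ _ := by
      rw [h4]
      exact Finset.single_le_sum (f := fun j => ∑ i ∈ Finset.range N, ∑ l ∈ Finset.range N,
        Q i l * (g i j * g l j)) (fun j _ => hnn fun i => g i j) (Finset.mem_univ j)

end LowerBound

/-! ### Integrands which do not vanish at time one -/

section Nondegenerate

open Filter Topology

lemma sum_range_two_mul {M : Type*} [AddCommMonoid M] (f : ℕ → M) (n : ℕ) :
    ∑ i ∈ Finset.range (2 * n), f i = ∑ i ∈ Finset.range n, (f (2 * i) + f (2 * i + 1)) := by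
  induction n with
  | zero => simp
  | succ n ih =>
    rw [show 2 * (n + 1) = 2 * n + 1 + 1 by ring, Finset.sum_range_succ, Finset.sum_range_succ, ih,
      Finset.sum_range_succ, add_assoc]

lemma gridPt_two_mul (n i : ℕ) : gridPt (2 * n) (2 * i) = gridPt n i := by
  apply Subtype.ext
  simp only [gridPt]
  push_cast
  rw [mul_div_mul_left _ _ (two_ne_zero)]

variable {Ω : Type*} [MeasurableSpace Ω] {d : ℕ} [NeZero d]
  {X : unitInterval → Ω → EuclideanSpace ℝ (Fin d)} {P : Measure Ω}
  [hX : IsContinuousCenteredGaussianIID X P]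

variable (X P) in
/-- The combinations of increments over the uniform grid with `n` cells, the `j`-th coordinate of
whose coefficients is at least `b` from the `q`-th cell on. -/
def stepCone (n q : ℕ) (b : ℝ) (j : Fin d) : Set (CameronMartin X P) :=
  {w | ∃ g : ℕ → EuclideanSpace ℝ (Fin d), (∀ i, q ≤ i → i < n → b ≤ g i j) ∧
    w = ∑ i ∈ Finset.range n, kerIncr X P (gridPt n i) (gridPt n (i + 1)) (g i)}

lemma kerIncr_add (a b : unitInterval) (u v : EuclideanSpace ℝ (Fin d)) :
    kerIncr X P a b (u + v) = kerIncr X P a b u + kerIncr X P a b v := by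
  simp only [kerIncr, map_add]; abel

lemma kerIncr_smul (a b : unitInterval) (r : ℝ) (u : EuclideanSpace ℝ (Fin d)) :
    kerIncr X P a b (r • u) = r • kerIncr X P a b u := by
  simp only [kerIncr, map_smul, smul_sub]

lemma kerIncr_add_kerIncr (a b c : unitInterval) (u : EuclideanSpace ℝ (Fin d)) :
    kerIncr X P a b u + kerIncr X P b c u = kerIncr X P a c u := by
  simp only [kerIncr]; abel

lemma convex_stepCone (n q : ℕ) (b : ℝ) (j : Fin d) : Convex ℝ (stepCone X P n q b j) := by
  rintro _ ⟨g, hg, rfl⟩ _ ⟨g', hg', rfl⟩ x y hx hy hxy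
  refine ⟨fun i => x • g i + y • g' i, fun i hi hi' => ?_, ?_⟩
  · have h1 := mul_le_mul_of_nonneg_left (hg i hi hi') hx
    have h2 := mul_le_mul_of_nonneg_left (hg' i hi hi') hy
    have h3 : b = x * b + y * b := by rw [← add_mul, hxy, one_mul]
    simp only [PiLp.add_apply, PiLp.smul_apply, smul_eq_mul]
    linarith
  · simp only [kerIncr_add, kerIncr_smul, Finset.sum_add_distrib, Finset.smul_sum]

lemma stepCone_subset (n q : ℕ) (b : ℝ) (j : Fin d) :
    stepCone X P n q b j ⊆ stepCone X P (2 * n) (2 * q) b j := by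
  rintro _ ⟨g, hg, rfl⟩
  refine ⟨fun i => g (i / 2), fun i hi hi' => hg _ (by omega) (by omega), ?_⟩
  rw [sum_range_two_mul]
  refine Finset.sum_congr rfl fun i _ => ?_
  have h1 : (2 * i + 1) / 2 = i := by omega
  have h2 : 2 * i / 2 = i := by omega
  simp only [h1, h2]
  rw [kerIncr_add_kerIncr, gridPt_two_mul, show 2 * i + 1 + 1 = 2 * (i + 1) by ring,
    gridPt_two_mul]

/-- The Young integrals of a continuous integrand which does not vanish at time `1` against
Cameron–Martin paths do not all vanish: the step functions which are at least `b > 0` near time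
`1` form a convex set which stays away from zero, so that the element of least norm of its closure
has a pairing bounded below with all of them. -/
theorem exists_le_sum_inner [IsProbabilityMeasure P]
    (hneg : NonPosCorrelatedIncrements (covFun X P))
    (hdiag : DiagonallyDominant (covFun X P)) (hnd : NonDeterministic X P)
    {F : unitInterval → EuclideanSpace ℝ (Fin d)} (hF : Continuous F) {j : Fin d}
    (hFj : 0 < F 1 j) :
    ∃ k : CameronMartin X P, ∃ η > 0, ∃ N₀ > 0, ∀ l : ℕ,
      η ≤ ∑ i ∈ Finset.range (2 ^ l * N₀), ⟪F (gridPt (2 ^ l * N₀) i),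
        k (gridPt (2 ^ l * N₀) (i + 1)) - k (gridPt (2 ^ l * N₀) i)⟫_ℝ := by
  obtain ⟨α, hα, c, hc, hcv⟩ := hnd
  set b := F 1 j / 2 with hb
  have hb0 : 0 < b := by positivity
  have hFc : Continuous fun t => F t j := by fun_prop
  obtain ⟨δ, hδ, hFδ⟩ := Metric.continuousAt_iff.1 (hFc.continuousAt (x := 1)) b hb0
  obtain ⟨m, hm⟩ := exists_nat_one_div_lt hδ
  have hm0 : (0 : ℝ) < m + 1 := by positivity
  set s := gridPt (m + 1) m with hs
  have hsv : (s : ℝ) = m / (m + 1) := by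
    simp only [hs, gridPt]
    push_cast
    exact min_eq_left ((div_le_one hm0).2 (by linarith))
  have hs1 : s < 1 := by
    apply Subtype.coe_lt_coe.1
    rw [hsv, Set.Icc.coe_one, div_lt_one hm0]
    linarith
  have hFb : ∀ t, s ≤ t → b ≤ F t j := by
    intro t ht
    have h1 : (s : ℝ) ≤ t := ht
    have h2 : 1 - (s : ℝ) < δ := by
      rw [hsv]
      refine lt_of_eq_of_lt ?_ hm
      rw [eq_div_iff hm0.ne', sub_mul, div_mul_cancel₀ _ hm0.ne']
      ring
    have h3 : dist t 1 < δ := by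
      rw [Subtype.dist_eq, Real.dist_eq, abs_sub_comm, Set.Icc.coe_one,
        abs_of_nonneg (by linarith [t.2.2])]
      linarith
    have h4 := hFδ h3
    rw [Real.dist_eq, abs_lt] at h4
    linarith [h4.1]
  set κ := c * ((1 : ℝ) - s) ^ α with hκ
  have hκ0 : 0 < κ := mul_pos hc (Real.rpow_pos_of_pos (sub_pos.2 hs1) _)
  have hgrid : ∀ l, gridPt (2 ^ l * (m + 1)) (2 ^ l * m) = s := by
    intro l
    induction l with
    | zero => simp [hs]
    | succ l ih => rw [pow_succ', mul_assoc, mul_assoc, gridPt_two_mul, ih]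
  set G : ℕ → Set (CameronMartin X P) := fun l =>
    stepCone X P (2 ^ l * (m + 1)) (2 ^ l * m) b j with hG
  have hGm : Monotone G := monotone_nat_of_le_succ fun l => by
    simp only [hG]
    rw [pow_succ', mul_assoc, mul_assoc]
    exact stepCone_subset _ _ _ _
  have hGn : ∀ l, ∀ w ∈ G l, b ^ 2 * κ ≤ ‖w‖ ^ 2 := by
    rintro l _ ⟨g, hg, rfl⟩
    exact le_norm_sq_sum_kerIncr hneg hdiag (hcv s 1 hs1 0)
      ⟨gridPt_mono _, gridPt_zero _, gridPt_self (by positivity)⟩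
      (Nat.mul_le_mul_left _ (Nat.le_succ m)) (hgrid l) hb0 hg
  have hFG : ∀ l, ∑ i ∈ Finset.range (2 ^ l * (m + 1)),
      kerIncr X P (gridPt (2 ^ l * (m + 1)) i) (gridPt (2 ^ l * (m + 1)) (i + 1))
        (F (gridPt (2 ^ l * (m + 1)) i)) ∈ G l := fun l =>
    ⟨fun i => F (gridPt _ i), fun i hi _ => hFb _ (by
      rw [← hgrid l]; exact gridPt_mono _ hi), rfl⟩
  set K := closure (⋃ l, G l) with hK
  have hKc : Convex ℝ K :=
    (hGm.directed_le.convex_iUnion fun l => convex_stepCone _ _ _ _).closure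
  have hKn : ∀ w ∈ K, b ^ 2 * κ ≤ ‖w‖ ^ 2 := by
    intro w hw
    have hcl : IsClosed {w : CameronMartin X P | b ^ 2 * κ ≤ ‖w‖ ^ 2} :=
      isClosed_le continuous_const (by fun_prop)
    exact closure_minimal (iUnion_subset fun l w hw => hGn l w hw) hcl hw
  have hKl : ∀ l, G l ⊆ K := fun l => (subset_iUnion G l).trans subset_closure
  obtain ⟨k, hkK, hk⟩ := exists_norm_eq_iInf_of_complete_convex ⟨_, hKl 0 (hFG 0)⟩
    isClosed_closure.isComplete hKc 0
  have hk' := (norm_eq_iInf_iff_real_inner_le_zero hKc hkK).1 hk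
  refine ⟨k, b ^ 2 * κ, by positivity, m + 1, by positivity, fun l => ?_⟩
  have h1 := hk' _ (hKl l (hFG l))
  rw [zero_sub, inner_neg_left, inner_sub_right, real_inner_self_eq_norm_sq,
    real_inner_comm, sum_inner] at h1
  simp only [inner_kerIncr] at h1
  linarith [hKn k hkK]

variable {n : ℕ} {V : Fin d → EuclideanSpace ℝ (Fin n) → EuclideanSpace ℝ (Fin n)}

/-- If the Riemann sums of a functional converge to it, and its integrand `⟨c, P V(y)⟩` does not
vanish at time `1`, then it is non-zero. -/
lemma exists_inner_pos [IsProbabilityMeasure P]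
    (hneg : NonPosCorrelatedIncrements (covFun X P))
    (hdiag : DiagonallyDominant (covFun X P)) (hnd : NonDeterministic X P)
    (hV : ∀ j, Continuous (V j)) {y : unitInterval → EuclideanSpace ℝ (Fin n)}
    {A : unitInterval → EuclideanSpace ℝ (Fin n) →L[ℝ] EuclideanSpace ℝ (Fin n)}
    (hy : Continuous y) (hA : Continuous A) (hA1 : A 1 = ContinuousLinearMap.id ℝ _)
    {D : CameronMartin X P →L[ℝ] EuclideanSpace ℝ (Fin n)}
    (hD : ∀ k : CameronMartin X P, Tendsto (fun N => riemannSum V y A N k) atTop (𝓝 (D k)))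
    {c : EuclideanSpace ℝ (Fin n)} {j : Fin d} (hc : 0 < ⟪c, V j (y 1)⟫_ℝ) :
    ∃ k, 0 < ⟪c, D k⟫_ℝ := by
  set F : unitInterval → EuclideanSpace ℝ (Fin d) := fun t =>
    WithLp.toLp 2 fun j => ⟪c, A t (V j (y t))⟫_ℝ with hF
  have hFc : Continuous F := by
    refine (PiLp.continuous_toLp 2 _).comp (continuous_pi fun j => ?_)
    exact continuous_const.inner (hA.clm_apply ((hV j).comp hy))
  have hF1 : 0 < F 1 j := by simpa [hF, hA1] using hc
  obtain ⟨k, η, hη, N₀, hN₀, hk⟩ := exists_le_sum_inner hneg hdiag hnd hFc hF1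
  refine ⟨k, hη.trans_le ?_⟩
  have hpow : Tendsto (fun l : ℕ => 2 ^ l * N₀) atTop atTop :=
    (tendsto_pow_atTop_atTop_of_one_lt one_lt_two).atTop_mul_const' hN₀
  have h1 : Tendsto (fun l : ℕ => ⟪c, riemannSum V y A (2 ^ l * N₀) k⟫_ℝ) atTop
      (𝓝 ⟪c, D k⟫_ℝ) := tendsto_const_nhds.inner ((hD k).comp hpow)
  refine ge_of_tendsto' h1 fun l => (hk l).trans (le_of_eq ?_)
  simp only [riemannSum, map_sum, inner_sum, hF, PiLp.inner_apply, map_smul, inner_smul_right]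
  refine Finset.sum_congr rfl fun i _ => Finset.sum_congr rfl fun j _ => ?_
  simp [mul_comm]

end Nondegenerate

/-! ### Non-degeneracy of the deterministic Malliavin matrix -/

section Malliavin

variable {H : Type*} [NormedAddCommGroup H] [InnerProductSpace ℝ H] [CompleteSpace H] {n : ℕ}

/-- The Gram matrix of the gradients of the components of a map is positive definite as soon as no
non-trivial combination of these components has vanishing derivative. -/
lemma det_gradient_pos {Φ : H → EuclideanSpace ℝ (Fin n)} {D : H →L[ℝ] EuclideanSpace ℝ (Fin n)}
    {h : H} (hD : HasFDerivAt Φ D h)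
    (hinj : ∀ c : EuclideanSpace ℝ (Fin n), c ≠ 0 → ∃ k, ⟪c, D k⟫_ℝ ≠ 0) :
    0 < (Matrix.of fun i j : Fin n =>
      ⟪gradient (fun k => Φ k i) h, gradient (fun k => Φ k j) h⟫_ℝ).det := by
  have hgrad : ∀ i k, ⟪gradient (fun k => Φ k i) h, k⟫_ℝ = D k i := by
    intro i k
    have h1 : HasFDerivAt (fun k => Φ k i) ((EuclideanSpace.proj (𝕜 := ℝ) i).comp D) h :=
      (EuclideanSpace.proj (𝕜 := ℝ) i).hasFDerivAt.comp h hD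
    rw [gradient, h1.fderiv, InnerProductSpace.toDual_symm_apply]
    rfl
  refine (Matrix.posDef_gram_of_linearIndependent (𝕜 := ℝ)
    (v := fun i => gradient (fun k => Φ k i) h) (Fintype.linearIndependent_iff.2 ?_)).det_pos
  intro c hc
  by_contra! hne
  obtain ⟨i, hi⟩ := hne
  obtain ⟨k, hk⟩ := hinj (WithLp.toLp 2 c) fun h0 => hi (by
    have := congrArg (fun v : EuclideanSpace ℝ (Fin n) => v i) h0
    simpa using this)
  refine hk ?_
  have h1 : ⟪∑ i, c i • gradient (fun k => Φ k i) h, k⟫_ℝ = 0 := by rw [hc, inner_zero_left]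
  rw [sum_inner] at h1
  simp only [inner_smul_left, hgrad] at h1
  rw [PiLp.inner_apply, ← h1]
  refine Finset.sum_congr rfl fun i _ => ?_
  simp [mul_comm]

end Malliavin

end GaussVaradhan

end

theorem lemma4p5 {Ω : Type*} [MeasurableSpace Ω] (P : Measure Ω) [IsProbabilityMeasure P]
    {d n : ℕ} [NeZero d] (X : unitInterval → Ω → EuclideanSpace ℝ (Fin d))
    [GaussVaradhan.IsContinuousCenteredGaussianIID X P]
    (hX0 : ∀ᵐ ω ∂P, X 0 ω = 0)
    (hmix : ∃ ρ : ℝ, 1 ≤ ρ ∧ ρ < 2 ∧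
      GaussVaradhan.mixedVariation 1 ρ (GaussVaradhan.covFun X P) 0 1 0 1 < ⊤)
    (hneg : GaussVaradhan.NonPosCorrelatedIncrements (GaussVaradhan.covFun X P))
    (hdiag : GaussVaradhan.DiagonallyDominant (GaussVaradhan.covFun X P))
    (hnd : GaussVaradhan.NonDeterministic X P)
    (V₀ : EuclideanSpace ℝ (Fin n) → EuclideanSpace ℝ (Fin n))
    (V : Fin d → EuclideanSpace ℝ (Fin n) → EuclideanSpace ℝ (Fin n))
    (hV₀ : GaussVaradhan.SmoothBounded V₀) (hV : ∀ j, GaussVaradhan.SmoothBounded (V j))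
    (hell : GaussVaradhan.UniformlyElliptic V)
    (z : EuclideanSpace ℝ (Fin n)) :
    (∀ h : GaussVaradhan.CameronMartin X P,
      ∃! φ, GaussVaradhan.IsSkeleton V₀ V z (fun t => h t) φ) ∧
    Differentiable ℝ (GaussVaradhan.skeletonOne X P V₀ V z) ∧
    (∀ h : GaussVaradhan.CameronMartin X P,
      0 < (GaussVaradhan.malliavinMatrix X P V₀ V z h).det) ∧
    ∀ y : EuclideanSpace ℝ (Fin n),
      GaussVaradhan.distSq X P V₀ V z y = GaussVaradhan.distSqR X P V₀ V z y := by
  obtain ⟨p, C, hp1, hp2, hH⟩ := GaussVaradhan.exists_varEmbedding hmix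
  have hder := fun h : GaussVaradhan.CameronMartin X P =>
    GaussVaradhan.skeleton_hasFDerivAt (z := z) hV₀ hV hp1 hp2 hH h
  have hdet : ∀ h : GaussVaradhan.CameronMartin X P,
      0 < (GaussVaradhan.malliavinMatrix X P V₀ V z h).det := by
    intro h
    obtain ⟨D, y, A, hy, hA, hA1, hD, hlim⟩ := hder h
    refine GaussVaradhan.det_gradient_pos (Φ := GaussVaradhan.skeletonOne X P V₀ V z) hD
      fun c hc => ?_
    -- by ellipticity, `c` is not orthogonal to all the vectors `V_j(y_1)`
    obtain ⟨j, hj⟩ : ∃ j, ⟪V j (y 1), c⟫_ℝ ≠ 0 := by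
      by_contra! h0
      obtain ⟨lam, hlam, hV⟩ := hell
      have h1 := hV c (y 1)
      simp only [h0, ne_eq, OfNat.ofNat_ne_zero, not_false_eq_true, zero_pow,
        Finset.sum_const_zero] at h1
      have : 0 < ‖c‖ := norm_pos_iff.2 hc
      exact absurd h1 (not_le.2 (by positivity))
    have hpos := fun {c : EuclideanSpace ℝ (Fin n)} =>
      GaussVaradhan.exists_inner_pos (c := c) (j := j) hneg hdiag hnd (fun j => (hV j).1.continuous)
        hy hA hA1 hlim
    rw [real_inner_comm] at hj
    rcases hj.lt_or_gt with hj | hj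
    · obtain ⟨k, hk⟩ := hpos (c := -c) (by rw [inner_neg_left]; linarith)
      rw [inner_neg_left] at hk
      exact ⟨k, by linarith⟩
    · obtain ⟨k, hk⟩ := hpos hj
      exact ⟨k, hk.ne'⟩
  refine ⟨fun h => ?_, fun h => ?_, hdet, fun y => ?_⟩
  · obtain ⟨φ, hφ⟩ := GaussVaradhan.isSkeleton_exists (z := z) hV₀ hV hp1 hp2 (hH.finiteVarPath h)
    exact ⟨φ, hφ, fun ψ hψ => hψ.unique hV₀ hV hp1 hp2 (hH.finiteVarPath h) hφ⟩
  · obtain ⟨D, -, -, -, -, -, hD, -⟩ := hder h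
    exact hD.differentiableAt
  · simp only [GaussVaradhan.distSq, GaussVaradhan.distSqR, hdet, iInf_true]
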